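/- A configuration of $n$ points is a set $\mathcal P$ of $n$ distinct points of $\mathbb{RP}^2$; the space of such configurations carries the quotient topology from ordered $n$-tuples of distinct points. It is *simple* if no three of its points are collinear, and *typical* if moreover no six of its points lie on a conic. A *Q-deformation* is a continuous path $\mathcal P^t$, $t\in[0,1]$, of typical configurations; it *takes* $p\in\mathcal P^0$ to $p'\in\mathcal P^1$ if there is a continuous choice of points $p^t\in\mathcal P^t$ with $p^0=p$, $p^1=p'$. The *Q-monodromy group* $\operatorname{Aut}_Q(\mathcal P)$ of a typical configuration is the group of permutations of $\mathcal P$ realized by Q-deformations of $\mathcal P$ to itself. The *adjacency graph* $\Gamma_{\mathcal P}$ has vertex set $\mathcal P$, and distinct points $p,q$ are adjacent iff one of the two segments of the projective line $pq$ with endpoints $p,q$ is met by none of the lines connecting pairs of the remaining points. A simple $6$-configuration is *cyclic* if $\Gamma_{\mathcal P}$ is connected, and *hexagonal* if its points are the vertices of a convex hexagon in the affine plane $\mathbb{RP}^2\smallsetminus\ell$ for some line $\ell$ disjoint from $\mathcal P$. A point $p$ of a typical $6$-configuration $\mathcal P$ is *dominant* if it lies outside the conic $Q_p$ through the other five points,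 i.e. not in the component of $\mathbb{RP}^2\smallsetminus Q_p$ homeomorphic to a disc. **Lemma.** 1. Let $\mathcal P^0,\mathcal P^1$ be hexagonal typical $6$-configurations with marked dominant points $p^i\in\mathcal P^i$, $i=0,1$. Then there is a Q-deformation from $\mathcal P^0$ to $\mathcal P^1$ that takes $p^0$ to $p^1$. 2. The space $QC^6_1$ of typical cyclic $6$-configurations is (non-empty and) path connected, and it is a single path component of the space of all typical $6$-configurations. 3. For every $\mathcal P\in QC^6_1$, $\operatorname{Aut}_Q(\mathcal P)$ is the group of all permutations of $\mathcal P$ that preserve both the graph $\Gamma_{\mathcal P}$ and the set of dominant points, and it is isomorphic to the dihedral group $\mathbb D_3$ of order $6$. -/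

import Mathlib

open scoped LinearAlgebra.Projectivization

noncomputable section

/-- The real projective plane. -/
abbrev RP2 : Type := ℙ ℝ (Fin 3 → ℝ)

/-- The quotient topology on the real projective plane, as a quotient of `ℝ³ ∖ {0}`. -/
instance RP2.instTopologicalSpace : TopologicalSpace RP2 :=
  TopologicalSpace.coinduced (Projectivization.mk' ℝ (V := Fin 3 → ℝ)) inferInstance

/-- An `n`-configuration: an (unordered) set of `n` points of the real projective plane. -/
def PointConfig (n : ℕ) : Type := {P : Finset RP2 // P.card = n}

namespace PointConfig

variable {n : ℕ}

instance : Membership RP2 (PointConfig n) := ⟨fun P p => p ∈ P.1⟩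

/-- The set of points of a configuration, as a type. -/
abbrev Pt (P : PointConfig n) : Type := {p : RP2 // p ∈ P}

/-- Forgetting the numeration of `n` distinct points. -/
def ofOrdered (f : {f : Fin n → RP2 // Function.Injective f}) : PointConfig n :=
  ⟨Finset.univ.map ⟨f.1, f.2⟩, by simp⟩

/-- The topology of the unordered configuration space: the quotient, by the permutations of the
numeration, of the space of ordered `n`-tuples of distinct points. -/
instance : TopologicalSpace (PointConfig n) :=
  TopologicalSpace.coinduced ofOrdered inferInstance

/-- Simple configurations: no triple of points is collinear. -/
def IsSimple (P : PointConfig n) : Prop :=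
  ∀ a ∈ P, ∀ b ∈ P, ∀ c ∈ P, a ≠ b → b ≠ c → a ≠ c →
    ¬ Projectivization.IsCollinear ({a, b, c} : Set RP2)

end PointConfig

/-- The conic in the projective plane defined by a quadratic form. -/
def conic (Q : QuadraticForm ℝ (Fin 3 → ℝ)) : Set RP2 := {x | Q x.rep = 0}

/-- `p` lies inside the conic: `p` is not on the conic and its component in the complement
of the conic is homeomorphic to an (open) disc. -/
def IsInsideConic (Q : QuadraticForm ℝ (Fin 3 → ℝ)) (p : RP2) : Prop :=
  p ∉ conic Q ∧ Nonempty (connectedComponentIn (conic Q)ᶜ p ≃ₜ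
    Metric.ball (0 : EuclideanSpace ℝ (Fin 2)) 1)

/-- `p` lies outside of the conic: it is neither on the conic nor inside it. -/
def IsOutsideConic (Q : QuadraticForm ℝ (Fin 3 → ℝ)) (p : RP2) : Prop :=
  p ∉ conic Q ∧ ¬ IsInsideConic Q p

/-- The projective segment formed by the points `[s u + t v]`, `s, t ≥ 0`. The two segments joining
distinct points `[u]`, `[v]` in the projective plane are `projSegment u v` and
`projSegment u (-v)`. -/
def projSegment (u v : Fin 3 → ℝ) : Set RP2 :=
  {x | ∃ s t : ℝ, 0 ≤ s ∧ 0 ≤ t ∧ ∃ h : s • u + t • v ≠ 0,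
    x = Projectivization.mk ℝ (s • u + t • v) h}

theorem projSegment_comm (u v : Fin 3 → ℝ) : projSegment u v = projSegment v u := by
  ext x
  constructor
  · rintro ⟨s, t, hs, ht, h, rfl⟩
    exact ⟨t, s, ht, hs, by rwa [add_comm], by simp only [add_comm]⟩
  · rintro ⟨s, t, hs, ht, h, rfl⟩
    exact ⟨t, s, ht, hs, by rwa [add_comm], by simp only [add_comm]⟩

namespace PointConfig

variable {n : ℕ}

/-- Typical configurations: simple ones with no six points on a conic. -/
def IsTypical (P : PointConfig n) : Prop :=
  P.IsSimple ∧ ¬ ∃ S : Finset RP2, S ⊆ P.1 ∧ S.card = 6 ∧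
    ∃ Q : QuadraticForm ℝ (Fin 3 → ℝ), Q ≠ 0 ∧ ∀ x ∈ S, x ∈ conic Q

/-- The adjacency graph: distinct points `p`, `q` are adjacent if and only if one of the segments
joining them is not crossed by any of the lines connecting pairs of the remaining points. -/
def adjacencyGraph (P : PointConfig n) : SimpleGraph P.Pt where
  Adj p q := p ≠ q ∧ ∃ (u v : Fin 3 → ℝ) (hu : u ≠ 0) (hv : v ≠ 0),
    Projectivization.mk ℝ u hu = p.1 ∧ Projectivization.mk ℝ v hv = q.1 ∧
    ∀ a b : P.Pt, a ≠ b → a ≠ p → a ≠ q → b ≠ p → b ≠ q →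
      ∀ x ∈ projSegment u v, ¬ Projectivization.IsCollinear ({a.1, b.1, x} : Set RP2)
  symm := by
    refine ⟨?_⟩
    rintro p q ⟨hne, u, v, hu, hv, h1, h2, h⟩
    refine ⟨hne.symm, v, u, hv, hu, h2, h1, ?_⟩
    intro a b hab hap haq hbp hbq x hx
    exact h a b hab haq hap hbq hbp x (by rwa [projSegment_comm])
  loopless := ⟨fun p h => h.1 rfl⟩

/-- Cyclic 6-configurations: simple ones with connected adjacency graph. -/
def IsCyclic (P : PointConfig 6) : Prop := P.IsSimple ∧ P.adjacencyGraph.Connected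

/-- The position of a point in the affine chart complementary to the line `ℓ = 0`, which is
identified with the affine plane `ℓ = 1` in `ℝ³` (for points not on that line). -/
def affinePoint (ℓ : (Fin 3 → ℝ) →ₗ[ℝ] ℝ) (p : RP2) : Fin 3 → ℝ := (ℓ p.rep)⁻¹ • p.rep

/-- Hexagonal 6-configurations: simple ones whose points are the vertices of a convex hexagon in the
complement of some projective line that is disjoint from the configuration. -/
def IsHexagonal (P : PointConfig 6) : Prop :=
  P.IsSimple ∧ ∃ ℓ : (Fin 3 → ℝ) →ₗ[ℝ] ℝ, (∀ p ∈ P, ℓ p.rep ≠ 0) ∧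
    ConvexIndependent ℝ (fun p : P.Pt => affinePoint ℓ p.1)

/-- A point of a 6-configuration is dominant if it lies outside of the conic that passes through the
remaining five points. -/
def IsDominant (P : PointConfig 6) (p : RP2) : Prop :=
  p ∈ P ∧ ∃ Q : QuadraticForm ℝ (Fin 3 → ℝ), Q ≠ 0 ∧
    (∀ q ∈ P, q ≠ p → q ∈ conic Q) ∧ IsOutsideConic Q p

/-- The space of typical `n`-configurations. -/
def typicalSpace (n : ℕ) : Set (PointConfig n) := {P | P.IsTypical}

/-- The space of typical cyclic 6-configurations. -/
def typicalCyclicSpace : Set (PointConfig 6) := {P | P.IsTypical ∧ P.IsCyclic}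

/-- A Q-deformation is a path in the configuration space formed by typical configurations. -/
def IsQDeformation {P P' : PointConfig n} (γ : Path P P') : Prop := ∀ t, (γ t).IsTypical

/-- The deformation `γ` takes the point `p` to the point `p'`: there is a continuous choice of a
point of each configuration `γ t` that starts at `p` and ends at `p'`. -/
def Takes {P P' : PointConfig n} (γ : Path P P') (p p' : RP2) : Prop :=
  ∃ s : Path p p', ∀ t, s t ∈ γ t

theorem takes_refl (P : PointConfig n) {p : RP2} (hp : p ∈ P) : Takes (Path.refl P) p p :=
  ⟨Path.refl p, fun _ => hp⟩

theorem Takes.symm {P P' : PointConfig n} {γ : Path P P'} {p p' : RP2} (h : Takes γ p p') :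
    Takes γ.symm p' p := by
  obtain ⟨s, hs⟩ := h
  exact ⟨s.symm, fun t => hs _⟩

theorem Takes.trans {P P' P'' : PointConfig n} {γ : Path P P'} {γ' : Path P' P''}
    {p p' p'' : RP2} (h : Takes γ p p') (h' : Takes γ' p' p'') : Takes (γ.trans γ') p p'' := by
  obtain ⟨s, hs⟩ := h
  obtain ⟨s', hs'⟩ := h'
  refine ⟨s.trans s', fun t => ?_⟩
  rw [Path.trans_apply, Path.trans_apply]
  split_ifs
  · exact hs _
  · exact hs' _

theorem IsQDeformation.trans {P P' P'' : PointConfig n} {γ : Path P P'} {γ' : Path P' P''}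
    (h : IsQDeformation γ) (h' : IsQDeformation γ') : IsQDeformation (γ.trans γ') := by
  intro t
  rw [Path.trans_apply]
  split_ifs
  · exact h _
  · exact h' _

/-- The Q-deformation monodromy group of a typical configuration: the permutations of its points
that are realized by Q-deformations of the configuration to itself. -/
def qMonodromyGroup (P : PointConfig n) (hP : P.IsTypical) : Subgroup (Equiv.Perm P.Pt) where
  carrier := {σ | ∃ γ : Path P P, IsQDeformation γ ∧ ∀ p : P.Pt, Takes γ p.1 (σ p).1}
  one_mem' := ⟨Path.refl P, fun _ => hP, fun p => takes_refl P p.2⟩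
  mul_mem' := by
    rintro σ τ ⟨γ, hγ, hσ⟩ ⟨δ, hδ, hτ⟩
    exact ⟨δ.trans γ, hδ.trans hγ, fun p => (hτ p).trans (hσ (τ p))⟩
  inv_mem' := by
    rintro σ ⟨γ, hγ, hσ⟩
    refine ⟨γ.symm, fun t => hγ _, fun p => ?_⟩
    simpa using (hσ (σ⁻¹ p)).symm

end PointConfig

end

/-!
The points of a simple configuration are represented by six vectors of `ℝ³`, any three of which are
linearly independent (`Represents`). A line through two of the points crosses a segment between two
others or not depending on signs of determinants (`Represents.adj_iff`), so that the adjacency graph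
is encoded in the signs of the determinants of triples.

Both hexagonal and cyclic configurations are represented by six vectors all of whose increasing
triples have positive determinant (`Positive`). For hexagonal configurations these are the consecutive
vertices in an affine chart (`IsHexagonal.exists_positive`). A connected adjacency graph on six
vertices contains a path with three vertices; this path leaves few sign patterns, among which a
finite verification finds that the connected ones are hexagons up to the signs and the order of the
vectors (`IsCyclic.exists_positive`). The adjacency graph of a hexagon is the cycle of its sides.

The polynomial `conicBr` in the six vectors vanishes just when they are on a conic, so a hexagon is typical
if and only if `conicBr` does not vanish (`Positive.isTypical_iff`). It changes sign under a cyclic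
shift of the vertices, and its sign tells whether the last vertex is outside of the conic through the
others. Hence dominant and non-dominant vertices alternate (`Positive.isDominant_iff`). Here the
inside of a conic is homeomorphic to a disc by an affine chart, whereas the outside, a Möbius band, is
not, since twice the angular coordinate is a map to the circle that does not lift to the real line
(`ConicFrame.isEmpty_outside_homeomorph`).

The hexagons with negative bracket form a path connected space
(`isPathConnected_negativeHexagons`): a linear map takes the first four vertices to a projective
frame, and then the bracket is an affine function of one of the remaining four parameters. By the
cyclic shift the same holds for positive bracket. This provides the deformations: the dominant vertices
are those of one parity, so any dominant vertex can be taken as the first one, which fixes the sign of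
the bracket.

Along a path of typical configurations the signs of determinants are locally constant. So being cyclic
is preserved, and typical cyclic configurations form a whole path component. A continuous numeration of
the points of a deformation is locally the numeration of the vertices of a hexagon, with a fixed sign
of the bracket (`eventually_exists_positive`), so adjacency and dominance are preserved by the
monodromy. Conversely, a permutation of the vertices that preserves the sides and the parity is one of
six rotations and reflections (`hexagonPerm`), each of which takes the hexagon to a hexagon with the
same sign of the bracket, and is realized by a path between these two.
-/

noncomputable section

open Topology Filter

/-! ### Determinants and points of the projective plane -/

/-- The determinant of three vectors of `ℝ³`, written out as a polynomial in their coordinates. -/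
def br (u v w : Fin 3 → ℝ) : ℝ :=
  u 0 * (v 1 * w 2 - v 2 * w 1) - u 1 * (v 0 * w 2 - v 2 * w 0) + u 2 * (v 0 * w 1 - v 1 * w 0)

theorem br_eq_det (u v w : Fin 3 → ℝ) : br u v w = (Matrix.of ![u, v, w]).det := by
  simp [br, Matrix.det_fin_three]; ring

theorem br_ne_zero_iff {u v w : Fin 3 → ℝ} : br u v w ≠ 0 ↔ LinearIndependent ℝ ![u, v, w] := by
  rw [br_eq_det, ← isUnit_iff_ne_zero, ← Matrix.isUnit_iff_isUnit_det,
    ← Matrix.linearIndependent_rows_iff_isUnit]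
  rfl

theorem br_swap_left (u v w : Fin 3 → ℝ) : br v u w = -br u v w := by
  simp only [br]; ring

theorem br_swap_right (u v w : Fin 3 → ℝ) : br u w v = -br u v w := by
  simp only [br]; ring

theorem br_rotate (u v w : Fin 3 → ℝ) : br v w u = br u v w := by
  simp only [br]; ring

theorem br_smul (a b c : ℝ) (u v w : Fin 3 → ℝ) :
    br (a • u) (b • v) (c • w) = a * b * c * br u v w := by
  simp only [br, Pi.smul_apply, smul_eq_mul]; ring

theorem br_smul_right (c : ℝ) (u v w : Fin 3 → ℝ) : br u v (c • w) = c * br u v w := by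
  simp only [br, Pi.smul_apply, smul_eq_mul]; ring

theorem br_add_right (u v w w' : Fin 3 → ℝ) : br u v (w + w') = br u v w + br u v w' := by
  simp only [br, Pi.add_apply]; ring

@[simp] theorem br_self_right (u v : Fin 3 → ℝ) : br u v v = 0 := by simp only [br]; ring

theorem ne_zero_of_br_left {u v w : Fin 3 → ℝ} (h : br u v w ≠ 0) : u ≠ 0 := by
  rintro rfl; simp [br] at h

/-- Cramer's rule: the expansion of a vector in a basis of `ℝ³`. -/
theorem br_smul_eq (u v w x : Fin 3 → ℝ) :
    br u v w • x = br x v w • u + br u x w • v + br u v x • w := by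
  ext i
  fin_cases i <;> simp [br] <;> ring

theorem br_vecMul (M : Matrix (Fin 3) (Fin 3) ℝ) (u v w : Fin 3 → ℝ) :
    br (Matrix.vecMul u M) (Matrix.vecMul v M) (Matrix.vecMul w M) = M.det * br u v w := by
  simp only [br, Matrix.vecMul, dotProduct, Fin.sum_univ_three, Matrix.det_fin_three]
  ring

theorem continuous_br {X : Type*} [TopologicalSpace X] {f g h : X → Fin 3 → ℝ} (hf : Continuous f)
    (hg : Continuous g) (hh : Continuous h) : Continuous fun x => br (f x) (g x) (h x) := by
  unfold br; fun_prop

/-- The point of the projective plane represented by a vector (a fixed point for the zero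
vector). -/
def pt (v : Fin 3 → ℝ) : RP2 :=
  if h : v ≠ 0 then Projectivization.mk ℝ v h
  else Projectivization.mk ℝ (fun _ => 1) fun h => one_ne_zero (congrFun h 0)

theorem pt_of_ne {v : Fin 3 → ℝ} (h : v ≠ 0) : pt v = Projectivization.mk ℝ v h := dif_pos h

@[simp] theorem pt_rep (x : RP2) : pt x.rep = x := by
  rw [pt_of_ne x.rep_nonzero, Projectivization.mk_rep]

theorem pt_eq_pt_iff {u v : Fin 3 → ℝ} (hu : u ≠ 0) (hv : v ≠ 0) :
    pt u = pt v ↔ ∃ c : ℝ, c ≠ 0 ∧ u = c • v := by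
  rw [pt_of_ne hu, pt_of_ne hv, Projectivization.mk_eq_mk_iff']
  constructor
  · rintro ⟨c, rfl⟩
    exact ⟨c, fun h => hu (by simp [h]), rfl⟩
  · rintro ⟨c, -, rfl⟩
    exact ⟨c, rfl⟩

theorem pt_smul {c : ℝ} (hc : c ≠ 0) (v : Fin 3 → ℝ) : pt (c • v) = pt v := by
  by_cases hv : v = 0
  · simp [hv]
  · exact (pt_eq_pt_iff (smul_ne_zero hc hv) hv).2 ⟨c, hc, rfl⟩

theorem exists_rep_pt {v : Fin 3 → ℝ} (hv : v ≠ 0) : ∃ c : ℝ, c ≠ 0 ∧ (pt v).rep = c • v :=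
  (pt_eq_pt_iff (pt v).rep_nonzero hv).1 (pt_rep _)

theorem pt_ne_pt_of_br {u v w : Fin 3 → ℝ} (h : br u v w ≠ 0) : pt u ≠ pt v := by
  have hv : v ≠ 0 := by rintro rfl; simp [br] at h
  intro e
  obtain ⟨c, -, rfl⟩ := (pt_eq_pt_iff (ne_zero_of_br_left h) hv).1 e
  apply h
  simp only [br, Pi.smul_apply, smul_eq_mul]; ring

theorem pt_mem_iff {M : Projectivization.Subspace ℝ (Fin 3 → ℝ)} {v : Fin 3 → ℝ} (hv : v ≠ 0) :
    pt v ∈ M ↔ v ∈ M.submodule := by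
  rw [pt_of_ne hv]
  have := Submodule.mk_mem_projectivization_iff (K := ℝ) (s := M.submodule) (v := v) hv
  rw [← this]
  have e : M.submodule.projectivization = M := OrderIso.symm_apply_apply _ _
  rw [e]

theorem isCollinear_pt_iff {u v w : Fin 3 → ℝ} (hu : u ≠ 0) (hv : v ≠ 0) (hw : w ≠ 0) :
    Projectivization.IsCollinear ({pt u, pt v, pt w} : Set RP2) ↔ br u v w = 0 := by
  constructor
  · rintro ⟨M, hfin, hM, hsub⟩
    by_contra hne
    have hli := br_ne_zero_iff.1 hne
    have hspan : Submodule.span ℝ (Set.range ![u, v, w]) ≤ M.submodule := by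
      rw [Submodule.span_le]
      rintro _ ⟨i, rfl⟩
      fin_cases i
      · exact (pt_mem_iff hu).1 (hsub (by simp))
      · exact (pt_mem_iff hv).1 (hsub (by simp))
      · exact (pt_mem_iff hw).1 (hsub (by simp))
    have h1 := finrank_span_eq_card hli
    have h2 := Submodule.finrank_mono hspan
    simp at h1
    omega
  · intro h0
    have hli : ¬ LinearIndependent ℝ ![u, v, w] := fun h => br_ne_zero_iff.2 h h0
    refine ⟨(Submodule.span ℝ (Set.range ![u, v, w])).projectivization, ?_, ?_, ?_⟩
    · infer_instance
    · have h1 : Set.finrank ℝ (Set.range ![u, v, w]) ≤ 3 := by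
        simpa using finrank_range_le_card (R := ℝ) ![u, v, w]
      have h2 : 3 ≠ Set.finrank ℝ (Set.range ![u, v, w]) := by
        simpa [linearIndependent_iff_card_eq_finrank_span] using hli
      have e : (Submodule.span ℝ (Set.range ![u, v, w])).projectivization.submodule
        = Submodule.span ℝ (Set.range ![u, v, w]) := OrderIso.apply_symm_apply _ _
      rw [e]
      change Set.finrank ℝ (Set.range ![u, v, w]) ≤ 2
      omega
    · have key : ∀ i : Fin 3, ∀ x, ![u, v, w] i = x → x ≠ 0 →
          pt x ∈ (Submodule.span ℝ (Set.range ![u, v, w])).projectivization := by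
        intro i x hx hx0
        rw [pt_of_ne hx0, Submodule.mk_mem_projectivization_iff]
        exact Submodule.subset_span ⟨i, hx⟩
      rintro x (rfl | rfl | rfl)
      exacts [key 0 _ rfl hu, key 1 _ rfl hv, key 2 _ rfl hw]

/-! ### Topology of the projective plane -/

/-- The saturation of an open set is the union of its images under the homotheties. -/
theorem isOpenQuotientMap_mk' :
    IsOpenQuotientMap (Projectivization.mk' ℝ (V := Fin 3 → ℝ)) where
  surjective := Quotient.mk''_surjective
  continuous := continuous_coinduced_rng
  isOpenMap := by
    intro U hU
    rw [isOpen_coinduced]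
    have : Projectivization.mk' ℝ ⁻¹' (Projectivization.mk' ℝ (V := Fin 3 → ℝ) '' U) =
        ⋃ c : ℝˣ, (fun v : {v : Fin 3 → ℝ // v ≠ 0} =>
          (⟨c • v.1, by rw [Units.smul_def]; exact smul_ne_zero c.ne_zero v.2⟩ :
            {v : Fin 3 → ℝ // v ≠ 0})) ⁻¹' U := by
      ext v
      simp only [Set.mem_preimage, Set.mem_image, Set.mem_iUnion]
      constructor
      · rintro ⟨w, hw, e⟩
        rw [Projectivization.mk'_eq_mk, Projectivization.mk'_eq_mk,
          Projectivization.mk_eq_mk_iff] at e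
        obtain ⟨c, hc⟩ := e
        exact ⟨c, by simpa [hc] using hw⟩
      · rintro ⟨c, hc⟩
        refine ⟨_, hc, ?_⟩
        rw [Projectivization.mk'_eq_mk, Projectivization.mk'_eq_mk, Projectivization.mk_eq_mk_iff]
        exact ⟨c, rfl⟩
    rw [this]
    refine isOpen_iUnion fun c => hU.preimage ?_
    refine Continuous.subtype_mk ?_ _
    fun_prop

theorem map_pt_nhds {v : Fin 3 → ℝ} (hv : v ≠ 0) : map pt (𝓝 v) = 𝓝 (pt v) := by
  have h1 := isOpenQuotientMap_mk'.map_nhds_eq ⟨v, hv⟩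
  have h2 : Projectivization.mk' ℝ (V := Fin 3 → ℝ) = pt ∘ Subtype.val := by
    funext x; exact (pt_of_ne x.2).symm
  have h3 : map Subtype.val (𝓝 (⟨v, hv⟩ : {v : Fin 3 → ℝ // v ≠ 0})) = 𝓝 v :=
    map_nhds_subtype_coe_eq_nhds (p := fun v : Fin 3 → ℝ => v ≠ 0) hv
      (isOpen_compl_singleton.mem_nhds hv)
  rw [h2, ← Filter.map_map, h3] at h1
  exact h1

theorem continuousAt_pt {v : Fin 3 → ℝ} (hv : v ≠ 0) : ContinuousAt pt v :=
  (map_pt_nhds hv).le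

theorem Continuous.pt {X : Type*} [TopologicalSpace X] {f : X → Fin 3 → ℝ} (hf : Continuous f)
    (h0 : ∀ x, f x ≠ 0) : Continuous fun x => pt (f x) :=
  continuous_iff_continuousAt.2 fun x =>
    ContinuousAt.comp (f := f) (g := _root_.pt) (continuousAt_pt (h0 x)) hf.continuousAt

/-- Neighbourhoods of a tuple of points are images of neighbourhoods of a tuple of vectors. -/
theorem image_pt_mem_nhds {ι : Type*} [Finite ι] {V : ι → Fin 3 → ℝ} (hV : ∀ i, V i ≠ 0)
    {S : Set (ι → Fin 3 → ℝ)} (hS : S ∈ 𝓝 V) :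
    (fun W i => pt (W i)) '' S ∈ 𝓝 fun i => pt (V i) := by
  rw [nhds_pi, Filter.mem_pi'] at hS
  obtain ⟨I, t, ht, hI⟩ := hS
  have hU : Set.pi Set.univ (fun i => pt '' t i) ∈ 𝓝 fun i => pt (V i) := by
    refine set_pi_mem_nhds Set.finite_univ fun i _ => ?_
    rw [← map_pt_nhds (hV i)]
    exact image_mem_map (ht i)
  refine mem_of_superset hU fun f hf => ?_
  choose W hW hWf using fun i => hf i trivial
  exact ⟨W, hI fun i _ => hW i, funext hWf⟩

instance : T2Space RP2 := by
  rw [t2Space_iff_of_isOpenQuotientMap isOpenQuotientMap_mk']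
  -- proportionality of vectors is a closed condition
  have : {q : {v : Fin 3 → ℝ // v ≠ 0} × {v : Fin 3 → ℝ // v ≠ 0} |
      Projectivization.mk' ℝ q.1 = Projectivization.mk' ℝ q.2} =
      ⋂ i : Fin 3, ⋂ j : Fin 3, {q | q.1.1 i * q.2.1 j = q.1.1 j * q.2.1 i} := by
    ext ⟨⟨u, hu⟩, ⟨v, hv⟩⟩
    simp only [Set.mem_ofPred_eq, Set.mem_iInter, Projectivization.mk'_eq_mk,
      Projectivization.mk_eq_mk_iff']
    constructor
    · rintro ⟨c, rfl⟩ i j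
      simp only [Pi.smul_apply, smul_eq_mul]; ring
    · intro h
      obtain ⟨k, hk⟩ := Function.ne_iff.1 hv
      refine ⟨u k / v k, funext fun i => ?_⟩
      simp only [Pi.smul_apply, smul_eq_mul, Pi.zero_apply] at hk ⊢
      rw [div_mul_eq_mul_div, h k i, mul_div_assoc, div_self hk, mul_one]
  rw [this]
  have h1 (i : Fin 3) : Continuous fun q : {v : Fin 3 → ℝ // v ≠ 0} × {v : Fin 3 → ℝ // v ≠ 0} =>
      q.1.1 i := (continuous_apply i).comp (continuous_subtype_val.comp continuous_fst)
  have h2 (i : Fin 3) : Continuous fun q : {v : Fin 3 → ℝ // v ≠ 0} × {v : Fin 3 → ℝ // v ≠ 0} =>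
      q.2.1 i := (continuous_apply i).comp (continuous_subtype_val.comp continuous_snd)
  exact isClosed_iInter fun i => isClosed_iInter fun j =>
    isClosed_eq ((h1 i).mul (h2 j)) ((h1 j).mul (h2 i))

/-! ### Configurations represented by vectors -/

/-- Six vectors, any three of which are linearly independent. -/
def SimpleTuple (V : Fin 6 → Fin 3 → ℝ) : Prop :=
  ∀ i j k, i ≠ j → j ≠ k → i ≠ k → br (V i) (V j) (V k) ≠ 0

theorem Fin.exists_two_ne (i j : Fin 6) : ∃ k l : Fin 6, k ≠ i ∧ k ≠ j ∧ l ≠ i ∧ l ≠ j ∧ k ≠ l := by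
  revert i j; decide

theorem SimpleTuple.ne_zero {V : Fin 6 → Fin 3 → ℝ} (hV : SimpleTuple V) (i : Fin 6) :
    V i ≠ 0 := by
  obtain ⟨k, l, hk, -, hl, -, hkl⟩ := Fin.exists_two_ne i i
  exact ne_zero_of_br_left (hV i k l hk.symm hkl hl.symm)

theorem SimpleTuple.injective {V : Fin 6 → Fin 3 → ℝ} (hV : SimpleTuple V) :
    Function.Injective fun i => pt (V i) := by
  intro i j h
  by_contra hij
  obtain ⟨k, l, hk, hk', -⟩ := Fin.exists_two_ne i j
  exact pt_ne_pt_of_br (hV i j k hij hk'.symm hk.symm) h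

/-- The vectors of the simple tuple `V` represent the points of `P`. -/
structure Represents (V : Fin 6 → Fin 3 → ℝ) (P : PointConfig 6) : Prop where
  simple : SimpleTuple V
  mem_iff : ∀ p, p ∈ P ↔ ∃ i, pt (V i) = p

namespace PointConfig

theorem mem_ofOrdered {n : ℕ} (f : {f : Fin n → RP2 // Function.Injective f}) (p : RP2) :
    p ∈ ofOrdered f ↔ ∃ i, f.1 i = p := by
  change p ∈ (ofOrdered f).1 ↔ _
  simp [ofOrdered]

theorem ext_mem {n : ℕ} {P Q : PointConfig n} (h : ∀ p, p ∈ P ↔ p ∈ Q) : P = Q :=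
  Subtype.ext (Finset.ext h)

theorem exists_ofOrdered_eq {n : ℕ} (P : PointConfig n) : ∃ f, ofOrdered f = P := by
  let e := P.1.equivFinOfCardEq P.2
  refine ⟨⟨fun i => (e.symm i).1, Subtype.val_injective.comp e.symm.injective⟩, ?_⟩
  refine ext_mem fun p => ?_
  rw [mem_ofOrdered]
  constructor
  · rintro ⟨i, rfl⟩
    exact (e.symm i).2
  · intro hp
    exact ⟨e ⟨p, hp⟩, by simp⟩

theorem isSimple_ofOrdered_iff {V : Fin 6 → Fin 3 → ℝ} (h0 : ∀ i, V i ≠ 0)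
    (hinj : Function.Injective fun i => pt (V i)) :
    (ofOrdered ⟨_, hinj⟩).IsSimple ↔ SimpleTuple V := by
  constructor
  · intro h i j k hij hjk hik h0'
    refine h (pt (V i)) ((mem_ofOrdered _ _).2 ⟨i, rfl⟩) (pt (V j)) ((mem_ofOrdered _ _).2 ⟨j, rfl⟩)
      (pt (V k)) ((mem_ofOrdered _ _).2 ⟨k, rfl⟩) (hinj.ne hij) (hinj.ne hjk) (hinj.ne hik) ?_
    exact (isCollinear_pt_iff (h0 i) (h0 j) (h0 k)).2 h0'
  · intro h a ha b hb c hc hab hbc hac hcol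
    obtain ⟨i, rfl⟩ := (mem_ofOrdered _ _).1 ha
    obtain ⟨j, rfl⟩ := (mem_ofOrdered _ _).1 hb
    obtain ⟨k, rfl⟩ := (mem_ofOrdered _ _).1 hc
    refine h i j k (fun e => hab (by rw [e])) (fun e => hbc (by rw [e])) (fun e => hac (by rw [e])) ?_
    exact (isCollinear_pt_iff (h0 i) (h0 j) (h0 k)).1 hcol

end PointConfig

open PointConfig

theorem SimpleTuple.represents {V : Fin 6 → Fin 3 → ℝ} (hV : SimpleTuple V) :
    Represents V (ofOrdered ⟨_, hV.injective⟩) :=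
  ⟨hV, mem_ofOrdered _⟩

namespace Represents

variable {V : Fin 6 → Fin 3 → ℝ} {P Q : PointConfig 6}

theorem eq_ofOrdered (h : Represents V P) : P = ofOrdered ⟨_, h.simple.injective⟩ :=
  ext_mem fun p => (h.mem_iff p).trans (mem_ofOrdered ⟨_, h.simple.injective⟩ p).symm

theorem unique (h : Represents V P) (h' : Represents V Q) : P = Q :=
  h.eq_ofOrdered.trans h'.eq_ofOrdered.symm

theorem isSimple (h : Represents V P) : P.IsSimple := by
  rw [h.eq_ofOrdered]
  exact (isSimple_ofOrdered_iff h.simple.ne_zero h.simple.injective).2 h.simple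

theorem mem (h : Represents V P) (i : Fin 6) : pt (V i) ∈ P := (h.mem_iff _).2 ⟨i, rfl⟩

/-- The numeration of the points of a configuration by a representing tuple. -/
def equiv (h : Represents V P) : Fin 6 ≃ P.Pt :=
  Equiv.ofBijective (fun i => ⟨pt (V i), h.mem i⟩)
    ⟨fun _ _ e => h.simple.injective (congrArg Subtype.val e), fun p => by
      obtain ⟨i, hi⟩ := (h.mem_iff p.1).1 p.2
      exact ⟨i, Subtype.ext hi⟩⟩

@[simp] theorem coe_equiv (h : Represents V P) (i : Fin 6) : (h.equiv i).1 = pt (V i) := rfl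

theorem relabel (h : Represents V P) (σ : Equiv.Perm (Fin 6)) {c : Fin 6 → ℝ}
    (hc : ∀ i, c i ≠ 0) : Represents (fun i => c i • V (σ i)) P where
  simple i j k hij hjk hik := by
    rw [br_smul]
    exact mul_ne_zero (mul_ne_zero (mul_ne_zero (hc i) (hc j)) (hc k))
      (h.simple _ _ _ (σ.injective.ne hij) (σ.injective.ne hjk) (σ.injective.ne hik))
  mem_iff p := by
    rw [h.mem_iff]
    simp only [pt_smul (hc _)]
    exact ⟨fun ⟨i, hi⟩ => ⟨σ.symm i, by simpa using hi⟩, fun ⟨i, hi⟩ => ⟨σ i, hi⟩⟩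

end Represents

theorem PointConfig.IsSimple.exists_represents {P : PointConfig 6} (hP : P.IsSimple) :
    ∃ V, Represents V P := by
  obtain ⟨f, rfl⟩ := P.exists_ofOrdered_eq
  have hf : f.1 = fun i => pt ((f.1 i).rep) := by simp
  have hinj : Function.Injective fun i => pt ((f.1 i).rep) := hf ▸ f.2
  have e : f = ⟨_, hinj⟩ := Subtype.ext hf
  have h0 : ∀ i, (f.1 i).rep ≠ 0 := fun i => (f.1 i).rep_nonzero
  rw [e] at hP
  exact ⟨_, (isSimple_ofOrdered_iff h0 hinj).1 hP, by simpa using mem_ofOrdered f⟩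

/-- The adjacency graph of a tuple of vectors in terms of determinants: the lines through the pairs
of the remaining points all cross the same one of the two segments joining `i` and `j`. -/
def signGraph (V : Fin 6 → Fin 3 → ℝ) : SimpleGraph (Fin 6) where
  Adj i j := i ≠ j ∧
    ((∀ a b, a ≠ b → a ≠ i → a ≠ j → b ≠ i → b ≠ j →
      0 < br (V a) (V b) (V i) * br (V a) (V b) (V j)) ∨
    (∀ a b, a ≠ b → a ≠ i → a ≠ j → b ≠ i → b ≠ j →
      br (V a) (V b) (V i) * br (V a) (V b) (V j) < 0))
  symm := by
    refine ⟨?_⟩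
    rintro i j ⟨hij, h | h⟩
    · exact ⟨hij.symm, Or.inl fun a b h1 h2 h3 h4 h5 => by
        rw [mul_comm]; exact h a b h1 h3 h2 h5 h4⟩
    · exact ⟨hij.symm, Or.inr fun a b h1 h2 h3 h4 h5 => by
        rw [mul_comm]; exact h a b h1 h3 h2 h5 h4⟩
  loopless := ⟨fun _ h => h.1 rfl⟩

/-- The segment from `i` to `j` that corresponds to the pair `V i`, `ε • V j` is not crossed by the
line through `a` and `b` if and only if the determinants of `V a`, `V b` with `V i` and with
`ε • V j` have the same sign. -/
theorem Represents.adj_iff {V : Fin 6 → Fin 3 → ℝ} {P : PointConfig 6} (h : Represents V P)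
    (i j : Fin 6) :
    P.adjacencyGraph.Adj (h.equiv i) (h.equiv j) ↔ (signGraph V).Adj i j := by
  have hV := h.simple
  have h0 := hV.ne_zero
  constructor
  · rintro ⟨hne, u, v, hu, hv, hui, hvj, hseg⟩
    have hij : i ≠ j := fun e => hne (by rw [e])
    rw [← pt_of_ne hu, Represents.coe_equiv, pt_eq_pt_iff hu (h0 i)] at hui
    rw [← pt_of_ne hv, Represents.coe_equiv, pt_eq_pt_iff hv (h0 j)] at hvj
    obtain ⟨c, hc, rfl⟩ := hui
    obtain ⟨d, hd, rfl⟩ := hvj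
    have key : ∀ a b, a ≠ b → a ≠ i → a ≠ j → b ≠ i → b ≠ j →
        0 < c * d * (br (V a) (V b) (V i) * br (V a) (V b) (V j)) := by
      intro a b hab hai haj hbi hbj
      have hi := hV a b i hab hbi hai
      have hj := hV a b j hab hbj haj
      by_contra hneg
      have hlt : c * d * (br (V a) (V b) (V i) * br (V a) (V b) (V j)) < 0 :=
        lt_of_le_of_ne (not_lt.1 hneg) (by positivity)
      -- the line through `a` and `b` meets the segment in the point with these coefficients
      set s := |d * br (V a) (V b) (V j)| with hs
      set t := |c * br (V a) (V b) (V i)| with ht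
      have hs0 : s ≠ 0 := by positivity
      have hst : s • c • V i + t • d • V j ≠ 0 := by
        intro e
        have h1 : br (V a) (V j) (s • c • V i + t • d • V j) = 0 := by rw [e]; simp [br]
        rw [br_add_right, br_smul_right, br_smul_right, br_smul_right, br_smul_right,
          br_self_right] at h1
        have := hV a j i haj hij.symm hai
        simp [hs0, hc, this] at h1
      have hx := hseg (h.equiv a) (h.equiv b) (by simpa using hab) (by simpa using hai)
        (by simpa using haj) (by simpa using hbi) (by simpa using hbj) _
        ⟨s, t, abs_nonneg _, abs_nonneg _, hst, rfl⟩
      rw [← pt_of_ne hst] at hx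
      refine hx ((isCollinear_pt_iff (h0 a) (h0 b) hst).2 ?_)
      rw [br_add_right, br_smul_right, br_smul_right, br_smul_right, br_smul_right]
      have hneg' : (c * br (V a) (V b) (V i)) * (d * br (V a) (V b) (V j)) < 0 := by
        linarith
      rw [hs, ht]
      rcases mul_neg_iff.1 hneg' with ⟨h1, h2⟩ | ⟨h1, h2⟩
      · rw [abs_of_pos h1, abs_of_neg h2]; ring
      · rw [abs_of_neg h1, abs_of_pos h2]; ring
    refine ⟨hij, ?_⟩
    rcases (mul_ne_zero hc hd).lt_or_gt with hcd | hcd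
    · exact Or.inr fun a b h1 h2 h3 h4 h5 => neg_of_mul_pos_right (key a b h1 h2 h3 h4 h5) hcd.le
    · exact Or.inl fun a b h1 h2 h3 h4 h5 => (mul_pos_iff_of_pos_left hcd).1
        (key a b h1 h2 h3 h4 h5)
  · rintro ⟨hij, hor⟩
    have main : ∀ ε : ℝ, ε ≠ 0 → (∀ a b, a ≠ b → a ≠ i → a ≠ j → b ≠ i → b ≠ j →
        0 < br (V a) (V b) (V i) * (ε * br (V a) (V b) (V j))) →
        P.adjacencyGraph.Adj (h.equiv i) (h.equiv j) := by
      intro ε hε hpos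
      refine ⟨by simpa using hij, V i, ε • V j, h0 i, smul_ne_zero hε (h0 j), ?_, ?_, ?_⟩
      · rw [← pt_of_ne (h0 i)]; rfl
      · rw [← pt_of_ne (smul_ne_zero hε (h0 j)), pt_smul hε]; rfl
      · rintro a b hab hai haj hbi hbj x ⟨s, t, hs, ht, hst, rfl⟩ hcol
        obtain ⟨a, rfl⟩ := h.equiv.surjective a
        obtain ⟨b, rfl⟩ := h.equiv.surjective b
        simp only [ne_eq, EmbeddingLike.apply_eq_iff_eq] at hab hai haj hbi hbj
        rw [← pt_of_ne hst, h.coe_equiv, h.coe_equiv, isCollinear_pt_iff (h0 a) (h0 b) hst,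
          br_add_right, br_smul_right, br_smul_right, br_smul_right] at hcol
        have hp := hpos a b hab hai haj hbi hbj
        have hi := hV a b i hab hbi hai
        have hj := hV a b j hab hbj haj
        have hst' : 0 < s ∨ 0 < t := by
          by_contra hno
          push Not at hno
          have e1 : s = 0 := le_antisymm hno.1 hs
          have e2 : t = 0 := le_antisymm hno.2 ht
          exact hst (by simp [e1, e2])
        have h1 : 0 < br (V a) (V b) (V i) *
            (s * br (V a) (V b) (V i) + t * (ε * br (V a) (V b) (V j))) := by
          have e : br (V a) (V b) (V i) *
            (s * br (V a) (V b) (V i) + t * (ε * br (V a) (V b) (V j))) =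
            s * (br (V a) (V b) (V i)) ^ 2 +
              t * (br (V a) (V b) (V i) * (ε * br (V a) (V b) (V j))) := by ring
          rw [e]
          rcases hst' with h' | h'
          · have : 0 < s * (br (V a) (V b) (V i)) ^ 2 := by positivity
            have := mul_nonneg ht hp.le
            linarith
          · have := mul_pos h' hp
            have : 0 ≤ s * (br (V a) (V b) (V i)) ^ 2 := by positivity
            linarith
        rw [hcol, mul_zero] at h1
        exact lt_irrefl _ h1
    rcases hor with h' | h'
    · exact main 1 one_ne_zero fun a b h1 h2 h3 h4 h5 => by
        rw [one_mul]; exact h' a b h1 h2 h3 h4 h5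
    · refine main (-1) (by norm_num) fun a b h1 h2 h3 h4 h5 => ?_
      have := h' a b h1 h2 h3 h4 h5
      linarith

/-- The adjacency graph of a configuration is the graph read off from the determinants. -/
def Represents.graphIso {V : Fin 6 → Fin 3 → ℝ} {P : PointConfig 6} (h : Represents V P) :
    signGraph V ≃g P.adjacencyGraph where
  toEquiv := h.equiv
  map_rel_iff' := h.adj_iff _ _

theorem Represents.isCyclic_iff {V : Fin 6 → Fin 3 → ℝ} {P : PointConfig 6}
    (h : Represents V P) : P.IsCyclic ↔ (signGraph V).Connected := by
  rw [h.graphIso.connected_iff]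
  exact ⟨fun h => h.2, fun h' => ⟨h.isSimple, h'⟩⟩

/-! ### Signs of determinants -/

/-- Vectors whose triples of increasing index have positive determinant: they represent the
consecutive vertices of a convex hexagon. -/
def Positive (V : Fin 6 → Fin 3 → ℝ) : Prop :=
  ∀ i j k, i < j → j < k → 0 < br (V i) (V j) (V k)

/-- The alternating extension of a function of increasing triples. The value at a triple with
repeated entries has no meaning. -/
def altSign (c : Fin 6 → Fin 6 → Fin 6 → ℤ) (i j k : Fin 6) : ℤ :=
  if i < j then
    if j < k then c i j k else if i < k then -c i k j else c k i j
  else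
    if i < k then -c j i k else if j < k then c j k i else -c k j i

/-- The signs of the determinants of increasing triples of vectors of `V` are those of `c`. -/
def HasSigns (V : Fin 6 → Fin 3 → ℝ) (c : Fin 6 → Fin 6 → Fin 6 → ℤ) : Prop :=
  ∀ i j k, i < j → j < k → 0 < (c i j k : ℝ) * br (V i) (V j) (V k)

theorem HasSigns.alt {V : Fin 6 → Fin 3 → ℝ} {c : Fin 6 → Fin 6 → Fin 6 → ℤ} (h : HasSigns V c)
    {i j k : Fin 6} (hij : i ≠ j) (hjk : j ≠ k) (hik : i ≠ k) :
    0 < (altSign c i j k : ℝ) * br (V i) (V j) (V k) := by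
  unfold altSign
  split_ifs with h1 h2 h3 h4 h5
  · exact h i j k h1 h2
  · have := h i k j h3 (lt_of_le_of_ne (not_lt.1 h2) hjk.symm)
    rw [br_swap_right] at this
    push_cast; linarith
  · have := h k i j (lt_of_le_of_ne (not_lt.1 h3) hik.symm) h1
    rwa [← br_rotate] at this
  · have := h j i k (lt_of_le_of_ne (not_lt.1 h1) hij.symm) h4
    rw [br_swap_left] at this
    push_cast; linarith
  · have := h j k i h5 (lt_of_le_of_ne (not_lt.1 h4) hik.symm)
    rwa [br_rotate] at this
  · have := h k j i (lt_of_le_of_ne (not_lt.1 h5) hjk.symm)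
      (lt_of_le_of_ne (not_lt.1 h1) hij.symm)
    rw [br_swap_left, br_rotate, ← br_rotate] at this
    rw [← br_rotate, ← br_rotate] at this
    push_cast; linarith

theorem HasSigns.simple {V : Fin 6 → Fin 3 → ℝ} {c : Fin 6 → Fin 6 → Fin 6 → ℤ}
    (h : HasSigns V c) : SimpleTuple V := by
  intro i j k hij hjk hik h0
  have := h.alt hij hjk hik
  simp [h0] at this

/-- The adjacency relation read off from the signs of determinants. -/
def SignAdj (c : Fin 6 → Fin 6 → Fin 6 → ℤ) (i j : Fin 6) : Prop :=
  i ≠ j ∧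
    ((∀ a b, a ≠ b → a ≠ i → a ≠ j → b ≠ i → b ≠ j → 0 < altSign c a b i * altSign c a b j) ∨
    (∀ a b, a ≠ b → a ≠ i → a ≠ j → b ≠ i → b ≠ j → altSign c a b i * altSign c a b j < 0))

instance (c : Fin 6 → Fin 6 → Fin 6 → ℤ) (i j : Fin 6) : Decidable (SignAdj c i j) :=
  have h (p : Fin 6 → Fin 6 → Prop) [∀ a b, Decidable (p a b)] : Decidable
      (∀ a b, a ≠ b → a ≠ i → a ≠ j → b ≠ i → b ≠ j → p a b) := inferInstance
  @instDecidableAnd _ _ _ (@instDecidableOr _ _ (h _) (h _))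

theorem mul_pos_iff_of_signs {x y X Y : ℝ} (hx : 0 < x * X) (hy : 0 < y * Y) :
    0 < X * Y ↔ 0 < x * y := by
  have h : 0 < (x * y) * (X * Y) := by nlinarith [mul_pos hx hy]
  exact ⟨fun h' => pos_of_mul_pos_left h h'.le, fun h' => pos_of_mul_pos_right h h'.le⟩

theorem mul_neg_iff_of_signs {x y X Y : ℝ} (hx : 0 < x * X) (hy : 0 < y * Y) :
    X * Y < 0 ↔ x * y < 0 := by
  have h : 0 < (x * y) * (X * Y) := by nlinarith [mul_pos hx hy]
  exact ⟨fun h' => neg_of_mul_pos_left h h'.le, fun h' => neg_of_mul_pos_right h h'.le⟩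

theorem HasSigns.adj_iff {V : Fin 6 → Fin 3 → ℝ} {c : Fin 6 → Fin 6 → Fin 6 → ℤ}
    (h : HasSigns V c) (i j : Fin 6) : (signGraph V).Adj i j ↔ SignAdj c i j := by
  refine and_congr_right fun hij => or_congr ?_ ?_
  · refine forall₂_congr fun a b => ?_
    refine imp_congr_right fun h1 => imp_congr_right fun h2 => imp_congr_right fun h3 =>
      imp_congr_right fun h4 => imp_congr_right fun h5 => ?_
    rw [mul_pos_iff_of_signs (h.alt h1 h4 h2) (h.alt h1 h5 h3)]
    norm_cast
  · refine forall₂_congr fun a b => ?_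
    refine imp_congr_right fun h1 => imp_congr_right fun h2 => imp_congr_right fun h3 =>
      imp_congr_right fun h4 => imp_congr_right fun h5 => ?_
    rw [mul_neg_iff_of_signs (h.alt h1 h4 h2) (h.alt h1 h5 h3)]
    norm_cast

theorem Positive.hasSigns {V : Fin 6 → Fin 3 → ℝ} (h : Positive V) :
    HasSigns V fun _ _ _ => 1 := by
  intro i j k hij hjk
  simpa using h i j k hij hjk

theorem Positive.simple {V : Fin 6 → Fin 3 → ℝ} (h : Positive V) : SimpleTuple V :=
  h.hasSigns.simple

theorem Positive.adj_iff {V : Fin 6 → Fin 3 → ℝ} (h : Positive V) (i j : Fin 6) :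
    (signGraph V).Adj i j ↔ j = i + 1 ∨ i = j + 1 := by
  rw [h.hasSigns.adj_iff]
  revert i j
  decide +kernel

theorem Positive.connected {V : Fin 6 → Fin 3 → ℝ} (h : Positive V) :
    (signGraph V).Connected := by
  have hpre : ∀ i : Fin 6, (signGraph V).Reachable 0 i := by
    have step : ∀ i : Fin 6, (signGraph V).Reachable 0 i → (signGraph V).Reachable 0 (i + 1) :=
      fun i hi => hi.trans ((h.adj_iff i (i + 1)).2 (Or.inl rfl)).reachable
    have h0 : (signGraph V).Reachable 0 0 := SimpleGraph.Reachable.refl _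
    have h1 := step 0 h0
    have h2 := step _ h1
    have h3 := step _ h2
    have h4 := step _ h3
    have h5 := step _ h4
    intro i
    fin_cases i <;> assumption
  exact { preconnected := fun i j => (hpre i).symm.trans (hpre j), nonempty := ⟨0⟩ }

/-- Tuples with the same signs of determinants have the same adjacency graph. -/
theorem signGraph_congr {V W : Fin 6 → Fin 3 → ℝ} (h : ∀ i j k, i ≠ j → j ≠ k → i ≠ k →
    0 < br (V i) (V j) (V k) * br (W i) (W j) (W k)) : signGraph V = signGraph W := by
  ext i j
  refine and_congr_right fun hij => or_congr ?_ ?_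
  · refine forall₂_congr fun a b => ?_
    refine imp_congr_right fun h1 => imp_congr_right fun h2 => imp_congr_right fun h3 =>
      imp_congr_right fun h4 => imp_congr_right fun h5 => ?_
    exact (mul_pos_iff_of_signs (h _ _ _ h1 h4 h2) (h _ _ _ h1 h5 h3)).symm
  · refine forall₂_congr fun a b => ?_
    refine imp_congr_right fun h1 => imp_congr_right fun h2 => imp_congr_right fun h3 =>
      imp_congr_right fun h4 => imp_congr_right fun h5 => ?_
    exact (mul_neg_iff_of_signs (h _ _ _ h1 h4 h2) (h _ _ _ h1 h5 h3)).symm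

/-! ### Convex hexagons -/

/-- A strict total order on a finite set is a numeration: an element is sent to the number of its
predecessors. -/
theorem Fin.exists_perm_of_strict_order {n : ℕ} (r : Fin n → Fin n → Prop) (hirr : ∀ i, ¬ r i i)
    (htri : ∀ i j, i ≠ j → r i j ∨ r j i) (htrans : ∀ i j k, r i j → r j k → r i k) :
    ∃ σ : Equiv.Perm (Fin n), ∀ i j, i < j → r (σ i) (σ j) := by
  classical
  have hlt : ∀ i j, r i j → (Finset.univ.filter fun k => r k i).card <
      (Finset.univ.filter fun k => r k j).card := by
    intro i j hij
    refine Finset.card_lt_card (Finset.ssubset_iff_of_subset ?_ |>.2 ⟨i, ?_, ?_⟩)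
    · intro k hk
      simp only [Finset.mem_filter, Finset.mem_univ, true_and] at hk ⊢
      exact htrans _ _ _ hk hij
    · simpa using hij
    · simpa using hirr i
  have hbound : ∀ i, (Finset.univ.filter fun k => r k i).card < n := by
    intro i
    have : (Finset.univ.filter fun k => r k i).card < (Finset.univ : Finset (Fin n)).card :=
      Finset.card_lt_card (Finset.filter_ssubset.2 ⟨i, Finset.mem_univ _, hirr i⟩)
    simpa using this
  let f : Fin n → Fin n := fun i => ⟨_, hbound i⟩
  have hf : Function.Injective f := by
    intro i j hij
    by_contra hne
    have e : (Finset.univ.filter fun k => r k i).card = (Finset.univ.filter fun k => r k j).card :=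
      congrArg Fin.val hij
    rcases htri i j hne with h | h
    · exact (hlt _ _ h).ne e
    · exact (hlt _ _ h).ne e.symm
  let e : Equiv.Perm (Fin n) := Equiv.ofBijective f (Finite.injective_iff_bijective.1 hf)
  refine ⟨e.symm, fun i j hij => ?_⟩
  by_contra hno
  have hne : e.symm i ≠ e.symm j := e.symm.injective.ne hij.ne
  have h1 := hlt _ _ ((htri _ _ hne).resolve_left hno)
  have h2 : f (e.symm j) < f (e.symm i) := h1
  have h3 : ∀ x, f (e.symm x) = x := e.apply_symm_apply
  rw [h3, h3] at h2
  exact lt_asymm h2 hij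

/-- Vectors in an affine plane, none of which is in the triangle formed by three others, can be
numbered in such a way that they become positive. The first vector is arbitrary, and the others are
ordered by the direction in which they are seen from it. -/
theorem exists_positive_of_no_triangle {V : Fin 6 → Fin 3 → ℝ} (hV : SimpleTuple V)
    (h : ∀ i j k l, i ≠ j → j ≠ k → i ≠ k → l ≠ i → l ≠ j → l ≠ k →
      ¬ (0 < br (V l) (V j) (V k) ∧ 0 < br (V i) (V l) (V k) ∧ 0 < br (V i) (V j) (V l))) :
    ∃ σ : Equiv.Perm (Fin 6), Positive fun i => V (σ i) := by
  have hs := fun i : Fin 5 => (Fin.succ_ne_zero i)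
  obtain ⟨σ, hσ⟩ := Fin.exists_perm_of_strict_order
    (fun i j : Fin 5 => 0 < br (V 0) (V i.succ) (V j.succ)) (by simp)
    (by
      intro i j hij
      have h1 := hV 0 i.succ j.succ (hs i).symm (by simpa using hij) (hs j).symm
      rw [br_swap_right (V 0) (V i.succ) (V j.succ)]
      rcases h1.lt_or_gt with h | h
      · right; linarith
      · left; exact h)
    (by
      intro i j k hij hjk
      have hij' : i ≠ j := by rintro rfl; simp at hij
      have hjk' : j ≠ k := by rintro rfl; simp at hjk
      have hik' : i ≠ k := by
        rintro rfl
        rw [br_swap_right] at hjk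
        linarith
      -- otherwise the vector `0` is in the triangle formed by `i`, `j` and `k`
      by_contra hno
      have h1 := hV 0 i.succ k.succ (hs i).symm (by simpa using hik') (hs k).symm
      have h2 : br (V 0) (V i.succ) (V k.succ) < 0 := lt_of_le_of_ne (not_lt.1 hno) h1
      refine h i.succ j.succ k.succ 0 (by simpa using hij') (by simpa using hjk')
        (by simpa using hik') (hs i).symm (hs j).symm (hs k).symm ⟨hjk, ?_, ?_⟩
      · rw [br_swap_left]; linarith
      · rw [br_rotate]; exact hij)
  refine ⟨Equiv.Perm.decomposeFin.symm (0, σ), ?_⟩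
  intro i j k hij hjk
  have e0 : Equiv.Perm.decomposeFin.symm (0, σ) 0 = 0 := by simp
  have es : ∀ i : Fin 5, Equiv.Perm.decomposeFin.symm (0, σ) i.succ = (σ i).succ := by
    intro i; simp
  obtain ⟨j, rfl⟩ := Fin.exists_succ_eq.2 ((Fin.zero_le i).trans_lt hij).ne'
  obtain ⟨k, rfl⟩ := Fin.exists_succ_eq.2 ((Fin.zero_le j.succ).trans_lt hjk).ne'
  have hjk1 := hσ j k (by simpa using hjk)
  induction i using Fin.cases with
  | zero =>
    simp only [e0, es]
    exact hjk1
  | succ i =>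
    simp only [es]
    have hij1 := hσ i j (by simpa using hij)
    have hik1 := hσ i k (by simpa using hij.trans hjk)
    have hij' : (σ i).succ ≠ (σ j).succ := by simpa using hij.ne
    have hjk' : (σ j).succ ≠ (σ k).succ := by simpa using hjk.ne
    have hik' : (σ i).succ ≠ (σ k).succ := by simpa using (hij.trans hjk).ne
    -- otherwise `j` is in the triangle formed by `0`, `i` and `k`
    by_contra hno
    have h1 := hV _ _ _ hij' hjk' hik'
    have h2 := lt_of_le_of_ne (not_lt.1 hno) h1
    refine h 0 (σ i).succ (σ k).succ (σ j).succ (hs _).symm hik' (hs _).symm (hs _) hij'.symm hjk'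
      ⟨?_, hjk1, hij1⟩
    rw [br_swap_left]
    linarith

/-- The points are represented by vectors in the affine plane `ℓ = 1`, where convex position forbids
a point in the triangle formed by three others. -/
theorem PointConfig.IsHexagonal.exists_positive {P : PointConfig 6} (hP : P.IsHexagonal) :
    ∃ V, Positive V ∧ Represents V P := by
  obtain ⟨hsimple, ℓ, hℓ, hconv⟩ := hP
  obtain ⟨U, hU⟩ := hsimple.exists_represents
  have hℓU : ∀ i, ℓ (U i) ≠ 0 := by
    intro i h0
    obtain ⟨c, hc, e⟩ := exists_rep_pt (hU.simple.ne_zero i)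
    apply hℓ _ (hU.mem i)
    rw [e, map_smul, h0, smul_zero]
  set V : Fin 6 → Fin 3 → ℝ := fun i => (ℓ (U i))⁻¹ • U i with hVdef
  have hV : Represents V P := hU.relabel 1 (fun i => inv_ne_zero (hℓU i))
  have hℓV : ∀ i, ℓ (V i) = 1 := fun i => by
    simp [hVdef, hℓU i]
  have haff : ∀ i, affinePoint ℓ (pt (V i)) = V i := by
    intro i
    obtain ⟨c, hc, e⟩ := exists_rep_pt (hV.simple.ne_zero i)
    rw [affinePoint, e, map_smul, hℓV, smul_eq_mul, mul_one, smul_smul, inv_mul_cancel₀ hc,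
      one_smul]
  have hconvV : ConvexIndependent ℝ V := by
    have := hconv.comp_embedding hV.equiv.toEmbedding
    convert this using 1
    funext i
    exact (haff i).symm
  obtain ⟨σ, hσ⟩ := exists_positive_of_no_triangle hV.simple (by
    rintro i j k l hij hjk hik hli hlj hlk ⟨h1, h2, h3⟩
    have hx := br_smul_eq (V i) (V j) (V k) (V l)
    have hsum : br (V i) (V j) (V k) =
        br (V l) (V j) (V k) + br (V i) (V l) (V k) + br (V i) (V j) (V l) := by
      have := congrArg ℓ hx
      simpa [hℓV] using this
    have hpos : 0 < br (V i) (V j) (V k) := by linarith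
    have hmem : V l ∈ convexHull ℝ (V '' {i, j, k}) := by
      have hi : V i ∈ convexHull ℝ (V '' {i, j, k}) :=
        subset_convexHull _ _ ⟨i, by simp, rfl⟩
      have hj : V j ∈ convexHull ℝ (V '' {i, j, k}) :=
        subset_convexHull _ _ ⟨j, by simp, rfl⟩
      have hk : V k ∈ convexHull ℝ (V '' {i, j, k}) :=
        subset_convexHull _ _ ⟨k, by simp, rfl⟩
      have e : V l = (br (V l) (V j) (V k) / br (V i) (V j) (V k)) • V i +
          (br (V i) (V l) (V k) / br (V i) (V j) (V k)) • V j +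
          (br (V i) (V j) (V l) / br (V i) (V j) (V k)) • V k := by
        have := congrArg (fun x => (br (V i) (V j) (V k))⁻¹ • x) hx
        simp only [smul_smul, smul_add, inv_mul_cancel₀ hpos.ne', one_smul] at this
        simp only [div_eq_inv_mul]
        exact this
      have hc := (convex_convexHull ℝ (V '' {i, j, k})).sum_mem (t := Finset.univ)
        (w := ![br (V l) (V j) (V k) / br (V i) (V j) (V k),
          br (V i) (V l) (V k) / br (V i) (V j) (V k),
          br (V i) (V j) (V l) / br (V i) (V j) (V k)]) (z := ![V i, V j, V k])
        (by
          intro m _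
          fin_cases m <;> simp <;> positivity)
        (by
          simp only [Fin.sum_univ_three, Matrix.cons_val_zero, Matrix.cons_val_one,
            Matrix.cons_val]
          rw [← add_div, ← add_div, ← hsum, div_self hpos.ne'])
        (by
          intro m _
          fin_cases m
          exacts [hi, hj, hk])
      rw [e]
      simpa [Fin.sum_univ_three] using hc
    have := hconvV _ _ hmem
    simp [hli, hlj, hlk] at this)
  exact ⟨fun i => V (σ i), hσ, by simpa using hV.relabel σ (c := 1) (by simp)⟩

/-! ### Cyclic configurations are convex hexagons -/

/-- The sign encoded by a Boolean. -/
def boolSign (b : Bool) : ℤ := if b then 1 else -1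

/-- The signs of a tuple whose first three vectors have, up to the signs of the vectors, the same
determinants with pairs of remaining vectors. Here `a` and `b` are the signs of the first and last
triple, `y` gives the signs of the triples with two entries among the first three, and `e` is the
sign of the triples with last entries `3` and `5`. -/
def pathSigns (e a b y₃ y₄ y₅ : Bool) (i j k : Fin 6) : ℤ :=
  if k < 3 then boolSign a
  else if 3 ≤ i then boolSign b
  else if j < 3 then boolSign (if k = 3 then y₃ else if k = 4 then y₄ else y₅)
  else if j = 3 ∧ k = 5 then boolSign e else 1

/-- The chirotope `c` becomes positive if the indices are renumbered by `f` and the vectors are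
multiplied by the signs `s`. -/
def PositiveAfter (c : Fin 6 → Fin 6 → Fin 6 → ℤ) (f : Fin 6 → Fin 6) (s : Fin 6 → Bool) : Prop :=
  ∀ i j k : Fin 6, i < j → j < k →
    0 < boolSign (s i) * boolSign (s j) * boolSign (s k) * altSign c (f i) (f j) (f k)

instance (c : Fin 6 → Fin 6 → Fin 6 → ℤ) (f : Fin 6 → Fin 6) (s : Fin 6 → Bool) :
    Decidable (PositiveAfter c f s) := by
  unfold PositiveAfter; infer_instance

/-- No edge joins the first three vertices with the last three. -/
def NoCrossEdge (c : Fin 6 → Fin 6 → Fin 6 → ℤ) : Prop :=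
  ∀ i j : Fin 6, i < 3 → 3 ≤ j → ¬ SignAdj c i j

instance (c : Fin 6 → Fin 6 → Fin 6 → ℤ) : Decidable (NoCrossEdge c) := by
  unfold NoCrossEdge; infer_instance

/-- A finite verification. The sign patterns `pathSigns` are either excluded by a Grassmann–Plücker
relation (the first alternative), or have a disconnected graph, or become positive after a
permutation of the last three vectors and changes of signs. -/
theorem pathSigns_cases : ∀ e a b y₃ y₄ y₅ : Bool,
    (y₃ = y₅ ∧ (y₃ = y₄ ↔ e = false)) ∨ NoCrossEdge (pathSigns e a b y₃ y₄ y₅) ∨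
    ∃ f ∈ ([![0, 1, 2, 3, 4, 5], ![0, 1, 2, 3, 5, 4], ![0, 1, 2, 4, 3, 5], ![0, 1, 2, 4, 5, 3],
      ![0, 1, 2, 5, 3, 4], ![0, 1, 2, 5, 4, 3]] : List (Fin 6 → Fin 6)),
      ∃ e₀ e₃ e₄ e₅ : Bool,
        PositiveAfter (pathSigns e a b y₃ y₄ y₅) f ![e₀, e₀, e₀, e₃, e₄, e₅] := by
  decide +kernel

theorem SimpleGraph.Connected.exists_adj_mem_notMem {α : Type*} {G : SimpleGraph α}
    (hG : G.Connected) {S : Set α} {a b : α} (ha : a ∈ S) (hb : b ∉ S) :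
    ∃ x ∈ S, ∃ y, y ∉ S ∧ G.Adj x y := by
  obtain ⟨w⟩ := hG.preconnected a b
  obtain ⟨d, -, h1, h2⟩ := w.exists_boundary_dart S ha hb
  exact ⟨_, h1, _, h2, d.adj⟩

theorem SimpleGraph.Connected.exists_path_two {G : SimpleGraph (Fin 6)} (hG : G.Connected) :
    ∃ p q r : Fin 6, p ≠ r ∧ G.Adj p q ∧ G.Adj q r := by
  obtain ⟨x, hx, q, hq, hxq⟩ :=
    hG.exists_adj_mem_notMem (S := {0}) (a := 0) (b := 1) rfl (by simp)
  obtain rfl : x = 0 := hx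
  obtain ⟨b, hb⟩ : ∃ b : Fin 6, b ∉ ({0, q} : Set (Fin 6)) := by
    obtain ⟨k, -, h1, h2, -⟩ := Fin.exists_two_ne 0 q
    exact ⟨k, by simp [h1, h2]⟩
  obtain ⟨x, hx, r, hr, hxr⟩ := hG.exists_adj_mem_notMem (S := {0, q}) (a := 0) (by simp) hb
  simp only [Set.mem_insert_iff, Set.mem_singleton_iff, not_or] at hr
  rcases hx with rfl | rfl
  · exact ⟨q, 0, r, Ne.symm hr.2, hxq.symm, hxr⟩
  · exact ⟨0, x, r, Ne.symm hr.1, hxq, hxr⟩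

theorem Fin.exists_perm_three {p q r : Fin 6} (hpq : p ≠ q) (hqr : q ≠ r) (hpr : p ≠ r) :
    ∃ σ : Equiv.Perm (Fin 6), σ 0 = p ∧ σ 1 = q ∧ σ 2 = r := by
  have hf : Function.Injective ![(0 : Fin 6), 1, 2] := by decide
  have hg : Function.Injective ![p, q, r] := by
    intro i j h
    fin_cases i <;> fin_cases j <;> simp_all
  let e := (Equiv.ofInjective _ hf).symm.trans (Equiv.ofInjective _ hg)
  have h : ∀ i, e.extendSubtype (![(0 : Fin 6), 1, 2] i) = ![p, q, r] i := fun i => by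
    rw [Equiv.extendSubtype_apply_of_mem e _ (Set.mem_range_self i)]
    simp [e, Equiv.ofInjective_symm_apply hf i]
  exact ⟨e.extendSubtype, h 0, h 1, h 2⟩

theorem Represents.signGraph_relabel {V : Fin 6 → Fin 3 → ℝ} {P : PointConfig 6}
    (h : Represents V P) (σ : Equiv.Perm (Fin 6)) {c : Fin 6 → ℝ} (hc : ∀ i, c i ≠ 0)
    (i j : Fin 6) :
    (signGraph fun i => c i • V (σ i)).Adj i j ↔ (signGraph V).Adj (σ i) (σ j) := by
  have h' := h.relabel σ hc
  have e : ∀ i, h'.equiv i = h.equiv (σ i) := fun i => Subtype.ext (pt_smul (hc i) _)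
  rw [← h'.adj_iff, ← h.adj_iff, e, e]

/-- The sign of a nonzero real number, as a Boolean. -/
def posBool (x : ℝ) : Bool := decide (0 < x)

theorem boolSign_posBool_mul {x : ℝ} (hx : x ≠ 0) : 0 < (boolSign (posBool x) : ℝ) * x := by
  rcases hx.lt_or_gt with h | h
  · simp [boolSign, posBool, h.not_gt, h]
  · simp [boolSign, posBool, h]

theorem mul_pos_trans {s x y : ℝ} (h : 0 < s * x) (h' : 0 < x * y) : 0 < s * y := by
  have hx : x ≠ 0 := by rintro rfl; simp at h
  have h2 : 0 < s * y * x ^ 2 := by nlinarith [mul_pos h h']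
  exact pos_of_mul_pos_left h2 (by positivity)

/-- Adjacent vertices of the graph of a tuple have, after a change of sign, determinants of the same
sign with each pair of the remaining vectors. -/
theorem exists_factor_of_adj {V : Fin 6 → Fin 3 → ℝ} {i j : Fin 6} (h : (signGraph V).Adj i j) :
    ∃ ε : ℝ, ε ≠ 0 ∧ ∀ a b, a ≠ b → a ≠ i → a ≠ j → b ≠ i → b ≠ j →
      0 < br (V a) (V b) (V i) * (ε * br (V a) (V b) (V j)) := by
  obtain ⟨-, h | h⟩ := h
  · exact ⟨1, one_ne_zero, by simpa using h⟩
  · refine ⟨-1, by norm_num, fun a b h1 h2 h3 h4 h5 => ?_⟩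
    have := h a b h1 h2 h3 h4 h5
    linarith

/-- A rescaling of a tuple whose first three vertices form a path of the graph has the determinants
described by `pathSigns`. -/
theorem exists_hasSigns_pathSigns {V : Fin 6 → Fin 3 → ℝ} (hV : SimpleTuple V)
    (h01 : (signGraph V).Adj 0 1) (h12 : (signGraph V).Adj 1 2) :
    ∃ (c : Fin 6 → ℝ) (e a b y₃ y₄ y₅ : Bool), (∀ i, c i ≠ 0) ∧
      HasSigns (fun i => c i • V i) (pathSigns e a b y₃ y₄ y₅) ∧
      ¬ (y₃ = y₅ ∧ (y₃ = y₄ ↔ e = false)) := by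
  obtain ⟨d₁, hd₁, hA⟩ := exists_factor_of_adj h01
  obtain ⟨d₂, hd₂, hB⟩ := exists_factor_of_adj h12
  set d₄ := br (V 0) (V 3) (V 4)
  have hd₄ : d₄ ≠ 0 := hV _ _ _ (by decide) (by decide) (by decide)
  set d₅ := d₄ * br (V 0) (V 4) (V 5) with hd₅
  have hd₅0 : d₅ ≠ 0 := mul_ne_zero hd₄ (hV _ _ _ (by decide) (by decide) (by decide))
  -- the first three factors make the determinants of the vectors `0`, `1`, `2` with the remaining
  -- pairs agree in sign; the last two make the triples `034` and `045` positive
  set c : Fin 6 → ℝ := ![1, d₁, d₁ * d₂, 1, d₄, d₅] with hc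
  have hc0 : ∀ i, c i ≠ 0 := by
    intro i
    fin_cases i <;> simp [hc, hd₁, hd₂, hd₄, hd₅0]
  set W : Fin 6 → Fin 3 → ℝ := fun i => c i • V i with hW
  have hWs : ∀ i j k, br (W i) (W j) (W k) = c i * c j * c k * br (V i) (V j) (V k) :=
    fun i j k => br_smul _ _ _ _ _ _
  have hWV : SimpleTuple W := fun i j k h1 h2 h3 => by
    rw [hWs]
    exact mul_ne_zero (mul_ne_zero (mul_ne_zero (hc0 i) (hc0 j)) (hc0 k)) (hV i j k h1 h2 h3)
  have hA' : ∀ a b, a ≠ b → a ≠ 0 → a ≠ 1 → b ≠ 0 → b ≠ 1 →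
      0 < br (W 0) (W a) (W b) * br (W 1) (W a) (W b) := by
    intro a b h1 h2 h3 h4 h5
    have h := hA a b h1 h2 h3 h4 h5
    rw [← br_rotate (W 0), ← br_rotate (W 1), hWs, hWs]
    have e0 : c 0 = 1 := rfl
    have e1 : c 1 = d₁ := rfl
    rw [e0, e1]
    have : 0 < (c a * c b) ^ 2 := by have := hc0 a; have := hc0 b; positivity
    have := mul_pos this h
    linarith
  have hB' : ∀ a b, a ≠ b → a ≠ 1 → a ≠ 2 → b ≠ 1 → b ≠ 2 →
      0 < br (W 1) (W a) (W b) * br (W 2) (W a) (W b) := by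
    intro a b h1 h2 h3 h4 h5
    have h := hB a b h1 h2 h3 h4 h5
    rw [← br_rotate (W 1), ← br_rotate (W 2), hWs, hWs]
    have e1 : c 1 = d₁ := rfl
    have e2 : c 2 = d₁ * d₂ := rfl
    rw [e1, e2]
    have : 0 < (c a * c b * d₁) ^ 2 := by have := hc0 a; have := hc0 b; positivity
    have := mul_pos this h
    linarith
  have h034 : 0 < br (W 0) (W 3) (W 4) := by
    rw [hWs]
    have e : c 0 * c 3 * c 4 * br (V 0) (V 3) (V 4) = d₄ ^ 2 := by
      simp only [hc, Matrix.cons_val]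
      change 1 * 1 * d₄ * d₄ = _
      ring
    rw [e]; positivity
  have h045 : 0 < br (W 0) (W 4) (W 5) := by
    rw [hWs]
    have e : c 0 * c 4 * c 5 * br (V 0) (V 4) (V 5) = d₅ ^ 2 := by
      simp only [hc, Matrix.cons_val]
      rw [hd₅]
      ring
    rw [e]; positivity
  have hne : ∀ i j k : Fin 6, i ≠ j → j ≠ k → i ≠ k → br (W i) (W j) (W k) ≠ 0 := hWV
  have hE := boolSign_posBool_mul (hne 0 3 5 (by decide) (by decide) (by decide))
  have hY : ∀ x : Fin 6, x ≠ 0 → x ≠ 1 → x ≠ 2 →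
      0 < (boolSign (posBool (br (W 0) (W 1) (W x))) : ℝ) * br (W 0) (W 1) (W x) :=
    fun x h0 h1 h2 => boolSign_posBool_mul (hne 0 1 x (by decide) h1.symm h0.symm)
  have hY2 : ∀ x : Fin 6, x ≠ 0 → x ≠ 1 → x ≠ 2 →
      0 < (boolSign (posBool (br (W 0) (W 1) (W x))) : ℝ) * br (W 0) (W 2) (W x) := by
    intro x h0 h1 h2
    refine mul_pos_trans (hY x h0 h1 h2) ?_
    have := hB' 0 x h0.symm (by decide) (by decide) h1 h2
    rw [br_swap_left (W 0), br_swap_left (W 0)] at this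
    linarith
  have hY3 : ∀ x : Fin 6, x ≠ 0 → x ≠ 1 → x ≠ 2 →
      0 < (boolSign (posBool (br (W 0) (W 1) (W x))) : ℝ) * br (W 1) (W 2) (W x) :=
    fun x h0 h1 h2 => mul_pos_trans (hY2 x h0 h1 h2) (hA' 2 x h2.symm (by decide) (by decide) h0 h1)
  refine ⟨c, posBool (br (W 0) (W 3) (W 5)), posBool (br (W 0) (W 1) (W 2)),
    posBool (br (W 3) (W 4) (W 5)), posBool (br (W 0) (W 1) (W 3)),
    posBool (br (W 0) (W 1) (W 4)), posBool (br (W 0) (W 1) (W 5)), hc0, ?_, ?_⟩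
  · have h1jk : ∀ (s : ℝ) (j k : Fin 6), j ≠ k → j ≠ 0 → j ≠ 1 → k ≠ 0 → k ≠ 1 →
        0 < s * br (W 0) (W j) (W k) → 0 < s * br (W 1) (W j) (W k) :=
      fun s j k h1 h2 h3 h4 h5 h => mul_pos_trans h (hA' j k h1 h2 h3 h4 h5)
    have h2jk : ∀ (s : ℝ) (j k : Fin 6), j ≠ k → j ≠ 1 → j ≠ 2 → k ≠ 1 → k ≠ 2 →
        0 < s * br (W 1) (W j) (W k) → 0 < s * br (W 2) (W j) (W k) :=
      fun s j k h1 h2 h3 h4 h5 h => mul_pos_trans h (hB' j k h1 h2 h3 h4 h5)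
    have t034 : 0 < (1 : ℝ) * br (W 0) (W 3) (W 4) := by rwa [one_mul]
    have t045 : 0 < (1 : ℝ) * br (W 0) (W 4) (W 5) := by rwa [one_mul]
    have t134 := h1jk _ 3 4 (by decide) (by decide) (by decide) (by decide) (by decide) t034
    have t145 := h1jk _ 4 5 (by decide) (by decide) (by decide) (by decide) (by decide) t045
    have t135 := h1jk _ 3 5 (by decide) (by decide) (by decide) (by decide) (by decide) hE
    have t234 := h2jk _ 3 4 (by decide) (by decide) (by decide) (by decide) (by decide) t134
    have t245 := h2jk _ 4 5 (by decide) (by decide) (by decide) (by decide) (by decide) t145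
    have t235 := h2jk _ 3 5 (by decide) (by decide) (by decide) (by decide) (by decide) t135
    have t012 := boolSign_posBool_mul (hne 0 1 2 (by decide) (by decide) (by decide))
    have t345 := boolSign_posBool_mul (hne 3 4 5 (by decide) (by decide) (by decide))
    have t1 := hY 3 (by decide) (by decide) (by decide)
    have t2 := hY 4 (by decide) (by decide) (by decide)
    have t3 := hY 5 (by decide) (by decide) (by decide)
    have t4 := hY2 3 (by decide) (by decide) (by decide)
    have t5 := hY2 4 (by decide) (by decide) (by decide)
    have t6 := hY2 5 (by decide) (by decide) (by decide)
    have t7 := hY3 3 (by decide) (by decide) (by decide)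
    have t8 := hY3 4 (by decide) (by decide) (by decide)
    have t9 := hY3 5 (by decide) (by decide) (by decide)
    intro i j k hij hjk
    change 0 < _ * br (W i) (W j) (W k)
    generalize posBool (br (W 0) (W 3) (W 5)) = e at *
    generalize posBool (br (W 0) (W 1) (W 2)) = a at *
    generalize posBool (br (W 3) (W 4) (W 5)) = b at *
    generalize posBool (br (W 0) (W 1) (W 3)) = y₃ at *
    generalize posBool (br (W 0) (W 1) (W 4)) = y₄ at *
    generalize posBool (br (W 0) (W 1) (W 5)) = y₅ at *
    clear_value W
    clear hA hB hA' hB' hY hY2 hY3 h1jk h2jk hne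
    fin_cases i <;> fin_cases j <;> first | exact absurd hij (by decide) | skip
    all_goals
      fin_cases k <;> first
        | exact absurd hjk (by decide)
        | (simp [pathSigns]; first
            | exact t012 | exact t345 | exact hE | exact t135 | exact t235
            | exact t1 | exact t2 | exact t3 | exact t4 | exact t5 | exact t6
            | exact t7 | exact t8 | exact t9
            | simpa using t034 | simpa using t045 | simpa using t134 | simpa using t145
            | simpa using t234 | simpa using t245)
  · rintro ⟨h35, h34⟩
    have t3 := hY2 3 (by decide) (by decide) (by decide)
    have t4 := hY2 4 (by decide) (by decide) (by decide)
    have t5 := hY2 5 (by decide) (by decide) (by decide)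
    -- a Grassmann–Plücker relation, all terms of which would have the same sign
    have gp : br (W 0) (W 3) (W 4) * br (W 0) (W 2) (W 5) -
        br (W 0) (W 3) (W 5) * br (W 0) (W 2) (W 4) +
        br (W 0) (W 4) (W 5) * br (W 0) (W 2) (W 3) = 0 := by
      simp only [br]; ring
    generalize posBool (br (W 0) (W 1) (W 3)) = y₃ at *
    generalize posBool (br (W 0) (W 1) (W 4)) = y₄ at *
    generalize posBool (br (W 0) (W 1) (W 5)) = y₅ at *
    generalize posBool (br (W 0) (W 3) (W 5)) = e at *
    subst h35
    have p5 := mul_pos h034 t5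
    have p3 := mul_pos h045 t3
    have p4 := mul_pos hE t4
    have hs : (boolSign e * boolSign y₄ : ℝ) = -boolSign y₃ := by
      cases e <;> cases y₃ <;> cases y₄ <;> simp [boolSign] at h34 ⊢
    have : (boolSign y₃ : ℝ) * (br (W 0) (W 3) (W 4) * br (W 0) (W 2) (W 5) -
        br (W 0) (W 3) (W 5) * br (W 0) (W 2) (W 4) +
        br (W 0) (W 4) (W 5) * br (W 0) (W 2) (W 3)) > 0 := by
      have : boolSign e * br (W 0) (W 3) (W 5) * (boolSign y₄ * br (W 0) (W 2) (W 4)) =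
        (boolSign e * boolSign y₄ : ℝ) * (br (W 0) (W 3) (W 5) * br (W 0) (W 2) (W 4)) := by ring
      rw [this, hs] at p4
      linarith
    rw [gp, mul_zero] at this
    exact lt_irrefl _ this

/-- The adjacency graph contains a path with three vertices, which reduces the statement to the sign
patterns `pathSigns`; connectedness of the graph excludes the patterns without edges to the other
three vertices. -/
theorem PointConfig.IsCyclic.exists_positive {P : PointConfig 6} (hP : P.IsCyclic) :
    ∃ V, Positive V ∧ Represents V P := by
  obtain ⟨U, hU⟩ := hP.1.exists_represents
  obtain ⟨p, q, r, hpr, hpq, hqr⟩ := (hU.isCyclic_iff.1 hP).exists_path_two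
  obtain ⟨σ, rfl, rfl, rfl⟩ := Fin.exists_perm_three hpq.ne hqr.ne hpr
  have h1 : ∀ i : Fin 6, (1 : ℝ) ≠ 0 := fun _ => one_ne_zero
  have hV := hU.relabel σ h1
  have h01 := (hU.signGraph_relabel σ h1 0 1).2 hpq
  have h12 := (hU.signGraph_relabel σ h1 1 2).2 hqr
  obtain ⟨c, e, a, b, y₃, y₄, y₅, hc, hs, hex⟩ := exists_hasSigns_pathSigns hV.simple h01 h12
  have hW := hV.relabel 1 hc
  have hs' : HasSigns (fun i => c i • (1 : ℝ) • U (σ ((1 : Equiv.Perm (Fin 6)) i)))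
    (pathSigns e a b y₃ y₄ y₅) := hs
  generalize (fun i => c i • (1 : ℝ) • U (σ ((1 : Equiv.Perm (Fin 6)) i))) = W at hW hs'
  rcases pathSigns_cases e a b y₃ y₄ y₅ with h | h | ⟨f, hf, e₀, e₃, e₄, e₅, hpos⟩
  · exact absurd h hex
  · obtain ⟨i, hi, j, hj, hadj⟩ := (hW.isCyclic_iff.1 hP).exists_adj_mem_notMem
      (S := {i | i < 3}) (a := 0) (b := 3) (by decide) (by decide)
    exact absurd ((hs'.adj_iff i j).1 hadj) (h i j hi (not_lt.1 hj))
  · have hinj : Function.Injective f := by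
      simp only [List.mem_cons, List.not_mem_nil, or_false] at hf
      rcases hf with rfl | rfl | rfl | rfl | rfl | rfl <;> decide
    let τ : Equiv.Perm (Fin 6) := Equiv.ofBijective f (Finite.injective_iff_bijective.1 hinj)
    have hb : ∀ i, (boolSign (![e₀, e₀, e₀, e₃, e₄, e₅] i) : ℝ) ≠ 0 := by
      intro i
      generalize (![e₀, e₀, e₀, e₃, e₄, e₅] i) = x
      cases x <;> simp [boolSign]
    refine ⟨_, ?_, hW.relabel τ hb⟩
    intro i j k hij hjk
    rw [br_smul]
    have h1 := hpos i j k hij hjk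
    have h2 := hs'.alt (hinj.ne hij.ne) (hinj.ne hjk.ne) (hinj.ne (hij.trans hjk).ne)
    have h3 : (0 : ℝ) < boolSign (![e₀, e₀, e₀, e₃, e₄, e₅] i) *
      boolSign (![e₀, e₀, e₀, e₃, e₄, e₅] j) * boolSign (![e₀, e₀, e₀, e₃, e₄, e₅] k) *
        altSign (pathSigns e a b y₃ y₄ y₅) (f i) (f j) (f k) := by exact_mod_cast h1
    exact mul_pos_trans h3 h2

/-! ### Matrices of positive determinant -/

theorem JoinedIn.matrix_mul {A B C D : Matrix (Fin 3) (Fin 3) ℝ}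
    (h : JoinedIn {M | M.det ≠ 0} A B) (h' : JoinedIn {M | M.det ≠ 0} C D) :
    JoinedIn {M | M.det ≠ 0} (A * C) (B * D) := by
  obtain ⟨γ, hγ⟩ := h
  obtain ⟨δ, hδ⟩ := h'
  refine ⟨γ.mul δ, fun t => ?_⟩
  change ((γ t) * (δ t)).det ≠ 0
  rw [Matrix.det_mul]
  exact mul_ne_zero (hγ t) (hδ t)

/-- The reflection of `ℝ³` in the first coordinate. -/
def firstReflection : Matrix (Fin 3) (Fin 3) ℝ := !![-1, 0, 0; 0, 1, 0; 0, 0, 1]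

/-- The sign of a diagonal entry can be moved to the first coordinate by a rotation of the axis of a
reflection. -/
theorem joinedIn_diagonal_update (i : Fin 3) {a : ℝ} (ha : a ≠ 0) :
    JoinedIn {M : Matrix (Fin 3) (Fin 3) ℝ | M.det ≠ 0}
      (Matrix.diagonal (Function.update 1 i a)) 1 ∨
    JoinedIn {M : Matrix (Fin 3) (Fin 3) ℝ | M.det ≠ 0}
      (Matrix.diagonal (Function.update 1 i a)) firstReflection := by
  have hdet : ∀ x : ℝ, (Matrix.diagonal (Function.update (1 : Fin 3 → ℝ) i x)).det = x := by
    intro x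
    rw [Matrix.det_diagonal, Finset.prod_update_of_mem (Finset.mem_univ i)]
    simp
  have hcont : Continuous fun x : ℝ => Matrix.diagonal (Function.update (1 : Fin 3 → ℝ) i x) :=
    Continuous.matrix_diagonal (continuous_const.update i continuous_id)
  have seg : ∀ b : ℝ, 0 < a * b → JoinedIn {M : Matrix (Fin 3) (Fin 3) ℝ | M.det ≠ 0}
      (Matrix.diagonal (Function.update 1 i a)) (Matrix.diagonal (Function.update 1 i b)) := by
    intro b hab
    refine JoinedIn.ofLine (f := fun t : ℝ =>
      Matrix.diagonal (Function.update (1 : Fin 3 → ℝ) i ((1 - t) * a + t * b)))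
      (hcont.comp (by fun_prop)).continuousOn (by simp) (by simp) ?_
    rintro _ ⟨t, ht, rfl⟩
    change Matrix.det _ ≠ 0
    rw [hdet]
    intro h0
    have h1 : a * ((1 - t) * a + t * b) = 0 := by rw [h0, mul_zero]
    have h2 : 0 < a * ((1 - t) * a + t * b) := by
      have e : a * ((1 - t) * a + t * b) = (1 - t) * a ^ 2 + t * (a * b) := by ring
      rw [e]
      rcases ht.1.eq_or_lt with h | h
      · rw [← h]; simp; positivity
      · have : 0 ≤ (1 - t) * a ^ 2 := mul_nonneg (by linarith [ht.2]) (by positivity)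
        have := mul_pos h hab
        linarith
    exact h2.ne' h1
  rcases ha.lt_or_gt with hneg | hpos
  · right
    have hs := seg (-1) (by linarith)
    refine hs.trans ?_
    fin_cases i
    · have e : Matrix.diagonal (Function.update (1 : Fin 3 → ℝ) 0 (-1)) = firstReflection := by
        ext i j
        fin_cases i <;> fin_cases j <;> simp [firstReflection]
      change JoinedIn _ (Matrix.diagonal (Function.update (1 : Fin 3 → ℝ) 0 (-1))) _
      rw [e]
      exact JoinedIn.refl (e ▸ hs.target_mem)
    · refine JoinedIn.ofLine (f := fun t : ℝ =>
        !![Real.cos (t * Real.pi), Real.sin (t * Real.pi), 0;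
          Real.sin (t * Real.pi), -Real.cos (t * Real.pi), 0; 0, 0, 1]) ?_ ?_ ?_ ?_
      · refine Continuous.continuousOn (continuous_matrix fun i j => ?_)
        fin_cases i <;> fin_cases j <;> simp <;> fun_prop
      · ext i j
        fin_cases i <;> fin_cases j <;> simp
      · ext i j
        fin_cases i <;> fin_cases j <;> simp [firstReflection]
      · rintro _ ⟨t, -, rfl⟩
        change Matrix.det _ ≠ 0
        rw [Matrix.det_fin_three]
        simp
        nlinarith [Real.sin_sq_add_cos_sq (t * Real.pi)]
    · refine JoinedIn.ofLine (f := fun t : ℝ =>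
        !![Real.cos (t * Real.pi), 0, Real.sin (t * Real.pi); 0, 1, 0;
          Real.sin (t * Real.pi), 0, -Real.cos (t * Real.pi)]) ?_ ?_ ?_ ?_
      · refine Continuous.continuousOn (continuous_matrix fun i j => ?_)
        fin_cases i <;> fin_cases j <;> simp <;> fun_prop
      · ext i j
        fin_cases i <;> fin_cases j <;> simp
      · ext i j
        fin_cases i <;> fin_cases j <;> simp [firstReflection]
      · rintro _ ⟨t, -, rfl⟩
        change Matrix.det _ ≠ 0
        rw [Matrix.det_fin_three]
        simp
        nlinarith [Real.sin_sq_add_cos_sq (t * Real.pi)]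
  · left
    have := seg 1 (by linarith)
    simpa using this

/-- An invertible matrix is a product of transvections and a diagonal matrix, and both kinds of
factors are joined to the identity or to the reflection. -/
theorem joinedIn_one_or_firstReflection {M : Matrix (Fin 3) (Fin 3) ℝ} (hM : M.det ≠ 0) :
    JoinedIn {M : Matrix (Fin 3) (Fin 3) ℝ | M.det ≠ 0} M 1 ∨
    JoinedIn {M : Matrix (Fin 3) (Fin 3) ℝ | M.det ≠ 0} M firstReflection := by
  have hmul : ∀ A B : Matrix (Fin 3) (Fin 3) ℝ,
      (JoinedIn {M : Matrix (Fin 3) (Fin 3) ℝ | M.det ≠ 0} A 1 ∨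
        JoinedIn {M : Matrix (Fin 3) (Fin 3) ℝ | M.det ≠ 0} A firstReflection) →
      (JoinedIn {M : Matrix (Fin 3) (Fin 3) ℝ | M.det ≠ 0} B 1 ∨
        JoinedIn {M : Matrix (Fin 3) (Fin 3) ℝ | M.det ≠ 0} B firstReflection) →
      (JoinedIn {M : Matrix (Fin 3) (Fin 3) ℝ | M.det ≠ 0} (A * B) 1 ∨
        JoinedIn {M : Matrix (Fin 3) (Fin 3) ℝ | M.det ≠ 0} (A * B) firstReflection) := by
    have hJ : firstReflection * firstReflection = 1 := by
      ext i j
      fin_cases i <;> fin_cases j <;> simp [firstReflection]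
    rintro A B (hA | hA) (hB | hB)
    · left; simpa using hA.matrix_mul hB
    · right; simpa using hA.matrix_mul hB
    · right; simpa using hA.matrix_mul hB
    · left; simpa [hJ] using hA.matrix_mul hB
  refine Matrix.diagonal_transvection_induction_of_det_ne_zero _ M hM ?_ ?_
    fun A B _ _ => hmul A B
  · intro D hD
    rw [Matrix.det_diagonal] at hD
    have hD' : ∀ i, D i ≠ 0 := fun i => Finset.prod_ne_zero_iff.1 hD i (Finset.mem_univ i)
    have e : Matrix.diagonal D = Matrix.diagonal (Function.update 1 0 (D 0)) *
        Matrix.diagonal (Function.update 1 1 (D 1)) *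
        Matrix.diagonal (Function.update 1 2 (D 2)) := by
      rw [Matrix.diagonal_mul_diagonal, Matrix.diagonal_mul_diagonal]
      congr 1
      funext i
      fin_cases i <;> simp
    rw [e]
    exact hmul _ _ (hmul _ _ (joinedIn_diagonal_update 0 (hD' 0))
      (joinedIn_diagonal_update 1 (hD' 1))) (joinedIn_diagonal_update 2 (hD' 2))
  · rintro ⟨i, j, hij, c⟩
    left
    refine JoinedIn.ofLine (f := fun t : ℝ => Matrix.transvection i j ((1 - t) * c)) ?_ ?_ ?_ ?_
    · unfold Matrix.transvection
      refine Continuous.continuousOn (continuous_const.add ?_)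
      refine continuous_matrix fun k l => ?_
      simp only [Matrix.single_apply]
      split_ifs <;> fun_prop
    · simp [Matrix.TransvectionStruct.toMatrix]
    · simp
    · rintro _ ⟨t, -, rfl⟩
      simp [Matrix.det_transvection_of_ne i j hij]

theorem isPathConnected_det_pos :
    IsPathConnected {M : Matrix (Fin 3) (Fin 3) ℝ | 0 < M.det} := by
  refine ⟨1, by simp, fun {M} hM => ?_⟩
  have key : ∀ B, JoinedIn {M : Matrix (Fin 3) (Fin 3) ℝ | M.det ≠ 0} M B →
      JoinedIn {M : Matrix (Fin 3) (Fin 3) ℝ | 0 < M.det} M B := by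
    rintro B ⟨γ, hγ⟩
    refine ⟨γ, fun t => ?_⟩
    by_contra hneg
    have hcont : Continuous fun t => (γ t).det := γ.continuous.matrix_det
    obtain ⟨s, hs⟩ := mem_range_of_exists_le_of_exists_ge hcont ⟨t, not_lt.1 hneg⟩
      ⟨0, by rw [γ.source]; exact le_of_lt hM⟩
    exact hγ s hs
  rcases joinedIn_one_or_firstReflection (ne_of_gt hM) with h | h
  · exact (key _ h).symm
  · have h1 : 0 < firstReflection.det := (key _ h).target_mem
    have h2 : firstReflection.det = -1 := by
      rw [Matrix.det_fin_three]; simp [firstReflection]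
    linarith

/-! ### The conic condition and the normal form of a hexagon -/

/-- The bracket polynomial that vanishes if and only if six points are on a conic. It is of degree
two in each of the six vectors. -/
def conicBr (V : Fin 6 → Fin 3 → ℝ) : ℝ :=
  br (V 0) (V 1) (V 3) * br (V 0) (V 2) (V 4) * br (V 1) (V 2) (V 5) * br (V 3) (V 4) (V 5) -
  br (V 0) (V 1) (V 2) * br (V 0) (V 3) (V 4) * br (V 1) (V 3) (V 5) * br (V 2) (V 4) (V 5)

/-- The bracket changes sign under a cyclic shift of the numeration; this reflects the alternation of
dominant and non-dominant vertices of a hexagon. -/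
theorem conicBr_rotate (V : Fin 6 → Fin 3 → ℝ) :
    conicBr (fun i => V (i + 1)) = -conicBr V := by
  simp only [conicBr, br, Fin.isValue, Fin.reduceAdd]
  ring

theorem conicBr_neg_index (V : Fin 6 → Fin 3 → ℝ) :
    conicBr (fun i => V (-i)) = conicBr V := by
  change br (V 0) (V 5) (V 3) * br (V 0) (V 4) (V 2) * br (V 5) (V 4) (V 1) *
      br (V 3) (V 2) (V 1) - br (V 0) (V 5) (V 4) * br (V 0) (V 3) (V 2) * br (V 5) (V 3) (V 1) *
      br (V 4) (V 2) (V 1) = _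
  simp only [conicBr, br]
  ring

theorem conicBr_smul_vecMul (c : Fin 6 → ℝ) (W : Fin 6 → Fin 3 → ℝ)
    (g : Matrix (Fin 3) (Fin 3) ℝ) :
    conicBr (fun i => c i • Matrix.vecMul (W i) g) =
      (c 0 * c 1 * c 2 * c 3 * c 4 * c 5) ^ 2 * g.det ^ 4 * conicBr W := by
  simp only [conicBr, br_smul, br_vecMul]
  ring

theorem continuous_conicBr : Continuous conicBr := by
  unfold conicBr br
  fun_prop

/-- The normal form of six points of which the first four are a projective frame. -/
def normalHexagon (α β γ δ : ℝ) : Fin 6 → Fin 3 → ℝ :=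
  ![![1, 0, 0], ![0, 1, 0], ![0, 0, 1], ![1, -1, 1], ![1 + γ, -(1 + α), 1], ![1 + δ, -(1 + β), 1]]

theorem conicBr_normalHexagon (α β γ δ : ℝ) : conicBr (normalHexagon α β γ δ) =
    δ * (α * (1 + β + γ) - β * γ) - (1 + α) * β * γ := by
  simp [conicBr, normalHexagon, br]; ring

theorem positive_normalHexagon {α β γ δ : ℝ} (hα : 0 < α) (hβ : α < β) (hγ : α < γ)
    (hδ : β * γ < α * δ) : Positive (normalHexagon α β γ δ) := by
  have hβδ : β < δ := by
    by_contra h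
    push Not at h
    nlinarith
  have hγδ : γ < δ := by
    by_contra h
    push Not at h
    nlinarith
  have hsum : 0 < α + δ - β - γ := by
    have : 0 < α * (α + δ - β - γ) := by nlinarith [mul_pos (sub_pos.2 hβ) (sub_pos.2 hγ)]
    exact pos_of_mul_pos_right this hα.le
  intro i j k hij hjk
  fin_cases i <;> fin_cases j <;> first | exact absurd hij (by decide) | skip
  all_goals
    fin_cases k <;> first
      | exact absurd hjk (by decide)
      | (simp [normalHexagon, br]; done)
      | (simp [normalHexagon, br]; nlinarith)

/-- A hexagon is brought to the normal form by a linear map of positive determinant and positive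
scale factors. -/
theorem Positive.exists_normalHexagon {V : Fin 6 → Fin 3 → ℝ} (h : Positive V) :
    ∃ (g : Matrix (Fin 3) (Fin 3) ℝ) (c : Fin 6 → ℝ) (α β γ δ : ℝ), 0 < g.det ∧ (∀ i, 0 < c i) ∧
      0 < α ∧ α < β ∧ α < γ ∧ β * γ < α * δ ∧
      V = fun i => c i • Matrix.vecMul (normalHexagon α β γ δ i) g := by
  set b := br (V 0) (V 1) (V 2) with hb
  have hb0 : 0 < b := h 0 1 2 (by decide) (by decide)
  -- the coordinates of the last three vectors in the basis formed by the first three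
  set p : Fin 6 → ℝ := fun j => br (V 1) (V 2) (V j) / b with hp
  set q : Fin 6 → ℝ := fun j => br (V 0) (V 2) (V j) / b with hq
  set r : Fin 6 → ℝ := fun j => br (V 0) (V 1) (V j) / b with hr
  have hp0 : ∀ j, 2 < j → 0 < p j := fun j hj => div_pos (h 1 2 j (by decide) hj) hb0
  have hq0 : ∀ j, 2 < j → 0 < q j := fun j hj => div_pos (h 0 2 j (by decide) hj) hb0
  have hr0 : ∀ j, 2 < j → 0 < r j :=
    fun j hj => div_pos (h 0 1 j (by decide) (lt_trans (by decide) hj)) hb0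
  have hV : ∀ j, V j = p j • V 0 - q j • V 1 + r j • V 2 := by
    intro j
    have := congrArg (fun x => b⁻¹ • x) (br_smul_eq (V 0) (V 1) (V 2) (V j))
    simp only [← hb, smul_smul, smul_add, inv_mul_cancel₀ hb0.ne', one_smul] at this
    rw [this, ← br_rotate (V j) (V 1) (V 2), br_swap_right (V 0) (V 2) (V j)]
    simp only [hp, hq, hr, div_eq_inv_mul]
    module
  have p3 := hp0 3 (by decide)
  have p4 := hp0 4 (by decide)
  have p5 := hp0 5 (by decide)
  have q3 := hq0 3 (by decide)
  have q4 := hq0 4 (by decide)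
  have q5 := hq0 5 (by decide)
  have r3 := hr0 3 (by decide)
  have r4 := hr0 4 (by decide)
  have r5 := hr0 5 (by decide)
  have V3 := hV 3
  have V4 := hV 4
  have V5 := hV 5
  generalize p 3 = x₀ at *
  generalize p 4 = y₀ at *
  generalize p 5 = z₀ at *
  generalize q 3 = x₁ at *
  generalize q 4 = y₁ at *
  generalize q 5 = z₁ at *
  generalize r 3 = x₂ at *
  generalize r 4 = y₂ at *
  generalize r 5 = z₂ at *
  set g : Matrix (Fin 3) (Fin 3) ℝ := Matrix.of ![x₀ • V 0, x₁ • V 1, x₂ • V 2] with hg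
  set c : Fin 6 → ℝ := ![x₀⁻¹, x₁⁻¹, x₂⁻¹, 1, y₂ / x₂, z₂ / x₂] with hc
  set γ := y₀ * x₂ / (x₀ * y₂) - 1 with hγ
  set α := y₁ * x₂ / (x₁ * y₂) - 1 with hα
  set δ := z₀ * x₂ / (x₀ * z₂) - 1 with hδ
  set β := z₁ * x₂ / (x₁ * z₂) - 1 with hβ
  have hgdet : 0 < g.det := by
    rw [hg, ← br_eq_det, br_smul]
    positivity
  have hc0 : ∀ i, 0 < c i := by
    intro i
    fin_cases i <;> simp [hc] <;> positivity
  have hmul : ∀ x : Fin 3 → ℝ, Matrix.vecMul x g =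
      (x 0 * x₀) • V 0 + (x 1 * x₁) • V 1 + (x 2 * x₂) • V 2 := by
    intro x
    ext i
    simp only [Matrix.vecMul, dotProduct, Fin.sum_univ_three, hg, Matrix.of_apply,
      Matrix.cons_val_zero, Matrix.cons_val_one, Matrix.cons_val, Pi.smul_apply, Pi.add_apply,
      smul_eq_mul]
    ring
  have hVN : V = fun i => c i • Matrix.vecMul (normalHexagon α β γ δ i) g := by
    funext i
    simp only [hmul, smul_add, smul_smul]
    fin_cases i
    · simp [hc, normalHexagon, p3.ne']
    · simp [hc, normalHexagon, q3.ne']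
    · simp [hc, normalHexagon, r3.ne']
    · simp [hc, normalHexagon]
      rw [V3]; module
    · have e1 : y₂ / x₂ * ((1 + γ) * x₀) = y₀ := by rw [hγ]; field_simp; ring
      have e2 : y₂ / x₂ * (-(1 + α) * x₁) = -y₁ := by rw [hα]; field_simp; ring
      have e3 : y₂ / x₂ * (1 * x₂) = y₂ := by field_simp
      have : V 4 = (y₂ / x₂ * ((1 + γ) * x₀)) • V 0 + (y₂ / x₂ * (-(1 + α) * x₁)) • V 1 +
          (y₂ / x₂ * (1 * x₂)) • V 2 := by
        rw [e1, e2, e3, V4]; module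
      exact this
    · have e1 : z₂ / x₂ * ((1 + δ) * x₀) = z₀ := by rw [hδ]; field_simp; ring
      have e2 : z₂ / x₂ * (-(1 + β) * x₁) = -z₁ := by rw [hβ]; field_simp; ring
      have e3 : z₂ / x₂ * (1 * x₂) = z₂ := by field_simp
      have : V 5 = (z₂ / x₂ * ((1 + δ) * x₀)) • V 0 + (z₂ / x₂ * (-(1 + β) * x₁)) • V 1 +
          (z₂ / x₂ * (1 * x₂)) • V 2 := by
        rw [e1, e2, e3, V5]; module
      exact this
  have hbr : ∀ i j k, i < j → j < k → 0 < br (normalHexagon α β γ δ i) (normalHexagon α β γ δ j)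
      (normalHexagon α β γ δ k) := by
    intro i j k hij hjk
    have h1 := h i j k hij hjk
    rw [hVN] at h1
    simp only [br_smul, br_vecMul] at h1
    rw [← mul_assoc] at h1
    refine pos_of_mul_pos_right h1 ?_
    have := hc0 i
    have := hc0 j
    have := hc0 k
    positivity
  refine ⟨g, c, α, β, γ, δ, hgdet, hc0, ?_, ?_, ?_, ?_, hVN⟩
  · have := hbr 0 3 4 (by decide) (by decide)
    simpa [normalHexagon, br] using this
  · have := hbr 0 4 5 (by decide) (by decide)
    simp [normalHexagon, br] at this
    linarith
  · have := hbr 2 3 4 (by decide) (by decide)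
    simp [normalHexagon, br] at this
    linarith
  · have := hbr 3 4 5 (by decide) (by decide)
    simp [normalHexagon, br] at this
    linarith

/-- Positive tuples of vectors such that the conic bracket is negative. -/
def negativeHexagons : Set (Fin 6 → Fin 3 → ℝ) := {V | Positive V ∧ conicBr V < 0}

/-- The value of the last parameter of the normal form in terms of a positive parameter `s`. The
conic bracket of `normalHexagon α β γ (β * γ / α + τ)` is `τ * k - A`, where `k` and `A` are as
below and `A` is positive. For positive `τ` it is negative if and only if `τ⁻¹` is greater than
`max 0 (k / A)`, and `s` is the difference. -/
def lastParameter (α β γ s : ℝ) : ℝ :=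
  β * γ / α + (max 0 ((α * (1 + β + γ) - β * γ) / (β * γ / α * ((β - α) * (γ - α)))) + s)⁻¹

theorem lastParameter_spec {α β γ s : ℝ} (hα : 0 < α) (hβ : α < β) (hγ : α < γ) (hs : 0 < s) :
    β * γ < α * lastParameter α β γ s ∧
      conicBr (normalHexagon α β γ (lastParameter α β γ s)) < 0 := by
  have hA : 0 < β * γ / α * ((β - α) * (γ - α)) :=
    mul_pos (div_pos (mul_pos (hα.trans hβ) (hα.trans hγ)) hα)
      (mul_pos (sub_pos.2 hβ) (sub_pos.2 hγ))
  rw [conicBr_normalHexagon, lastParameter]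
  set A := β * γ / α * ((β - α) * (γ - α)) with hAdef
  set k := α * (1 + β + γ) - β * γ with hk
  set m := max 0 (k / A) + s with hm
  have hm0 : 0 < m := add_pos_of_nonneg_of_pos (le_max_left _ _) hs
  have hkm : k / A < m := lt_add_of_le_of_pos (le_max_right _ _) hs
  rw [div_lt_iff₀ hA] at hkm
  constructor
  · rw [mul_add, mul_div_cancel₀ _ hα.ne']
    have := mul_pos hα (inv_pos.2 hm0)
    linarith
  · have e : (β * γ / α + m⁻¹) * k - (1 + α) * β * γ = m⁻¹ * k - A := by
      rw [hAdef, hk]; field_simp; ring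
    rw [e, sub_neg, inv_mul_lt_iff₀ hm0]
    exact hkm

theorem exists_lastParameter {α β γ δ : ℝ} (hα : 0 < α) (hβ : α < β) (hγ : α < γ)
    (hδ : β * γ < α * δ) (hc : conicBr (normalHexagon α β γ δ) < 0) :
    ∃ s, 0 < s ∧ lastParameter α β γ s = δ := by
  have hA : 0 < β * γ / α * ((β - α) * (γ - α)) :=
    mul_pos (div_pos (mul_pos (hα.trans hβ) (hα.trans hγ)) hα)
      (mul_pos (sub_pos.2 hβ) (sub_pos.2 hγ))
  rw [conicBr_normalHexagon] at hc
  have hτ : 0 < δ - β * γ / α := by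
    rw [sub_pos, div_lt_iff₀ hα]; linarith
  refine ⟨(δ - β * γ / α)⁻¹ - max 0 ((α * (1 + β + γ) - β * γ) /
    (β * γ / α * ((β - α) * (γ - α)))), ?_, ?_⟩
  · rw [sub_pos, max_lt_iff]
    refine ⟨inv_pos.2 hτ, ?_⟩
    rw [div_lt_iff₀ hA, inv_mul_eq_div, lt_div_iff₀ hτ]
    have e : (α * (1 + β + γ) - β * γ) * (δ - β * γ / α) - β * γ / α * ((β - α) * (γ - α)) =
        δ * (α * (1 + β + γ) - β * γ) - (1 + α) * β * γ := by
      field_simp; ring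
    linarith
  · rw [lastParameter]
    rw [add_sub_cancel, inv_inv]
    ring

/-- Negative hexagons are the continuous image of a product of convex sets and of the set of matrices
of positive determinant. -/
theorem isPathConnected_negativeHexagons : IsPathConnected negativeHexagons := by
  -- parameters: a matrix, six scale factors, and `(α, β, γ, s)`
  set S : Set (Matrix (Fin 3) (Fin 3) ℝ × (Fin 6 → ℝ) × (Fin 4 → ℝ)) :=
    {M | 0 < M.det} ×ˢ {c | ∀ i, 0 < c i} ×ˢ {a | 0 < a 0 ∧ a 0 < a 1 ∧ a 0 < a 2 ∧ 0 < a 3} with hS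
  set Φ : Matrix (Fin 3) (Fin 3) ℝ × (Fin 6 → ℝ) × (Fin 4 → ℝ) → Fin 6 → Fin 3 → ℝ :=
    fun x i => x.2.1 i • Matrix.vecMul (normalHexagon (x.2.2 0) (x.2.2 1) (x.2.2 2)
      (lastParameter (x.2.2 0) (x.2.2 1) (x.2.2 2) (x.2.2 3)) i) x.1 with hΦ
  have hSc : IsPathConnected S := by
    refine isPathConnected_det_pos.prod (IsPathConnected.prod ?_ ?_)
    · refine Convex.isPathConnected ?_ ⟨fun _ => 1, fun _ => one_pos⟩
      have : {c : Fin 6 → ℝ | ∀ i, 0 < c i} = Set.pi Set.univ fun _ => Set.Ioi 0 := by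
        ext c; simp
      rw [this]
      exact convex_pi fun i _ => convex_Ioi 0
    · refine Convex.isPathConnected ?_ ⟨![1, 2, 2, 1], one_pos, one_lt_two, one_lt_two, one_pos⟩
      rintro x ⟨h1, h2, h3, h4⟩ y ⟨h1', h2', h3', h4'⟩ a b ha hb hab
      simp only [Set.mem_ofPred_eq, Pi.add_apply, Pi.smul_apply, smul_eq_mul]
      rcases ha.eq_or_lt with rfl | ha
      · obtain rfl : b = 1 := by linarith
        simpa using ⟨h1', h2', h3', h4'⟩
      · refine ⟨?_, ?_, ?_, ?_⟩
        · have := mul_pos ha h1; have := mul_nonneg hb h1'.le; linarith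
        · have := mul_pos ha (sub_pos.2 h2); have := mul_nonneg hb (sub_pos.2 h2').le; linarith
        · have := mul_pos ha (sub_pos.2 h3); have := mul_nonneg hb (sub_pos.2 h3').le; linarith
        · have := mul_pos ha h4; have := mul_nonneg hb h4'.le; linarith
  have himage : Φ '' S = negativeHexagons := by
    ext V
    constructor
    · rintro ⟨⟨g, c, a⟩, ⟨hg, hc, h1, h2, h3, h4⟩, rfl⟩
      obtain ⟨hδ, hneg⟩ := lastParameter_spec h1 h2 h3 h4
      constructor
      · intro i j k hij hjk
        have := positive_normalHexagon h1 h2 h3 hδ i j k hij hjk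
        simp only [hΦ, br_smul, br_vecMul]
        exact mul_pos (mul_pos (mul_pos (hc i) (hc j)) (hc k)) (mul_pos hg this)
      · simp only [hΦ, conicBr_smul_vecMul]
        refine mul_neg_of_pos_of_neg ?_ hneg
        have := hc 0; have := hc 1; have := hc 2; have := hc 3; have := hc 4; have := hc 5
        have : 0 < g.det := hg
        simp only at *
        positivity
    · rintro ⟨hpos, hneg⟩
      obtain ⟨g, c, α, β, γ, δ, hg, hc, hα, hβ, hγ, hδ, rfl⟩ := hpos.exists_normalHexagon
      have hneg' : conicBr (normalHexagon α β γ δ) < 0 := by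
        rw [conicBr_smul_vecMul] at hneg
        exact neg_of_mul_neg_right hneg (by positivity)
      obtain ⟨s, hs, rfl⟩ := exists_lastParameter hα hβ hγ hδ hneg'
      exact ⟨⟨g, c, ![α, β, γ, s]⟩, ⟨hg, hc, hα, hβ, hγ, hs⟩, rfl⟩
  rw [← himage]
  refine hSc.image' ?_
  have hlast : ContinuousOn (fun x : Matrix (Fin 3) (Fin 3) ℝ × (Fin 6 → ℝ) × (Fin 4 → ℝ) =>
      lastParameter (x.2.2 0) (x.2.2 1) (x.2.2 2) (x.2.2 3)) S := by
    unfold lastParameter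
    have hA : ∀ x ∈ S, x.2.2 1 * x.2.2 2 / x.2.2 0 *
        ((x.2.2 1 - x.2.2 0) * (x.2.2 2 - x.2.2 0)) ≠ 0 := by
      rintro x ⟨-, -, h1, h2, h3, h4⟩
      have := mul_pos (div_pos (mul_pos (h1.trans h2) (h1.trans h3)) h1)
        (mul_pos (sub_pos.2 h2) (sub_pos.2 h3))
      exact this.ne'
    have h0 : ∀ x ∈ S, x.2.2 0 ≠ 0 := fun x hx => hx.2.2.1.ne'
    refine ContinuousOn.add (ContinuousOn.div (by fun_prop) (by fun_prop) h0) ?_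
    refine ContinuousOn.inv₀ (ContinuousOn.add (ContinuousOn.sup continuousOn_const ?_)
      (by fun_prop)) ?_
    · refine ContinuousOn.div (by fun_prop) ?_ hA
      exact (ContinuousOn.div (by fun_prop) (by fun_prop) h0).mul (by fun_prop)
    · intro x hx
      exact (add_pos_of_nonneg_of_pos (le_max_left _ _) hx.2.2.2.2.2).ne'
  refine continuousOn_pi.2 fun i => ?_
  have hc : ContinuousOn (fun x : Matrix (Fin 3) (Fin 3) ℝ × (Fin 6 → ℝ) × (Fin 4 → ℝ) =>
      x.2.1 i) S := by fun_prop
  refine hc.smul (continuousOn_pi.2 fun j => ?_)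
  simp only [Matrix.vecMul, dotProduct, Fin.sum_univ_three]
  have hN : ∀ k, ContinuousOn (fun x : Matrix (Fin 3) (Fin 3) ℝ × (Fin 6 → ℝ) × (Fin 4 → ℝ) =>
      normalHexagon (x.2.2 0) (x.2.2 1) (x.2.2 2)
      (lastParameter (x.2.2 0) (x.2.2 1) (x.2.2 2) (x.2.2 3)) i k) S := by
    intro k
    fin_cases i <;> fin_cases k <;> simp [normalHexagon] <;> fun_prop
  have hM : ∀ k, ContinuousOn (fun x : Matrix (Fin 3) (Fin 3) ℝ × (Fin 6 → ℝ) × (Fin 4 → ℝ) =>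
      x.1 k j) S := fun k => (continuous_fst.matrix_elem k j).continuousOn
  exact (((hN 0).mul (hM 0)).add ((hN 1).mul (hM 1))).add ((hN 2).mul (hM 2))

/-! ### The inside and the outside of a conic -/

/-- A function on the projective plane given by a homogeneous function of degree zero is continuous,
although the choice of representatives is not. -/
theorem continuousAt_comp_rep {Y : Type*} [TopologicalSpace Y] {f : (Fin 3 → ℝ) → Y}
    (hf : ∀ c : ℝ, c ≠ 0 → ∀ v, f (c • v) = f v) {v : Fin 3 → ℝ} (hv : v ≠ 0)
    (hc : ContinuousAt f v) : ContinuousAt (fun x : RP2 => f x.rep) (pt v) := by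
  have h : ∀ w, w ≠ 0 → f (pt w).rep = f w := by
    intro w hw
    obtain ⟨c, hc, e⟩ := exists_rep_pt hw
    rw [e, hf c hc]
  rw [ContinuousAt, ← map_pt_nhds hv, tendsto_map'_iff, h v hv]
  refine hc.congr' ?_
  filter_upwards [isOpen_compl_singleton.mem_nhds hv] with w hw
  exact (h w hw).symm

theorem isOpen_setOf_rep {P : (Fin 3 → ℝ) → Prop} (hP : IsOpen {v | P v})
    (hs : ∀ c : ℝ, c ≠ 0 → ∀ v, P v → P (c • v)) : IsOpen {x : RP2 | P x.rep} := by
  rw [isOpen_iff_mem_nhds]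
  intro x hx
  rw [← pt_rep x, ← map_pt_nhds x.rep_nonzero]
  refine mem_map.2 ?_
  filter_upwards [hP.mem_nhds hx, isOpen_compl_singleton.mem_nhds x.rep_nonzero] with w hw hw0
  obtain ⟨c, hc, e⟩ := exists_rep_pt hw0
  change P (pt w).rep
  rw [e]
  exact hs c hc w hw

/-- The standard quadratic form of signature `(1, 2)`. -/
def cone (w : Fin 3 → ℝ) : ℝ := w 2 ^ 2 - w 0 ^ 2 - w 1 ^ 2

theorem cone_smul (c : ℝ) (w : Fin 3 → ℝ) : cone (c • w) = c ^ 2 * cone w := by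
  simp only [cone, Pi.smul_apply, smul_eq_mul]; ring

theorem continuous_cone : Continuous cone := by unfold cone; fun_prop

/-- A basis of `ℝ³`, formed by the rows of an invertible matrix. It serves as the coordinate system in
which a conic takes the standard form `cone = 0`. -/
structure ConicFrame where
  /-- The matrix whose rows are the vectors of the basis. -/
  toMat : Matrix (Fin 3) (Fin 3) ℝ
  det_ne : toMat.det ≠ 0

namespace ConicFrame

variable (T : ConicFrame)

/-- The vector with given coordinates. -/
def vec (w : Fin 3 → ℝ) : Fin 3 → ℝ := Matrix.vecMul w T.toMat

/-- The coordinates of a vector. -/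
def coord (v : Fin 3 → ℝ) : Fin 3 → ℝ := Matrix.vecMul v T.toMat⁻¹

@[simp] theorem coord_vec (w : Fin 3 → ℝ) : T.coord (T.vec w) = w := by
  rw [coord, vec, Matrix.vecMul_vecMul, Matrix.mul_nonsing_inv _ (isUnit_iff_ne_zero.2 T.det_ne),
    Matrix.vecMul_one]

@[simp] theorem vec_coord (w : Fin 3 → ℝ) : T.vec (T.coord w) = w := by
  rw [coord, vec, Matrix.vecMul_vecMul, Matrix.nonsing_inv_mul _ (isUnit_iff_ne_zero.2 T.det_ne),
    Matrix.vecMul_one]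

theorem vec_smul (c : ℝ) (w : Fin 3 → ℝ) : T.vec (c • w) = c • T.vec w := Matrix.smul_vecMul _ _ _

theorem coord_smul (c : ℝ) (w : Fin 3 → ℝ) : T.coord (c • w) = c • T.coord w :=
  Matrix.smul_vecMul _ _ _

theorem continuous_vec : Continuous T.vec := continuous_id.matrix_vecMul continuous_const

theorem continuous_coord : Continuous T.coord := continuous_id.matrix_vecMul continuous_const

theorem vec_ne_zero {w : Fin 3 → ℝ} (hw : w ≠ 0) : T.vec w ≠ 0 := by
  intro h
  apply hw
  rw [← T.coord_vec w, h]
  exact Matrix.zero_vecMul _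

/-- The open disc bounded by the standard conic of the frame. -/
def inside : Set RP2 := {x | 0 < cone (T.coord x.rep)}

/-- The open Möbius band bounded by the standard conic of the frame. -/
def outside : Set RP2 := {x | cone (T.coord x.rep) < 0}

theorem exists_rep_vec {w : Fin 3 → ℝ} (hw : w ≠ 0) :
    ∃ c : ℝ, c ≠ 0 ∧ T.coord (pt (T.vec w)).rep = c • w := by
  obtain ⟨c, hc, e⟩ := exists_rep_pt (T.vec_ne_zero hw)
  exact ⟨c, hc, by rw [e, coord_smul, coord_vec]⟩

theorem pt_vec_mem_inside {w : Fin 3 → ℝ} (hw : w ≠ 0) :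
    pt (T.vec w) ∈ T.inside ↔ 0 < cone w := by
  obtain ⟨c, hc, e⟩ := T.exists_rep_vec hw
  change 0 < cone _ ↔ _
  rw [e, cone_smul]
  exact mul_pos_iff_of_pos_left (by positivity)

theorem pt_vec_mem_outside {w : Fin 3 → ℝ} (hw : w ≠ 0) :
    pt (T.vec w) ∈ T.outside ↔ cone w < 0 := by
  obtain ⟨c, hc, e⟩ := T.exists_rep_vec hw
  change cone _ < 0 ↔ _
  rw [e, cone_smul]
  have : 0 < c ^ 2 := by positivity
  exact ⟨fun h => neg_of_mul_neg_right h this.le, fun h => mul_neg_of_pos_of_neg this h⟩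

theorem pt_vec_coord (x : RP2) : pt (T.vec (T.coord x.rep)) = x := by simp

theorem isOpen_inside : IsOpen T.inside :=
  isOpen_setOf_rep (P := fun v => 0 < cone (T.coord v))
    (isOpen_lt continuous_const (continuous_cone.comp T.continuous_coord)) fun c hc v hv => by
      rw [coord_smul, cone_smul]; positivity

theorem isOpen_outside : IsOpen T.outside :=
  isOpen_setOf_rep (P := fun v => cone (T.coord v) < 0)
    (isOpen_lt (continuous_cone.comp T.continuous_coord) continuous_const) fun c hc v hv => by
      rw [coord_smul, cone_smul]
      exact mul_neg_of_pos_of_neg (by positivity) hv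

theorem disjoint_inside_outside : Disjoint T.inside T.outside :=
  Set.disjoint_left.2 fun x (h : 0 < cone (T.coord x.rep)) (h' : cone (T.coord x.rep) < 0) =>
    lt_asymm h h'

/-- The point of the affine chart `w 2 = 1` with given coordinates. -/
def chart (u : EuclideanSpace ℝ (Fin 2)) : RP2 := pt (T.vec ![u 0, u 1, 1])

theorem chart_ne (a b : ℝ) : ![a, b, 1] ≠ 0 := fun h => one_ne_zero (congrFun h 2)

theorem continuous_chart : Continuous T.chart := by
  refine Continuous.pt (T.continuous_vec.comp ?_) fun u => T.vec_ne_zero (chart_ne _ _)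
  refine continuous_pi fun i => ?_
  fin_cases i <;> simp <;> fun_prop

theorem chart_mem_inside_iff (u : EuclideanSpace ℝ (Fin 2)) :
    T.chart u ∈ T.inside ↔ u ∈ Metric.ball (0 : EuclideanSpace ℝ (Fin 2)) 1 := by
  rw [chart, pt_vec_mem_inside _ (chart_ne _ _), mem_ball_zero_iff, EuclideanSpace.norm_eq,
    Real.sqrt_lt' one_pos]
  simp only [cone, Fin.sum_univ_two, Real.norm_eq_abs, sq_abs]
  simp
  constructor <;> intro h <;> linarith

/-- The coordinates, in the affine chart `w 2 = 1`, of the point represented by a vector. -/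
def affineCoord (v : Fin 3 → ℝ) : EuclideanSpace ℝ (Fin 2) :=
  !₂[T.coord v 0 / T.coord v 2, T.coord v 1 / T.coord v 2]

theorem coord_two_ne {x : RP2} (hx : x ∈ T.inside) : T.coord x.rep 2 ≠ 0 := by
  intro h
  have : 0 < cone (T.coord x.rep) := hx
  simp only [cone, h] at this
  nlinarith [sq_nonneg (T.coord x.rep 0), sq_nonneg (T.coord x.rep 1)]

theorem chart_affineCoord {x : RP2} (hx : x ∈ T.inside) : T.chart (T.affineCoord x.rep) = x := by
  have h2 := T.coord_two_ne hx
  conv_rhs => rw [← T.pt_vec_coord x]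
  have : T.coord x.rep 2 • ![T.affineCoord x.rep 0, T.affineCoord x.rep 1, 1] =
      T.coord x.rep := by
    ext i
    fin_cases i <;> simp [affineCoord] <;> field_simp
  rw [chart, ← pt_smul h2 (T.vec _), ← vec_smul, this]

/-- The inside of a conic is homeomorphic to the unit disc. -/
def insideHomeomorph : T.inside ≃ₜ Metric.ball (0 : EuclideanSpace ℝ (Fin 2)) 1 where
  toFun x := ⟨T.affineCoord x.1.rep, by
    rw [← T.chart_mem_inside_iff, T.chart_affineCoord x.2]; exact x.2⟩
  invFun u := ⟨T.chart u.1, (T.chart_mem_inside_iff _).2 u.2⟩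
  left_inv x := Subtype.ext (T.chart_affineCoord x.2)
  right_inv u := by
    refine Subtype.ext ?_
    obtain ⟨c, hc, e⟩ := T.exists_rep_vec (chart_ne (u.1 0) (u.1 1))
    change T.affineCoord (pt (T.vec ![u.1 0, u.1 1, 1])).rep = u.1
    rw [affineCoord, e]
    ext i
    fin_cases i <;> simp [hc]
  continuous_toFun := by
    refine Continuous.subtype_mk ?_ _
    refine continuous_iff_continuousAt.2 fun x => ?_
    have h2 := T.coord_two_ne x.2
    have h : ContinuousAt (fun x : RP2 => T.affineCoord x.rep) x.1 := by
      rw [← pt_rep x.1]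
      refine continuousAt_comp_rep (f := T.affineCoord) ?_ x.1.rep_nonzero ?_
      · intro c hc v
        simp only [affineCoord, coord_smul, Pi.smul_apply, smul_eq_mul,
          mul_div_mul_left _ _ hc]
      · have hi : ∀ i, ContinuousAt (fun v => T.coord v i) x.1.rep := fun i =>
          ((continuous_apply i).comp T.continuous_coord).continuousAt
        refine (PiLp.continuous_toLp 2 _).continuousAt.comp (continuousAt_pi.2 fun i => ?_)
        fin_cases i
        · exact (hi 0).div (hi 2) h2
        · exact (hi 1).div (hi 2) h2
    exact h.comp continuous_subtype_val.continuousAt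
  continuous_invFun :=
    Continuous.subtype_mk (T.continuous_chart.comp continuous_subtype_val) _

theorem isPreconnected_inside : IsPreconnected T.inside := by
  have : T.inside = T.chart '' Metric.ball (0 : EuclideanSpace ℝ (Fin 2)) 1 := by
    ext x
    constructor
    · intro hx
      exact ⟨T.affineCoord x.rep, by rwa [← T.chart_mem_inside_iff, T.chart_affineCoord hx],
        T.chart_affineCoord hx⟩
    · rintro ⟨u, hu, rfl⟩
      exact (T.chart_mem_inside_iff u).2 hu
  rw [this]
  exact (convex_ball _ _).isPreconnected.image _ T.continuous_chart.continuousOn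

/-- A parametrization of the outside of the conic by the strip `|u.2| < 1`. -/
def band (u : ℝ × ℝ) : RP2 := pt (T.vec ![Real.cos u.1, Real.sin u.1, u.2])

theorem band_ne (θ s : ℝ) : ![Real.cos θ, Real.sin θ, s] ≠ 0 := by
  intro h
  have h0 : Real.cos θ = 0 := congrFun h 0
  have h1 : Real.sin θ = 0 := congrFun h 1
  have := Real.sin_sq_add_cos_sq θ
  simp [h0, h1] at this

theorem continuous_band : Continuous T.band := by
  refine Continuous.pt (T.continuous_vec.comp ?_) fun u => T.vec_ne_zero (band_ne _ _)
  refine continuous_pi fun i => ?_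
  fin_cases i <;> simp <;> fun_prop

theorem band_mem_outside {u : ℝ × ℝ} (hu : |u.2| < 1) : T.band u ∈ T.outside := by
  rw [band, pt_vec_mem_outside _ (band_ne _ _)]
  have h1 := Real.sin_sq_add_cos_sq u.1
  have h2 := (sq_lt_one_iff_abs_lt_one u.2).2 hu
  simp only [cone, Matrix.cons_val_zero, Matrix.cons_val_one, Matrix.cons_val]
  linarith

theorem exists_band_eq {x : RP2} (hx : x ∈ T.outside) : ∃ u : ℝ × ℝ, |u.2| < 1 ∧ T.band u = x := by
  set w := T.coord x.rep with hw
  have hneg : cone w < 0 := hx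
  set z : ℂ := ⟨w 0, w 1⟩ with hz
  have hr : ‖z‖ ^ 2 = w 0 ^ 2 + w 1 ^ 2 := by
    rw [← Complex.normSq_eq_norm_sq, Complex.normSq_apply]; ring
  have hr0 : 0 < ‖z‖ := by
    rw [norm_pos_iff]
    intro h0
    rw [h0] at hr
    simp [cone] at hneg hr
    nlinarith [sq_nonneg (w 2)]
  refine ⟨(Complex.arg z, w 2 / ‖z‖), ?_, ?_⟩
  · rw [abs_div, abs_of_pos hr0, div_lt_one hr0]
    refine abs_lt_of_sq_lt_sq ?_ hr0.le
    simp only [cone] at hneg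
    linarith
  · conv_rhs => rw [← T.pt_vec_coord x]
    have e : ‖z‖ • ![Real.cos (Complex.arg z), Real.sin (Complex.arg z), w 2 / ‖z‖] = w := by
      ext i
      fin_cases i
      · exact Complex.norm_mul_cos_arg z
      · exact Complex.norm_mul_sin_arg z
      · simp; field_simp
    rw [band, ← pt_smul hr0.ne', ← vec_smul]
    simp only
    rw [e]

theorem isPreconnected_outside : IsPreconnected T.outside := by
  have : T.outside = T.band '' (Set.univ ×ˢ Set.Ioo (-1) 1) := by
    ext x
    constructor
    · intro hx
      obtain ⟨u, hu, rfl⟩ := T.exists_band_eq hx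
      exact ⟨u, ⟨trivial, abs_lt.1 hu⟩, rfl⟩
    · rintro ⟨u, hu, rfl⟩
      exact T.band_mem_outside (abs_lt.2 hu.2)
  rw [this]
  exact ((convex_univ.prod (convex_Ioo _ _)).isPreconnected).image _ T.continuous_band.continuousOn

/-- The first two coordinates of a vector, as a complex number. -/
def planePart (v : Fin 3 → ℝ) : ℂ := ⟨T.coord v 0, T.coord v 1⟩

theorem planePart_smul (c : ℝ) (v : Fin 3 → ℝ) : T.planePart (c • v) = c * T.planePart v := by
  apply Complex.ext <;> simp [planePart, coord_smul]

theorem continuous_planePart : Continuous T.planePart := by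
  have h : ∀ i, Continuous fun v => T.coord v i := fun i =>
    (continuous_apply i).comp T.continuous_coord
  have e : T.planePart = fun v => (T.coord v 0 : ℂ) + T.coord v 1 * Complex.I := by
    funext v
    apply Complex.ext <;> simp [planePart]
  rw [e]
  exact (Complex.continuous_ofReal.comp (h 0)).add
    ((Complex.continuous_ofReal.comp (h 1)).mul continuous_const)

theorem planePart_ne_zero {x : RP2} (hx : x ∈ T.outside) : T.planePart x.rep ≠ 0 := by
  intro h
  have h0 : T.coord x.rep 0 = 0 := congrArg Complex.re h
  have h1 : T.coord x.rep 1 = 0 := congrArg Complex.im h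
  have : cone (T.coord x.rep) < 0 := hx
  simp only [cone, h0, h1] at this
  nlinarith [sq_nonneg (T.coord x.rep 2)]

/-- Twice the angular coordinate of a point outside the conic, up to orientation; the angle itself
is defined up to a half-turn only. -/
def doubleAngle (x : T.outside) : Circle :=
  Circle.ofConjDivSelf (T.planePart x.1.rep) (T.planePart_ne_zero x.2)

theorem continuous_doubleAngle : Continuous T.doubleAngle := by
  refine continuous_induced_rng.2 (continuous_iff_continuousAt.2 fun x => ?_)
  have h : ContinuousAt (fun y : RP2 =>
      (starRingEnd ℂ) (T.planePart y.rep) / T.planePart y.rep) x.1 := by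
    rw [← pt_rep x.1]
    refine continuousAt_comp_rep
      (f := fun v => (starRingEnd ℂ) (T.planePart v) / T.planePart v) ?_ x.1.rep_nonzero ?_
    · intro c hc v
      simp only [planePart_smul, map_mul, Complex.conj_ofReal]
      exact mul_div_mul_left _ _ (Complex.ofReal_ne_zero.2 hc)
    · exact (Complex.continuous_conj.comp T.continuous_planePart).continuousAt.div
        T.continuous_planePart.continuousAt (T.planePart_ne_zero x.2)
  exact h.comp continuous_subtype_val.continuousAt

/-- The core circle of the outside of the conic. -/
def coreLoop (t : ℝ) : T.outside := ⟨T.band (t / 2, 0), T.band_mem_outside (by simp)⟩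

theorem continuous_coreLoop : Continuous T.coreLoop :=
  Continuous.subtype_mk (T.continuous_band.comp (by fun_prop)) _

theorem coreLoop_closed : T.coreLoop (2 * Real.pi) = T.coreLoop 0 := by
  refine Subtype.ext ?_
  change T.band _ = T.band _
  have e : ![Real.cos (2 * Real.pi / 2), Real.sin (2 * Real.pi / 2), 0] =
      (-1 : ℝ) • ![Real.cos (0 / 2), Real.sin (0 / 2), 0] := by
    ext i
    fin_cases i <;> simp
  rw [band, band]
  simp only
  rw [e, vec_smul, pt_smul (by norm_num)]

theorem doubleAngle_coreLoop (t : ℝ) : T.doubleAngle (T.coreLoop t) = Circle.exp (-t) := by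
  apply Circle.coe_injective
  obtain ⟨c, hc, e⟩ := T.exists_rep_vec (band_ne (t / 2) 0)
  have hz : T.planePart (T.coreLoop t).1.rep = c * Complex.exp ((t / 2 : ℝ) * Complex.I) := by
    change (⟨T.coord (pt (T.vec ![Real.cos (t / 2), Real.sin (t / 2), 0])).rep 0,
      T.coord (pt (T.vec ![Real.cos (t / 2), Real.sin (t / 2), 0])).rep 1⟩ : ℂ) = _
    rw [e]
    apply Complex.ext
    · rw [Complex.re_ofReal_mul, Complex.exp_ofReal_mul_I_re]; simp
    · rw [Complex.im_ofReal_mul, Complex.exp_ofReal_mul_I_im]; simp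
  have hcoe : ((T.doubleAngle (T.coreLoop t) : Circle) : ℂ) =
    (starRingEnd ℂ) (T.planePart (T.coreLoop t).1.rep) / T.planePart (T.coreLoop t).1.rep := rfl
  rw [hcoe, hz, map_mul, Complex.conj_ofReal,
    mul_div_mul_left _ _ (Complex.ofReal_ne_zero.2 hc), ← Complex.exp_conj, ← Complex.exp_sub,
    Circle.coe_exp]
  congr 1
  rw [map_mul, Complex.conj_ofReal, Complex.conj_I]
  push_cast
  ring

/-- The outside of a conic is not homeomorphic to a disc: the angular coordinate makes a full turn
on its core circle, whereas the angle would lift to a real function on a disc. -/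
theorem isEmpty_outside_homeomorph :
    IsEmpty (T.outside ≃ₜ Metric.ball (0 : EuclideanSpace ℝ (Fin 2)) 1) := by
  refine ⟨fun e => ?_⟩
  let e' : T.outside ≃ₜ EuclideanSpace ℝ (Fin 2) := e.trans Homeomorph.unitBall.symm
  let g : C(EuclideanSpace ℝ (Fin 2), Circle) :=
    ⟨fun u => T.doubleAngle (e'.symm u), T.continuous_doubleAngle.comp e'.symm.continuous⟩
  have hg : ∀ t, g (e' (T.coreLoop t)) = Circle.exp (-t) := fun t => by
    simp [g, doubleAngle_coreLoop]
  obtain ⟨F, ⟨hF0, hF⟩, -⟩ := Circle.isCoveringMap_exp.existsUnique_continuousMap_lifts g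
    (e' (T.coreLoop 0)) 0 (by rw [hg]; simp)
  have hlift : (fun t => F (e' (T.coreLoop t))) = fun t => -t := by
    refine Circle.isCoveringMap_exp.eq_of_comp_eq
      (F.continuous.comp (e'.continuous.comp T.continuous_coreLoop)) continuous_neg ?_ 0 ?_
    · funext t
      exact (congrFun hF _).trans (hg t)
    · simpa using hF0
  have h1 := congrFun hlift (2 * Real.pi)
  have h0 := congrFun hlift 0
  simp only [T.coreLoop_closed] at h1 h0
  have := Real.pi_pos
  linarith

end ConicFrame

/-! ### Connected components of the complement of a conic -/

namespace ConicFrame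

variable (T : ConicFrame) {Q : QuadraticForm ℝ (Fin 3 → ℝ)} {κ : ℝ}

theorem compl_conic_eq (hκ : κ ≠ 0) (hQ : ∀ w, Q (T.vec w) = κ * cone w) :
    (conic Q)ᶜ = T.inside ∪ T.outside := by
  ext x
  have h : x ∈ conic Q ↔ cone (T.coord x.rep) = 0 := by
    change Q x.rep = 0 ↔ _
    rw [← T.vec_coord x.rep, hQ, T.coord_vec]
    simp [hκ]
  rw [Set.mem_compl_iff, h]
  change _ ↔ 0 < cone (T.coord x.rep) ∨ cone (T.coord x.rep) < 0
  rw [or_comm, lt_or_lt_iff_ne]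

theorem connectedComponentIn_eq_inside (hκ : κ ≠ 0) (hQ : ∀ w, Q (T.vec w) = κ * cone w) {p : RP2}
    (hp : p ∈ T.inside) : connectedComponentIn (conic Q)ᶜ p = T.inside := by
  have hc := T.compl_conic_eq hκ hQ
  have hp' : p ∈ (conic Q)ᶜ := by rw [hc]; exact Or.inl hp
  refine Set.Subset.antisymm ?_ ?_
  · refine isPreconnected_connectedComponentIn.subset_left_of_subset_union T.isOpen_inside
      T.isOpen_outside T.disjoint_inside_outside ?_ ⟨p, mem_connectedComponentIn hp', hp⟩
    rw [← hc]
    exact connectedComponentIn_subset _ _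
  · exact T.isPreconnected_inside.subset_connectedComponentIn hp
      (by rw [hc]; exact Set.subset_union_left)

theorem connectedComponentIn_eq_outside (hκ : κ ≠ 0) (hQ : ∀ w, Q (T.vec w) = κ * cone w) {p : RP2}
    (hp : p ∈ T.outside) : connectedComponentIn (conic Q)ᶜ p = T.outside := by
  have hc := T.compl_conic_eq hκ hQ
  have hp' : p ∈ (conic Q)ᶜ := by rw [hc]; exact Or.inr hp
  refine Set.Subset.antisymm ?_ ?_
  · refine isPreconnected_connectedComponentIn.subset_right_of_subset_union T.isOpen_inside
      T.isOpen_outside T.disjoint_inside_outside ?_ ⟨p, mem_connectedComponentIn hp', hp⟩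
    rw [← hc]
    exact connectedComponentIn_subset _ _
  · exact T.isPreconnected_outside.subset_connectedComponentIn hp
      (by rw [hc]; exact Set.subset_union_right)

theorem isOutsideConic_iff (hκ : κ ≠ 0) (hQ : ∀ w, Q (T.vec w) = κ * cone w) (p : RP2) :
    IsOutsideConic Q p ↔ p ∈ T.outside := by
  have hc := T.compl_conic_eq hκ hQ
  constructor
  · rintro ⟨h1, h2⟩
    have h3 : p ∈ T.inside ∪ T.outside := by rw [← hc]; exact h1
    refine h3.resolve_left fun hin => h2 ⟨h1, ?_⟩
    rw [T.connectedComponentIn_eq_inside hκ hQ hin]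
    exact ⟨T.insideHomeomorph⟩
  · intro hp
    have h1 : p ∉ conic Q := by
      change p ∈ (conic Q)ᶜ
      rw [hc]
      exact Or.inr hp
    refine ⟨h1, fun ⟨_, h3⟩ => ?_⟩
    rw [T.connectedComponentIn_eq_outside hκ hQ hp] at h3
    obtain ⟨e⟩ := h3
    exact T.isEmpty_outside_homeomorph.false e

end ConicFrame

/-! ### The conics through the vertices of a hexagon -/

theorem QuadraticMap.apply_combination (Q : QuadraticForm ℝ (Fin 3 → ℝ)) (a b c : Fin 3 → ℝ)
    (x y z : ℝ) : Q (x • a + y • b + z • c) = x ^ 2 * Q a + y ^ 2 * Q b + z ^ 2 * Q c +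
      x * y * QuadraticMap.polar Q a b + x * z * QuadraticMap.polar Q a c +
      y * z * QuadraticMap.polar Q b c := by
  rw [QuadraticMap.map_add Q, QuadraticMap.map_add Q, QuadraticMap.polar_add_left]
  simp only [QuadraticMap.map_smul, QuadraticMap.polar_smul_left, QuadraticMap.polar_smul_right,
    smul_eq_mul]
  ring

theorem QuadraticMap.apply_vecMul (Q : QuadraticForm ℝ (Fin 3 → ℝ)) (g : Matrix (Fin 3) (Fin 3) ℝ)
    (x : Fin 3 → ℝ) : Q (Matrix.vecMul x g) =
      x 0 ^ 2 * Q (g 0) + x 1 ^ 2 * Q (g 1) + x 2 ^ 2 * Q (g 2) +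
      x 0 * x 1 * QuadraticMap.polar Q (g 0) (g 1) + x 0 * x 2 * QuadraticMap.polar Q (g 0) (g 2) +
      x 1 * x 2 * QuadraticMap.polar Q (g 1) (g 2) := by
  have e : Matrix.vecMul x g = x 0 • g 0 + x 1 • g 1 + x 2 • g 2 := by
    ext i
    simp [Matrix.vecMul, dotProduct, Fin.sum_univ_three]
  rw [e]
  exact Q.apply_combination _ _ _ _ _ _

/-- The quadratic form that vanishes on the first five vectors of `normalHexagon α β γ δ`. -/
def hexagonConic (α γ : ℝ) (x : Fin 3 → ℝ) : ℝ :=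
  α * (1 + γ) * (x 1 * x 2) + γ * (1 + α) * (x 0 * x 2) + (γ - α) * (x 0 * x 1)

theorem hexagonConic_normalHexagon (α β γ δ : ℝ) :
    hexagonConic α γ (normalHexagon α β γ δ 5) = conicBr (normalHexagon α β γ δ) := by
  rw [conicBr_normalHexagon]
  simp [hexagonConic, normalHexagon]
  ring

/-- A quadratic form that vanishes on five vertices of a hexagon is a multiple of the standard
one. -/
theorem exists_eq_hexagonConic {Q : QuadraticForm ℝ (Fin 3 → ℝ)} {g : Matrix (Fin 3) (Fin 3) ℝ}
    {α β γ δ : ℝ} (hγ : α < γ)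
    (hQ : ∀ i, i ≠ 5 → Q (Matrix.vecMul (normalHexagon α β γ δ i) g) = 0) :
    ∃ μ, ∀ x, Q (Matrix.vecMul x g) = μ * hexagonConic α γ x := by
  have h0 := hQ 0 (by decide)
  have h1 := hQ 1 (by decide)
  have h2 := hQ 2 (by decide)
  have h3 := hQ 3 (by decide)
  have h4 := hQ 4 (by decide)
  simp only [Q.apply_vecMul g] at h0 h1 h2 h3 h4 ⊢
  generalize Q (g 0) = a at *
  generalize Q (g 1) = b at *
  generalize Q (g 2) = c at *
  generalize QuadraticMap.polar Q (g 0) (g 1) = p at *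
  generalize QuadraticMap.polar Q (g 0) (g 2) = q at *
  generalize QuadraticMap.polar Q (g 1) (g 2) = r at *
  simp [normalHexagon] at h0 h1 h2 h3 h4
  subst h0 h1 h2
  have hγα : γ - α ≠ 0 := (sub_pos.2 hγ).ne'
  refine ⟨p / (γ - α), fun x => ?_⟩
  have eq : q = p + r := by linarith
  subst eq
  have er : r * (γ - α) = p * (α * (1 + γ)) := by linarith
  have er' : r = p / (γ - α) * (α * (1 + γ)) := by field_simp; linarith
  have hp : p = p / (γ - α) * (γ - α) := by field_simp
  simp only [hexagonConic]
  generalize p / (γ - α) = m at *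
  subst er'
  rw [hp]
  ring

theorem exists_quadraticForm_hexagonConic {g : Matrix (Fin 3) (Fin 3) ℝ} (hg : g.det ≠ 0)
    (α γ : ℝ) : ∃ Q : QuadraticForm ℝ (Fin 3 → ℝ),
      ∀ x, Q (Matrix.vecMul x g) = hexagonConic α γ x := by
  let p : Fin 3 → (Fin 3 → ℝ) →ₗ[ℝ] ℝ := fun i => LinearMap.proj i
  let Q₀ : QuadraticForm ℝ (Fin 3 → ℝ) :=
    (α * (1 + γ)) • QuadraticMap.linMulLin (p 1) (p 2) +
    (γ * (1 + α)) • QuadraticMap.linMulLin (p 0) (p 2) +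
    (γ - α) • QuadraticMap.linMulLin (p 0) (p 1)
  refine ⟨Q₀.comp (Matrix.vecMulLinear g⁻¹), fun x => ?_⟩
  rw [QuadraticMap.comp_apply, Matrix.vecMulLinear_apply, Matrix.vecMul_vecMul,
    Matrix.mul_nonsing_inv _ (isUnit_iff_ne_zero.2 hg), Matrix.vecMul_one]
  simp [Q₀, p, hexagonConic]

/-- The rows form a basis in which the conic `hexagonConic` has the standard form: the form
`a * x₁ * x₂ + b * x₀ * x₂ + c * x₀ * x₁` becomes, in the coordinates `a⁻¹ * x₀`, `b⁻¹ * x₁`,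
`c⁻¹ * x₂`, a multiple of the elementary symmetric polynomial `e₂`, which has signature `(1, 2)`. -/
def hexagonFrame (α γ : ℝ) : Matrix (Fin 3) (Fin 3) ℝ :=
  !![α * (1 + γ), -(γ * (1 + α)), 0;
    -(α * (1 + γ)), -(γ * (1 + α)), γ - α;
    α * (1 + γ), γ * (1 + α), 0]

theorem det_hexagonFrame (α γ : ℝ) :
    (hexagonFrame α γ).det = -2 * (α * (1 + γ) * (γ * (1 + α)) * (γ - α)) := by
  rw [Matrix.det_fin_three]
  simp [hexagonFrame]
  ring

theorem hexagonConic_vecMul_hexagonFrame (α γ : ℝ) (w : Fin 3 → ℝ) :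
    hexagonConic α γ (Matrix.vecMul w (hexagonFrame α γ)) =
      α * (1 + γ) * (γ * (1 + α)) * (γ - α) * cone w := by
  simp [hexagonConic, hexagonFrame, cone, Matrix.vecMul, dotProduct, Fin.sum_univ_three]
  ring

/-- The sign of `μ` is irrelevant: inside and outside are distinguished by the sign of the multiple of
the form that has signature `(1, 2)`. -/
theorem isOutsideConic_iff_of_hexagonConic {Q : QuadraticForm ℝ (Fin 3 → ℝ)}
    {g : Matrix (Fin 3) (Fin 3) ℝ} (hg : g.det ≠ 0) {α γ μ : ℝ} (hα : 0 < α) (hγ : α < γ)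
    (hμ : μ ≠ 0) (hQ : ∀ x, Q (Matrix.vecMul x g) = μ * hexagonConic α γ x) {x : Fin 3 → ℝ}
    (hx : x ≠ 0) :
    IsOutsideConic Q (pt (Matrix.vecMul x g)) ↔ hexagonConic α γ x < 0 := by
  have hK : 0 < α * (1 + γ) * (γ * (1 + α)) * (γ - α) := by
    have := sub_pos.2 hγ
    have := hα.trans hγ
    positivity
  have hF : (hexagonFrame α γ).det ≠ 0 := by
    rw [det_hexagonFrame]
    exact mul_ne_zero (by norm_num) hK.ne'
  let T : ConicFrame := ⟨hexagonFrame α γ * g, by rw [Matrix.det_mul]; exact mul_ne_zero hF hg⟩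
  have hT : ∀ w, Q (T.vec w) = μ * (α * (1 + γ) * (γ * (1 + α)) * (γ - α)) * cone w := by
    intro w
    rw [ConicFrame.vec, ← Matrix.vecMul_vecMul, hQ, hexagonConic_vecMul_hexagonFrame]
    ring
  rw [T.isOutsideConic_iff (mul_ne_zero hμ hK.ne') hT]
  obtain ⟨w, rfl⟩ : ∃ w, Matrix.vecMul w (hexagonFrame α γ) = x :=
    ⟨Matrix.vecMul x (hexagonFrame α γ)⁻¹, by
      rw [Matrix.vecMul_vecMul, Matrix.nonsing_inv_mul _ (isUnit_iff_ne_zero.2 hF),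
        Matrix.vecMul_one]⟩
  have hw : w ≠ 0 := by
    rintro rfl
    exact hx (Matrix.zero_vecMul _)
  rw [Matrix.vecMul_vecMul]
  change pt (T.vec w) ∈ _ ↔ _
  rw [T.pt_vec_mem_outside hw, hexagonConic_vecMul_hexagonFrame]
  exact ⟨fun h => mul_neg_of_pos_of_neg hK h, fun h => neg_of_mul_neg_right h hK.le⟩

theorem mem_conic_pt_iff (Q : QuadraticForm ℝ (Fin 3 → ℝ)) {v : Fin 3 → ℝ} (hv : v ≠ 0) :
    pt v ∈ conic Q ↔ Q v = 0 := by
  obtain ⟨c, hc, e⟩ := exists_rep_pt hv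
  change Q (pt v).rep = 0 ↔ _
  rw [e, QuadraticMap.map_smul]
  simp [hc]

theorem eq_zero_of_apply_vecMul_eq_zero {Q : QuadraticForm ℝ (Fin 3 → ℝ)}
    {g : Matrix (Fin 3) (Fin 3) ℝ} (hg : g.det ≠ 0) (h : ∀ x, Q (Matrix.vecMul x g) = 0) :
    Q = 0 := by
  ext v
  have := h (Matrix.vecMul v g⁻¹)
  rwa [Matrix.vecMul_vecMul, Matrix.nonsing_inv_mul _ (isUnit_iff_ne_zero.2 hg),
    Matrix.vecMul_one] at this

namespace Positive

variable {V : Fin 6 → Fin 3 → ℝ} {P : PointConfig 6}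

/-- The last vertex of a hexagon is dominant if and only if the conic bracket is negative. -/
theorem isDominant_last_iff (h : Positive V) (hP : Represents V P) :
    P.IsDominant (pt (V 5)) ↔ conicBr V < 0 := by
  obtain ⟨g, c, α, β, γ, δ, hg, hc, hα, hβ, hγ, hδ, rfl⟩ := h.exists_normalHexagon
  have hN : ∀ i, normalHexagon α β γ δ i ≠ 0 :=
    (positive_normalHexagon hα hβ hγ hδ).simple.ne_zero
  have hpt : ∀ i, pt (c i • Matrix.vecMul (normalHexagon α β γ δ i) g) =
      pt (Matrix.vecMul (normalHexagon α β γ δ i) g) := fun i => pt_smul (hc i).ne' _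
  have hV0 := hP.simple.ne_zero
  have hsign : conicBr (fun i => c i • Matrix.vecMul (normalHexagon α β γ δ i) g) < 0 ↔
      conicBr (normalHexagon α β γ δ) < 0 := by
    rw [conicBr_smul_vecMul]
    have : 0 < (c 0 * c 1 * c 2 * c 3 * c 4 * c 5) ^ 2 * g.det ^ 4 := by
      have := hc 0; have := hc 1; have := hc 2; have := hc 3; have := hc 4; have := hc 5
      positivity
    exact ⟨fun h => neg_of_mul_neg_right h this.le, fun h => mul_neg_of_pos_of_neg this h⟩
  have hQc : ∀ (Q : QuadraticForm ℝ (Fin 3 → ℝ)) (i : Fin 6),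
      pt (c i • Matrix.vecMul (normalHexagon α β γ δ i) g) ∈ conic Q ↔
        Q (Matrix.vecMul (normalHexagon α β γ δ i) g) = 0 := by
    intro Q i
    rw [mem_conic_pt_iff Q (hV0 i), QuadraticMap.map_smul]
    simp [(hc i).ne']
  rw [hsign, ← hexagonConic_normalHexagon]
  constructor
  · rintro ⟨-, Q, hQ0, hQ, hout⟩
    obtain ⟨μ, hμ⟩ := exists_eq_hexagonConic (Q := Q) (g := g) (β := β) (δ := δ) hγ
      fun i hi => (hQc Q i).1 (hQ _ (hP.mem i) (hP.simple.injective.ne hi))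
    have hμ0 : μ ≠ 0 := by
      rintro rfl
      exact hQ0 (eq_zero_of_apply_vecMul_eq_zero hg.ne' (by simpa using hμ))
    rw [hpt] at hout
    exact (isOutsideConic_iff_of_hexagonConic hg.ne' hα hγ hμ0 hμ (hN 5)).1 hout
  · intro hneg
    obtain ⟨Q, hQ⟩ := exists_quadraticForm_hexagonConic hg.ne' α γ
    have hQ' : ∀ x, Q (Matrix.vecMul x g) = 1 * hexagonConic α γ x := by simpa using hQ
    refine ⟨hP.mem 5, Q, ?_, ?_, ?_⟩
    · rintro rfl
      exact hneg.ne (hQ (normalHexagon α β γ δ 5)).symm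
    · intro q hq hne
      obtain ⟨i, rfl⟩ := (hP.mem_iff q).1 hq
      have hi : i ≠ 5 := fun e => hne (by rw [e])
      rw [hQc, hQ]
      fin_cases i <;> simp [hexagonConic, normalHexagon] at hi ⊢ <;> ring
    · rw [hpt]
      exact (isOutsideConic_iff_of_hexagonConic hg.ne' hα hγ one_ne_zero hQ' (hN 5)).2 hneg

/-- The vertices of a hexagon form a typical configuration if and only if they are not on a
conic. -/
theorem isTypical_iff (h : Positive V) (hP : Represents V P) :
    P.IsTypical ↔ conicBr V ≠ 0 := by
  obtain ⟨g, c, α, β, γ, δ, hg, hc, hα, hβ, hγ, hδ, rfl⟩ := h.exists_normalHexagon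
  have hV0 := hP.simple.ne_zero
  have hzero : conicBr (fun i => c i • Matrix.vecMul (normalHexagon α β γ δ i) g) ≠ 0 ↔
      conicBr (normalHexagon α β γ δ) ≠ 0 := by
    rw [conicBr_smul_vecMul]
    have : (c 0 * c 1 * c 2 * c 3 * c 4 * c 5) ^ 2 * g.det ^ 4 ≠ 0 := by
      have := hc 0; have := hc 1; have := hc 2; have := hc 3; have := hc 4; have := hc 5
      positivity
    rw [mul_ne_zero_iff_left this]
  have hQc : ∀ (Q : QuadraticForm ℝ (Fin 3 → ℝ)) (i : Fin 6),
      pt (c i • Matrix.vecMul (normalHexagon α β γ δ i) g) ∈ conic Q ↔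
        Q (Matrix.vecMul (normalHexagon α β γ δ i) g) = 0 := by
    intro Q i
    rw [mem_conic_pt_iff Q (hV0 i), QuadraticMap.map_smul]
    simp [(hc i).ne']
  rw [hzero, ← hexagonConic_normalHexagon]
  constructor
  · rintro ⟨-, hno⟩ h0
    obtain ⟨Q, hQ⟩ := exists_quadraticForm_hexagonConic hg.ne' α γ
    refine hno ⟨P.1, subset_rfl, P.2, Q, ?_, ?_⟩
    · rintro rfl
      -- at `(1, 1, 0)` the form takes the value `γ - α`
      have := hQ ![1, 1, 0]
      simp [hexagonConic] at this
      linarith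
    · intro q hq
      obtain ⟨i, rfl⟩ := (hP.mem_iff q).1 hq
      rw [hQc, hQ]
      by_cases hi : i = 5
      · rw [hi, h0]
      · fin_cases i <;> simp [hexagonConic, normalHexagon] at hi ⊢ <;> ring
  · intro hne
    refine ⟨hP.isSimple, ?_⟩
    rintro ⟨S, hS, hcard, Q, hQ0, hQ⟩
    have hSP : S = P.1 := Finset.eq_of_subset_of_card_le hS (by rw [hcard, P.2])
    have hz : ∀ i, Q (Matrix.vecMul (normalHexagon α β γ δ i) g) = 0 := fun i =>
      (hQc Q i).1 (hQ _ (by rw [hSP]; exact hP.mem i))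
    obtain ⟨μ, hμ⟩ := exists_eq_hexagonConic (Q := Q) (g := g) (β := β) (δ := δ) hγ
      fun i _ => hz i
    have h5 := hz 5
    rw [hμ] at h5
    rcases mul_eq_zero.1 h5 with rfl | h5
    · exact hQ0 (eq_zero_of_apply_vecMul_eq_zero hg.ne' (by simpa using hμ))
    · exact hne h5

end Positive

/-! ### Symmetries of hexagons -/

namespace Positive

variable {V W : Fin 6 → Fin 3 → ℝ} {P Q : PointConfig 6}

/-- Relabellings that preserve positivity up to the common sign `e` of the vectors; the condition on
`f` is decidable. -/
theorem comp_of_altSign (h : Positive V) {f : Fin 6 → Fin 6} {e : ℤ}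
    (hf : ∀ i j k, i < j → j < k → f i ≠ f j ∧ f j ≠ f k ∧ f i ≠ f k ∧
      0 < e * e * e * altSign (fun _ _ _ => 1) (f i) (f j) (f k)) :
    Positive fun i => (e : ℝ) • V (f i) := by
  intro i j k hij hjk
  obtain ⟨h1, h2, h3, h4⟩ := hf i j k hij hjk
  rw [br_smul]
  have h5 : (0 : ℝ) < e * e * e * (altSign (fun _ _ _ => 1) (f i) (f j) (f k) : ℤ) := by
    exact_mod_cast h4
  exact mul_pos_trans h5 (h.hasSigns.alt h1 h2 h3)

theorem rotate (h : Positive V) (k : Fin 6) : Positive fun i => V (i + k) := by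
  have := h.comp_of_altSign (f := fun i => i + k) (e := 1) (by revert k; decide +kernel)
  simpa using this

theorem reflect (h : Positive V) : Positive fun i => (-1 : ℝ) • V (-i) := by
  have := h.comp_of_altSign (f := fun i => -i) (e := -1) (by decide +kernel)
  simpa using this

end Positive

theorem conicBr_smul (s : ℝ) (V : Fin 6 → Fin 3 → ℝ) :
    conicBr (fun i => s • V i) = s ^ 12 * conicBr V := by
  simp only [conicBr, br_smul]; ring

/-- A vertex of a hexagon is dominant or not depending on its parity and on the sign of the conic
bracket. -/
theorem Positive.isDominant_iff {V : Fin 6 → Fin 3 → ℝ} {P : PointConfig 6} (h : Positive V)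
    (hP : Represents V P) (i : Fin 6) :
    P.IsDominant (pt (V i)) ↔ if i.val % 2 = 0 then 0 < conicBr V else conicBr V < 0 := by
  -- a cyclic shift of the numeration changes the sign of the conic bracket, so that the case of the
  -- last vertex implies all others
  have step : ∀ j : Fin 6, (∀ V, Positive V → Represents V P →
      (P.IsDominant (pt (V j)) ↔ if j.val % 2 = 0 then 0 < conicBr V else conicBr V < 0)) →
      ∀ V, Positive V → Represents V P → (P.IsDominant (pt (V (j + 1))) ↔
        if (j + 1).val % 2 = 0 then 0 < conicBr V else conicBr V < 0) := by
    intro j hj V h hP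
    have hP' : Represents (fun i => V (i + 1)) P := by
      simpa using hP.relabel (Equiv.addRight (1 : Fin 6)) (c := 1) (by simp)
    rw [hj _ (h.rotate 1) hP', conicBr_rotate]
    have hpar : (j + 1).val % 2 = 0 ↔ ¬ j.val % 2 = 0 := by clear hj; revert j; decide
    by_cases hpj : j.val % 2 = 0
    · rw [if_pos hpj, if_neg (by rw [hpar]; exact not_not.2 hpj), neg_pos]
    · rw [if_neg hpj, if_pos (hpar.2 hpj), neg_lt_zero]
  have s5 : ∀ V, Positive V → Represents V P → (P.IsDominant (pt (V 5)) ↔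
      if (5 : Fin 6).val % 2 = 0 then 0 < conicBr V else conicBr V < 0) :=
    fun V h hP => h.isDominant_last_iff hP
  have s0 := step 5 s5
  have s1 := step 0 s0
  have s2 := step 1 s1
  have s3 := step 2 s2
  have s4 := step 3 s3
  fin_cases i
  exacts [s0 V h hP, s1 V h hP, s2 V h hP, s3 V h hP, s4 V h hP, s5 V h hP]

/-- Multiplication by two, from the integers modulo three to those modulo six. -/
def twice : ZMod 3 → Fin 6 := fun i : Fin 3 => ![0, 2, 4] i

/-- The action of the dihedral group of order `6` on the vertices of a hexagon that preserves the
parity of the vertices. -/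
def hexagonAct : DihedralGroup 3 → Fin 6 → Fin 6
  | .r i, x => x + twice i
  | .sr i, x => -(x + twice i)

theorem hexagonAct_mul : ∀ (a b : DihedralGroup 3) (x : Fin 6),
    hexagonAct (a * b) x = hexagonAct a (hexagonAct b x) := by
  decide +kernel

theorem hexagonAct_one : ∀ x : Fin 6, hexagonAct 1 x = x := by decide +kernel

/-- `hexagonAct` as a permutation representation. -/
def hexagonPerm : DihedralGroup 3 →* Equiv.Perm (Fin 6) where
  toFun d :=
    { toFun := hexagonAct d
      invFun := hexagonAct d⁻¹
      left_inv := fun x => by rw [← hexagonAct_mul, inv_mul_cancel, hexagonAct_one]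
      right_inv := fun x => by rw [← hexagonAct_mul, mul_inv_cancel, hexagonAct_one] }
  map_one' := Equiv.ext hexagonAct_one
  map_mul' a b := Equiv.ext (hexagonAct_mul a b)

theorem hexagonPerm_injective : Function.Injective hexagonPerm := by
  have h : ∀ a b : DihedralGroup 3, hexagonAct a 0 = hexagonAct b 0 →
    hexagonAct a 1 = hexagonAct b 1 → a = b := by decide +kernel
  intro a b hab
  exact h a b (DFunLike.congr_fun hab 0) (DFunLike.congr_fun hab 1)

/-- The edges of the hexagon. -/
def HexAdj (i j : Fin 6) : Prop := j = i + 1 ∨ i = j + 1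

instance (i j : Fin 6) : Decidable (HexAdj i j) := by unfold HexAdj; infer_instance

/-- An automorphism of the hexagon is determined by the images of two neighbours, and each next vertex
is the neighbour of the previous one that has not been used. -/
theorem exists_hexagonAct : ∀ a : Fin 6, a.val % 2 = 0 → ∀ b, HexAdj a b → ∀ c, c ≠ a → HexAdj b c →
    ∀ d, d ≠ b → HexAdj c d → ∀ e, e ≠ c → HexAdj d e → ∀ f, f ≠ d → HexAdj e f →
    ∃ g : DihedralGroup 3, ∀ i, hexagonAct g i = ![a, b, c, d, e, f] i := by
  decide +kernel

theorem exists_hexagonPerm_eq {τ : Equiv.Perm (Fin 6)}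
    (hadj : ∀ i j, HexAdj (τ i) (τ j) ↔ HexAdj i j)
    (hpar : ∀ i, (τ i).val % 2 = 0 ↔ i.val % 2 = 0) : ∃ d, hexagonPerm d = τ := by
  obtain ⟨g, hg⟩ := exists_hexagonAct (τ 0) ((hpar 0).2 (by decide))
    (τ 1) ((hadj _ _).2 (by decide)) (τ 2) (τ.injective.ne (by decide)) ((hadj _ _).2 (by decide))
    (τ 3) (τ.injective.ne (by decide)) ((hadj _ _).2 (by decide))
    (τ 4) (τ.injective.ne (by decide)) ((hadj _ _).2 (by decide))
    (τ 5) (τ.injective.ne (by decide)) ((hadj _ _).2 (by decide))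
  refine ⟨g, Equiv.ext fun i => (hg i).trans ?_⟩
  fin_cases i <;> rfl

/-- A dihedral relabelling of a hexagon is again a hexagon, up to a common factor, with the same
sign of the conic bracket. -/
theorem Positive.relabel_hexagonPerm {V : Fin 6 → Fin 3 → ℝ} (h : Positive V) (d : DihedralGroup 3) :
    ∃ s : ℝ, s ≠ 0 ∧ Positive (fun i => s • V (hexagonPerm d i)) ∧
      ∃ m : ℝ, 0 < m ∧ conicBr (fun i => s • V (hexagonPerm d i)) = m * conicBr V := by
  have h2 : ∀ V : Fin 6 → Fin 3 → ℝ, conicBr (fun i => V (i + 2)) = conicBr V := by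
    intro V
    have h1 := conicBr_rotate (fun i => V (i + 1))
    rw [conicBr_rotate V, neg_neg] at h1
    rw [← h1]
    congr 1
    funext i
    rw [add_assoc]
    rfl
  have hr : ∀ (V : Fin 6 → Fin 3 → ℝ) (k : ZMod 3),
      conicBr (fun i => V (i + twice k)) = conicBr V := by
    intro V k
    fin_cases k
    · change conicBr (fun i => V (i + 0)) = _
      simp
    · exact h2 V
    · have h4 := h2 (fun i => V (i + 2))
      rw [h2 V] at h4
      rw [← h4]
      congr 1
      funext i
      rw [add_assoc]
      rfl
  rcases d with k | k
  · refine ⟨1, one_ne_zero, ?_, 1, one_pos, ?_⟩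
    · simp only [one_smul]
      exact h.rotate (twice k)
    · simp only [one_smul, one_mul]
      exact hr V k
  · refine ⟨-1, by norm_num, ?_, 1, one_pos, ?_⟩
    · exact h.reflect.rotate (twice k)
    · rw [conicBr_smul]
      have := hr (fun i => V (-i)) k
      rw [conicBr_neg_index] at this
      change (-1) ^ 12 * conicBr (fun i => V (-(i + twice k))) = _
      rw [this]
      norm_num

/-! ### Deformations of hexagons -/

/-- Hexagons with the same sign of the conic bracket are joined by a path of hexagons whose vertices
are not on a conic. -/
theorem Positive.exists_path {V W : Fin 6 → Fin 3 → ℝ} (hV : Positive V) (hW : Positive W)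
    (h : 0 < conicBr V * conicBr W) :
    ∃ Γ : Path V W, ∀ t, Positive (Γ t) ∧ conicBr (Γ t) ≠ 0 := by
  have main : ∀ V W : Fin 6 → Fin 3 → ℝ, Positive V → Positive W → conicBr V < 0 →
      conicBr W < 0 → ∃ Γ : Path V W, ∀ t, Positive (Γ t) ∧ conicBr (Γ t) ≠ 0 := by
    intro V W hV hW h1 h2
    obtain ⟨Γ, hΓ⟩ := isPathConnected_negativeHexagons.joinedIn V ⟨hV, h1⟩ W ⟨hW, h2⟩
    exact ⟨Γ, fun t => ⟨(hΓ t).1, (hΓ t).2.ne⟩⟩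
  rcases mul_pos_iff.1 h with ⟨h1, h2⟩ | ⟨h1, h2⟩
  -- two hexagons with positive bracket become negative after a cyclic shift
  · obtain ⟨Γ, hΓ⟩ := main _ _ (hV.rotate 1) (hW.rotate 1) (by rw [conicBr_rotate]; linarith)
      (by rw [conicBr_rotate]; linarith)
    have hback : ∀ U : Fin 6 → Fin 3 → ℝ, (fun i => U (i + 5 + 1)) = U := by
      intro U
      funext i
      rw [add_assoc]
      exact congrArg U (add_zero i)
    have hcont : Continuous fun (U : Fin 6 → Fin 3 → ℝ) (i : Fin 6) => U (i + 5) := by fun_prop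
    refine ⟨(Γ.map hcont).cast (hback V).symm (hback W).symm, fun t => ?_⟩
    change Positive (fun i => Γ t (i + 5)) ∧ conicBr (fun i => Γ t (i + 5)) ≠ 0
    refine ⟨(hΓ t).1.rotate 5, fun h0 => (hΓ t).2 ?_⟩
    have := conicBr_rotate (fun i => Γ t (i + 5))
    rw [h0, neg_zero] at this
    rw [← this]
    congr 1
    funext i
    rw [add_assoc]
    exact congrArg (Γ t) (add_zero i).symm
  · exact main V W hV hW h1 h2

theorem continuous_ofOrdered {n : ℕ} : Continuous (ofOrdered (n := n)) := continuous_coinduced_rng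

theorem Positive.exists_deformation {V W : Fin 6 → Fin 3 → ℝ} {P Q : PointConfig 6}
    (hV : Positive V) (hW : Positive W) (hP : Represents V P) (hQ : Represents W Q)
    (h : 0 < conicBr V * conicBr W) :
    ∃ γ : Path P Q, IsQDeformation γ ∧ (∀ t, (γ t).IsCyclic) ∧
      ∀ i, Takes γ (pt (V i)) (pt (W i)) := by
  obtain ⟨Γ, hΓ⟩ := hV.exists_path hW h
  have hpt : ∀ i, Continuous fun t => pt (Γ t i) := fun i =>
    Continuous.pt ((continuous_apply i).comp Γ.continuous) fun t => (hΓ t).1.simple.ne_zero i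
  have hrep : ∀ t, Represents (Γ t) (ofOrdered ⟨_, (hΓ t).1.simple.injective⟩) :=
    fun t => (hΓ t).1.simple.represents
  let γ : Path P Q :=
    { toFun := fun t => ofOrdered ⟨fun i => pt (Γ t i), (hΓ t).1.simple.injective⟩
      continuous_toFun := continuous_ofOrdered.comp
        (Continuous.subtype_mk (continuous_pi hpt) fun t => (hΓ t).1.simple.injective)
      source' := by
        exact (hrep 0).unique (by rw [Γ.source]; exact hP)
      target' := (hrep 1).unique (by rw [Γ.target]; exact hQ) }
  have hγ : ∀ t, Represents (Γ t) (γ t) := hrep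
  refine ⟨γ, fun t => ((hΓ t).1.isTypical_iff (hγ t)).2 (hΓ t).2,
    fun t => (hγ t).isCyclic_iff.2 (hΓ t).1.connected, fun i => ?_⟩
  exact ⟨⟨⟨fun t => pt (Γ t i), hpt i⟩, by simp, by simp⟩, fun t => (hγ t).mem i⟩

theorem exists_mul_pos_of_rotate {V W : Fin 6 → Fin 3 → ℝ} (hV : conicBr V ≠ 0)
    (hW : conicBr W ≠ 0) :
    0 < conicBr V * conicBr W ∨ 0 < conicBr V * conicBr (fun i => W (i + 1)) := by
  rw [conicBr_rotate]
  rcases (mul_ne_zero hV hW).lt_or_gt with h | h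
  · right; linarith
  · left; exact h

theorem Represents.rotate {V : Fin 6 → Fin 3 → ℝ} {P : PointConfig 6} (h : Represents V P)
    (k : Fin 6) : Represents (fun i => V (i + k)) P := by
  simpa using h.relabel (Equiv.addRight k) (c := 1) (by simp)

theorem exists_deformation_of_cyclic {P Q : PointConfig 6} (hP : P.IsTypical) (hPc : P.IsCyclic)
    (hQ : Q.IsTypical) (hQc : Q.IsCyclic) :
    ∃ γ : Path P Q, IsQDeformation γ ∧ ∀ t, (γ t).IsCyclic := by
  obtain ⟨V, hV, hVP⟩ := hPc.exists_positive
  obtain ⟨W, hW, hWQ⟩ := hQc.exists_positive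
  rcases exists_mul_pos_of_rotate ((hV.isTypical_iff hVP).1 hP) ((hW.isTypical_iff hWQ).1 hQ)
    with h | h
  · obtain ⟨γ, h1, h2, -⟩ := hV.exists_deformation hW hVP hWQ h
    exact ⟨γ, h1, h2⟩
  · obtain ⟨γ, h1, h2, -⟩ := hV.exists_deformation (hW.rotate 1) hVP (hWQ.rotate 1) h
    exact ⟨γ, h1, h2⟩

/-- A dominant vertex can be taken as the first one, and then the conic bracket is positive. -/
theorem exists_deformation_of_hexagonal {P Q : PointConfig 6} {p q : RP2} (hP : P.IsHexagonal)
    (hQ : Q.IsHexagonal) (hp : P.IsDominant p) (hq : Q.IsDominant q) :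
    ∃ γ : Path P Q, IsQDeformation γ ∧ Takes γ p q := by
  have key : ∀ {P : PointConfig 6} {p : RP2}, P.IsHexagonal → P.IsDominant p →
      ∃ V, Positive V ∧ Represents V P ∧ pt (V 0) = p ∧ 0 < conicBr V := by
    intro P p hP hp
    obtain ⟨V, hV, hVP⟩ := hP.exists_positive
    obtain ⟨i, rfl⟩ := (hVP.mem_iff p).1 hp.1
    have h0 : (fun j => V (j + i)) 0 = V i := congrArg V (zero_add i)
    refine ⟨fun j => V (j + i), hV.rotate i, hVP.rotate i, by rw [h0], ?_⟩
    have := (hV.rotate i).isDominant_iff (hVP.rotate i) 0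
    exact (this.trans (if_pos rfl).to_iff).1 (by rwa [zero_add])
  obtain ⟨V, hV, hVP, rfl, hV0⟩ := key hP hp
  obtain ⟨W, hW, hWQ, rfl, hW0⟩ := key hQ hq
  obtain ⟨γ, h1, -, h3⟩ := hV.exists_deformation hW hVP hWQ (mul_pos hV0 hW0)
  exact ⟨γ, h1, h3 0⟩

theorem typicalCyclicSpace_nonempty : typicalCyclicSpace.Nonempty := by
  have hV : Positive (normalHexagon 1 2 2 5) :=
    positive_normalHexagon (by norm_num) (by norm_num) (by norm_num) (by norm_num)
  have hP := hV.simple.represents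
  refine ⟨_, (hV.isTypical_iff hP).2 ?_, hP.isCyclic_iff.2 hV.connected⟩
  rw [conicBr_normalHexagon]
  norm_num

theorem isPathConnected_typicalCyclicSpace : IsPathConnected typicalCyclicSpace := by
  obtain ⟨P, hP⟩ := typicalCyclicSpace_nonempty
  refine ⟨P, hP, fun {Q} hQ => ?_⟩
  obtain ⟨γ, h1, h2⟩ := exists_deformation_of_cyclic hP.1 hP.2 hQ.1 hQ.2
  exact ⟨γ, fun t => ⟨h1 t, h2 t⟩⟩

/-! ### Properties that are constant along deformations -/

namespace PointConfig

/-- If two points of a varying configuration coincide at some moment, then they stay together: the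
points of a configuration have disjoint neighbourhoods, and a nearby configuration has just one
point in each of them. -/
theorem isOpen_setOf_eq {X : Type*} [TopologicalSpace X] {n : ℕ} {γ : X → PointConfig n}
    (hγ : Continuous γ) {a b : X → RP2} (ha : Continuous a) (hb : Continuous b)
    (haγ : ∀ t, a t ∈ γ t) (hbγ : ∀ t, b t ∈ γ t) : IsOpen {t | a t = b t} := by
  rw [isOpen_iff_mem_nhds]
  intro t₀ ht₀
  obtain ⟨f, hf⟩ := (γ t₀).exists_ofOrdered_eq
  obtain ⟨U, hU, hUd⟩ := (Set.toFinite (Set.range f.1)).t2_separation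
  have hdisj : ∀ {i j : Fin n} {x : RP2}, x ∈ U (f.1 i) → x ∈ U (f.1 j) → i = j := by
    intro i j x hi hj
    by_contra hne
    exact Set.disjoint_left.1 (hUd ⟨i, rfl⟩ ⟨j, rfl⟩ (f.2.ne hne)) hi hj
  -- the configurations with a numeration close to `f`
  let O : Set (PointConfig n) := {P | ∃ g, ofOrdered g = P ∧ ∀ i, g.1 i ∈ U (f.1 i)}
  have hO : IsOpen O := by
    rw [isOpen_coinduced]
    have e : ofOrdered ⁻¹' O = ⋃ τ : Equiv.Perm (Fin n), ⋂ i,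
        {g : {g : Fin n → RP2 // Function.Injective g} | g.1 (τ i) ∈ U (f.1 i)} := by
      ext g
      simp only [Set.mem_preimage, Set.mem_iUnion, Set.mem_iInter]
      constructor
      · rintro ⟨g', hg', hU'⟩
        have hmem : ∀ i, ∃ j, g.1 j = g'.1 i := fun i => by
          have h : g'.1 i ∈ ofOrdered g' := (mem_ofOrdered g' _).2 ⟨i, rfl⟩
          rw [hg'] at h
          exact (mem_ofOrdered g _).1 h
        choose τ hτ using hmem
        have hinj : Function.Injective τ := fun i j hij => g'.2 (by rw [← hτ, ← hτ, hij])
        refine ⟨Equiv.ofBijective τ (Finite.injective_iff_bijective.1 hinj), fun i => ?_⟩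
        change g.1 (τ i) ∈ U (f.1 i)
        rw [hτ]
        exact hU' i
      · rintro ⟨τ, hτ⟩
        refine ⟨⟨fun i => g.1 (τ i), g.2.comp τ.injective⟩, ?_, hτ⟩
        refine ext_mem fun p => ?_
        rw [mem_ofOrdered, mem_ofOrdered]
        exact ⟨fun ⟨i, hi⟩ => ⟨τ i, hi⟩, fun ⟨i, hi⟩ => ⟨τ.symm i, by simpa using hi⟩⟩
    rw [e]
    refine isOpen_iUnion fun τ => isOpen_iInter_of_finite fun i => ?_
    exact (hU (f.1 i)).2.preimage ((continuous_apply (τ i)).comp continuous_subtype_val)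
  obtain ⟨i, hi⟩ := (mem_ofOrdered f (a t₀)).1 (by rw [hf]; exact haγ t₀)
  have hU₀ : U (f.1 i) ∈ 𝓝 (a t₀) := by
    rw [← hi]
    exact (hU _).2.mem_nhds (hU _).1
  have hb₀ : b ⁻¹' U (f.1 i) ∈ 𝓝 t₀ :=
    hb.continuousAt (by rw [← show a t₀ = b t₀ from ht₀]; exact hU₀)
  filter_upwards [(hO.preimage hγ).mem_nhds ⟨f, hf, fun j => (hU _).1⟩, ha.continuousAt hU₀, hb₀]
    with t htO hat hbt
  obtain ⟨g, hg, hgU⟩ := htO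
  obtain ⟨j, hj⟩ := (mem_ofOrdered g (a t)).1 (by rw [hg]; exact haγ t)
  obtain ⟨k, hk⟩ := (mem_ofOrdered g (b t)).1 (by rw [hg]; exact hbγ t)
  have hat' : a t ∈ U (f.1 i) := hat
  have hbt' : b t ∈ U (f.1 i) := hbt
  have hji : j = i := hdisj (hgU j) (by rw [hj]; exact hat')
  have hki : k = i := hdisj (hgU k) (by rw [hk]; exact hbt')
  change a t = b t
  rw [← hj, ← hk, hji, hki]

/-- Points of a varying configuration that are distinct at the beginning remain distinct. -/
theorem forall_ne_of_ne {n : ℕ} {γ : unitInterval → PointConfig n} (hγ : Continuous γ)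
    {a b : unitInterval → RP2} (ha : Continuous a) (hb : Continuous b) (haγ : ∀ t, a t ∈ γ t)
    (hbγ : ∀ t, b t ∈ γ t) (h0 : a 0 ≠ b 0) (t : unitInterval) : a t ≠ b t := by
  have hclopen : IsClopen {t | a t = b t} :=
    ⟨isClosed_eq ha hb, isOpen_setOf_eq hγ ha hb haγ hbγ⟩
  rcases isClopen_iff.1 hclopen with h | h
  · intro hab
    have : t ∈ {t | a t = b t} := hab
    rw [h] at this
    exact this
  · exact absurd (by rw [h]; trivial : (0 : unitInterval) ∈ {t | a t = b t}) h0

/-- Being cyclic is locally constant on the space of simple configurations, since the adjacency graph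
depends on the signs of determinants only. -/
theorem eventually_isCyclic_iff {P : PointConfig 6} (hP : P.IsSimple) :
    ∀ᶠ P' in 𝓝 P, P'.IsCyclic ↔ P.IsCyclic := by
  obtain ⟨V, hV⟩ := hP.exists_represents
  set O : Set (PointConfig 6) := {P' | ∃ W, Represents W P' ∧ ∀ i j k, i ≠ j → j ≠ k → i ≠ k →
    0 < br (V i) (V j) (V k) * br (W i) (W j) (W k)} with hO
  have hsub : ∀ P' ∈ O, (P'.IsCyclic ↔ P.IsCyclic) := by
    rintro P' ⟨W, hW, hs⟩
    rw [hW.isCyclic_iff, hV.isCyclic_iff, signGraph_congr hs]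
  have hOopen : IsOpen O := by
    rw [isOpen_coinduced, isOpen_iff_mem_nhds]
    rintro f ⟨W, hW, hs⟩
    -- renumber `W` in the order given by `f`
    have hmem : ∀ i, ∃ j, pt (W j) = f.1 i := fun i => by
      rw [← hW.mem_iff, mem_ofOrdered]; exact ⟨i, rfl⟩
    choose τ hτ using hmem
    have hinj : Function.Injective τ := fun i j hij => f.2 (by rw [← hτ, ← hτ, hij])
    let σ : Equiv.Perm (Fin 6) := Equiv.ofBijective τ (Finite.injective_iff_bijective.1 hinj)
    have hσ : ∀ i, pt (W (σ i)) = f.1 i := hτ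
    let S : Set (Fin 6 → Fin 3 → ℝ) := ⋂ i, ⋂ j, ⋂ k, {W' | i ≠ j → j ≠ k → i ≠ k →
      0 < br (V i) (V j) (V k) * br (W' (σ.symm i)) (W' (σ.symm j)) (W' (σ.symm k))}
    have hS : IsOpen S := by
      refine isOpen_iInter_of_finite fun i => isOpen_iInter_of_finite fun j =>
        isOpen_iInter_of_finite fun k => ?_
      by_cases h : i ≠ j ∧ j ≠ k ∧ i ≠ k
      · simp only [ne_eq, h.1, h.2.1, h.2.2, not_false_eq_true, forall_const]
        refine isOpen_lt continuous_const (continuous_const.mul (continuous_br ?_ ?_ ?_)) <;>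
          fun_prop
      · convert isOpen_univ
        rw [Set.eq_univ_iff_forall]
        intro W' h1 h2 h3
        exact absurd ⟨h1, h2, h3⟩ h
    have hWS : (fun i => W (σ i)) ∈ S := by
      simp only [S, Set.mem_iInter]
      intro i j k h1 h2 h3
      simpa using hs i j k h1 h2 h3
    have himg := image_pt_mem_nhds (fun i => hW.simple.ne_zero (σ i)) (hS.mem_nhds hWS)
    have hf : (fun i => pt (W (σ i))) = f.1 := funext hσ
    rw [hf] at himg
    filter_upwards [continuous_subtype_val.continuousAt himg] with f' hf'
    obtain ⟨W', hW'S, hW'f⟩ := hf'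
    simp only [S, Set.mem_iInter] at hW'S
    have hsimple : SimpleTuple fun i => W' (σ.symm i) := by
      intro i j k h1 h2 h3 h0
      have := hW'S i j k h1 h2 h3
      simp [h0] at this
    refine ⟨fun i => W' (σ.symm i), ⟨hsimple, fun p => ?_⟩, hW'S⟩
    rw [mem_ofOrdered, ← hW'f]
    exact ⟨fun ⟨i, hi⟩ => ⟨σ i, by simpa using hi⟩, fun ⟨i, hi⟩ => ⟨σ.symm i, hi⟩⟩
  have hPO : P ∈ O := ⟨V, hV, fun i j k h1 h2 h3 => mul_self_pos.2 (hV.simple i j k h1 h2 h3)⟩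
  filter_upwards [hOopen.mem_nhds hPO] with P' hP'
  exact hsub P' hP'

/-- A property of the points of an interval that is locally constant is constant. -/
theorem iff_of_eventually_iff {p : unitInterval → Prop} (h : ∀ t, ∀ᶠ t' in 𝓝 t, p t' ↔ p t)
    (s t : unitInterval) : p s ↔ p t := by
  have hloc : IsLocallyConstant p :=
    (IsLocallyConstant.iff_eventually_eq p).2 fun x => (h x).mono fun y hy => propext hy
  exact iff_of_eq (hloc.apply_eq_of_isPreconnected isPreconnected_univ trivial trivial)

theorem isCyclic_iff_of_path {P Q : PointConfig 6} (γ : Path P Q) (hγ : ∀ t, (γ t).IsSimple)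
    (s t : unitInterval) : (γ s).IsCyclic ↔ (γ t).IsCyclic :=
  iff_of_eventually_iff (p := fun t => (γ t).IsCyclic)
    (fun t => γ.continuous.continuousAt (eventually_isCyclic_iff (hγ t))) s t

theorem pathComponentIn_typicalSpace {P : PointConfig 6} (hP : P ∈ typicalCyclicSpace) :
    pathComponentIn (typicalSpace 6) P = typicalCyclicSpace := by
  refine Set.Subset.antisymm ?_ ?_
  · rintro Q ⟨γ, hγ⟩
    have h0 : (γ 0).IsCyclic := by rw [γ.source]; exact hP.2
    have h1 := (isCyclic_iff_of_path γ (fun t => (hγ t).1) 0 1).1 h0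
    rw [γ.target] at h1
    exact ⟨by have := hγ 1; rwa [γ.target] at this, h1⟩
  · exact isPathConnected_typicalCyclicSpace.subset_pathComponentIn hP fun Q hQ => hQ.1

/-- A numeration of the points of a varying typical cyclic configuration is locally a numeration of
the vertices of a hexagon, with a fixed sign of the conic bracket. -/
theorem eventually_exists_positive {X : Type*} [TopologicalSpace X] {γ : X → PointConfig 6}
    {s : Fin 6 → X → RP2} (hs : ∀ i, Continuous (s i)) (hsγ : ∀ i t, s i t ∈ γ t)
    (hinj : ∀ t, Function.Injective fun i => s i t) (t₀ : X) (ht : (γ t₀).IsTypical)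
    (hc : (γ t₀).IsCyclic) :
    ∃ (τ : Equiv.Perm (Fin 6)) (m : ℝ), ∀ᶠ t in 𝓝 t₀, ∃ V, Positive V ∧ Represents V (γ t) ∧
      0 < m * conicBr V ∧ ∀ i, s i t = pt (V (τ i)) := by
  obtain ⟨V, hV, hVγ⟩ := hc.exists_positive
  have hne := (hV.isTypical_iff hVγ).1 ht
  have hmem : ∀ i, ∃ j, pt (V j) = s i t₀ := fun i => (hVγ.mem_iff _).1 (hsγ i t₀)
  choose τ hτ using hmem
  have hτinj : Function.Injective τ := fun i j hij => hinj t₀ (by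
    change s i t₀ = s j t₀
    rw [← hτ, ← hτ, hij])
  let σ : Equiv.Perm (Fin 6) := Equiv.ofBijective τ (Finite.injective_iff_bijective.1 hτinj)
  have hσ : ∀ i, pt (V (σ i)) = s i t₀ := hτ
  refine ⟨σ, conicBr V, ?_⟩
  let S : Set (Fin 6 → Fin 3 → ℝ) := {W | Positive (fun i => W (σ.symm i)) ∧
    0 < conicBr V * conicBr (fun i => W (σ.symm i))}
  have hS : IsOpen S := by
    have hrel : Continuous fun (W : Fin 6 → Fin 3 → ℝ) (i : Fin 6) => W (σ.symm i) := by fun_prop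
    refine IsOpen.inter ?_ (isOpen_lt continuous_const
      (continuous_const.mul (continuous_conicBr.comp hrel)))
    have e : {W : Fin 6 → Fin 3 → ℝ | Positive fun i => W (σ.symm i)} = ⋂ i, ⋂ j, ⋂ k,
        {W | i < j → j < k → 0 < br (W (σ.symm i)) (W (σ.symm j)) (W (σ.symm k))} := by
      ext W
      simp only [Set.mem_iInter]
      rfl
    change IsOpen {W : Fin 6 → Fin 3 → ℝ | Positive fun i => W (σ.symm i)}
    rw [e]
    refine isOpen_iInter_of_finite fun i => isOpen_iInter_of_finite fun j =>
      isOpen_iInter_of_finite fun k => ?_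
    by_cases h : i < j ∧ j < k
    · simp only [h.1, h.2, forall_const]
      refine isOpen_lt continuous_const (continuous_br ?_ ?_ ?_) <;> fun_prop
    · convert isOpen_univ
      rw [Set.eq_univ_iff_forall]
      intro W h1 h2
      exact absurd ⟨h1, h2⟩ h
  have hVS : (fun i => V (σ i)) ∈ S := by
    change Positive (fun i => V (σ (σ.symm i))) ∧
      0 < conicBr V * conicBr (fun i => V (σ (σ.symm i)))
    simp only [Equiv.apply_symm_apply]
    exact ⟨hV, mul_self_pos.2 hne⟩
  have himg := image_pt_mem_nhds (fun i => hV.simple.ne_zero (σ i)) (hS.mem_nhds hVS)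
  rw [funext hσ] at himg
  filter_upwards [(continuous_pi hs).continuousAt himg] with t hst
  obtain ⟨W, ⟨hW, hm⟩, hWs⟩ := hst
  have hWs' : ∀ i, pt (W i) = s i t := fun i => congrFun hWs i
  refine ⟨fun i => W (σ.symm i), hW, ?_, hm, fun i => by simp [hWs']⟩
  -- `γ t` contains the six points represented by `W`, hence it has no others
  have hγ : ofOrdered ⟨_, hW.simple.injective⟩ = γ t := by
    refine Subtype.ext (Finset.eq_of_subset_of_card_le ?_ ?_)
    · intro p hp
      obtain ⟨i, rfl⟩ := (mem_ofOrdered _ p).1 hp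
      change pt (W (σ.symm i)) ∈ _
      rw [hWs']
      exact hsγ _ t
    · rw [(γ t).2, (ofOrdered _).2]
  rw [← hγ]
  exact hW.simple.represents

end PointConfig

/-! ### The monodromy group -/

namespace Represents

variable {V : Fin 6 → Fin 3 → ℝ} {P : PointConfig 6}

theorem adj_iff_hexAdj (h : Represents V P) (hV : Positive V) (i j : Fin 6) :
    P.adjacencyGraph.Adj (h.equiv i) (h.equiv j) ↔ HexAdj i j :=
  (h.adj_iff i j).trans (hV.adj_iff i j)

end Represents

namespace PointConfig

theorem adjacencyGraph_adj_congr {n : ℕ} {P Q : PointConfig n} (h : P = Q) {p q : P.Pt}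
    {p' q' : Q.Pt} (hp : p.1 = p'.1) (hq : q.1 = q'.1) :
    P.adjacencyGraph.Adj p q ↔ Q.adjacencyGraph.Adj p' q' := by
  subst h
  rw [Subtype.ext hp, Subtype.ext hq]

variable {P : PointConfig 6}

/-- The permutations realized by deformations preserve adjacency and dominance, because both are
locally constant along a deformation. -/
theorem preserves_of_mem_qMonodromyGroup (hP : P.IsTypical) (hc : P.IsCyclic)
    {σ : Equiv.Perm P.Pt} (hσ : σ ∈ P.qMonodromyGroup hP) :
    (∀ p q : P.Pt, P.adjacencyGraph.Adj (σ p) (σ q) ↔ P.adjacencyGraph.Adj p q) ∧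
      ∀ p : P.Pt, P.IsDominant (σ p).1 ↔ P.IsDominant p.1 := by
  obtain ⟨γ, hγ, hT⟩ := hσ
  choose s hs using hT
  obtain ⟨V₀, -, hVP⟩ := hc.exists_positive
  let e := hVP.equiv
  have hcyc : ∀ t, (γ t).IsCyclic := fun t =>
    (isCyclic_iff_of_path γ (fun t => (hγ t).1) 0 t).1 (by rw [γ.source]; exact hc)
  have hinj : ∀ t, Function.Injective fun i => s (e i) t := by
    intro t i j hij
    by_contra hne
    refine forall_ne_of_ne γ.continuous (s (e i)).continuous (s (e j)).continuous (hs _) (hs _)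
      ?_ t hij
    rw [(s (e i)).source, (s (e j)).source]
    exact fun h => hne (e.injective (Subtype.ext h))
  have hloc := fun t => eventually_exists_positive (γ := γ) (s := fun i => s (e i))
    (fun i => (s (e i)).continuous) (fun i => hs (e i)) hinj t (hγ t) (hcyc t)
  have hadj : ∀ i j, P.adjacencyGraph.Adj (σ (e i)) (σ (e j)) ↔
      P.adjacencyGraph.Adj (e i) (e j) := by
    intro i j
    have key := iff_of_eventually_iff (p := fun t =>
      (γ t).adjacencyGraph.Adj ⟨s (e i) t, hs _ t⟩ ⟨s (e j) t, hs _ t⟩) ?_ 1 0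
    · rwa [adjacencyGraph_adj_congr γ.target (p' := σ (e i)) (q' := σ (e j)) (s (e i)).target
        (s (e j)).target, adjacencyGraph_adj_congr γ.source (p' := e i) (q' := e j)
        (s (e i)).source (s (e j)).source] at key
    · intro t
      obtain ⟨τ, m, h⟩ := hloc t
      have h' : ∀ᶠ t' in 𝓝 t, (γ t').adjacencyGraph.Adj ⟨s (e i) t', hs _ t'⟩
          ⟨s (e j) t', hs _ t'⟩ ↔ HexAdj (τ i) (τ j) := by
        filter_upwards [h] with t' ⟨V, hV, hVγ, _, hVs⟩
        rw [← hVγ.adj_iff_hexAdj hV]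
        exact adjacencyGraph_adj_congr rfl (hVs i) (hVs j)
      filter_upwards [h'] with t' ht'
      exact ht'.trans h'.self_of_nhds.symm
  have hdom : ∀ i, P.IsDominant (σ (e i)).1 ↔ P.IsDominant (e i).1 := by
    intro i
    have key := iff_of_eventually_iff (p := fun t => (γ t).IsDominant (s (e i) t)) ?_ 1 0
    · simpa using key
    · intro t
      obtain ⟨τ, m, h⟩ := hloc t
      have h' : ∀ᶠ t' in 𝓝 t, (γ t').IsDominant (s (e i) t') ↔
          if (τ i).val % 2 = 0 then 0 < m else m < 0 := by
        filter_upwards [h] with t' ⟨V, hV, hVγ, hm, hVs⟩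
        rw [hVs i, hV.isDominant_iff hVγ]
        split_ifs
        · exact (pos_iff_pos_of_mul_pos hm).symm
        · exact (neg_iff_neg_of_mul_pos hm).symm
      filter_upwards [h'] with t' ht'
      exact ht'.trans h'.self_of_nhds.symm
  refine ⟨fun p q => ?_, fun p => ?_⟩
  · simpa using hadj (e.symm p) (e.symm q)
  · simpa using hdom (e.symm p)

end PointConfig

namespace Positive

variable {V : Fin 6 → Fin 3 → ℝ} {P : PointConfig 6}

/-- The dihedral permutations of the vertices of a hexagon are realized by deformations. -/
theorem permCongr_hexagonPerm_mem (hV : Positive V) (h : Represents V P) (hP : P.IsTypical)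
    (d : DihedralGroup 3) : h.equiv.permCongr (hexagonPerm d) ∈ P.qMonodromyGroup hP := by
  obtain ⟨s, hs, hpos, m, hm, hbr⟩ := hV.relabel_hexagonPerm d
  have h0 := (hV.isTypical_iff h).1 hP
  obtain ⟨γ, hγ, -, hT⟩ := hV.exists_deformation hpos h (h.relabel (hexagonPerm d) fun _ => hs)
    (by rw [hbr, mul_left_comm]; exact mul_pos hm (mul_self_pos.2 h0))
  refine ⟨γ, hγ, fun p => ?_⟩
  obtain ⟨i, rfl⟩ := h.equiv.surjective p
  simpa [pt_smul hs] using hT i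

/-- A permutation of the vertices of a hexagon that preserves adjacency and dominance is dihedral.
The dominant vertices are those of one parity. -/
theorem exists_permCongr_hexagonPerm_eq (hV : Positive V) (h : Represents V P) (hP : P.IsTypical)
    {σ : Equiv.Perm P.Pt}
    (hadj : ∀ p q : P.Pt, P.adjacencyGraph.Adj (σ p) (σ q) ↔ P.adjacencyGraph.Adj p q)
    (hdom : ∀ p : P.Pt, P.IsDominant (σ p).1 ↔ P.IsDominant p.1) :
    ∃ d, h.equiv.permCongr (hexagonPerm d) = σ := by
  have hτ : ∀ i, h.equiv (h.equiv.symm.permCongr σ i) = σ (h.equiv i) := by simp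
  obtain ⟨d, hd⟩ := exists_hexagonPerm_eq (τ := h.equiv.symm.permCongr σ)
    (fun i j => by
      rw [← h.adj_iff_hexAdj hV, ← h.adj_iff_hexAdj hV, hτ, hτ, hadj])
    (fun i => by
      have := hdom (h.equiv i)
      rw [← hτ, h.coe_equiv, h.coe_equiv, hV.isDominant_iff h, hV.isDominant_iff h] at this
      rcases ((hV.isTypical_iff h).1 hP).lt_or_gt with h0 | h0
      · simp only [h0, h0.not_gt] at this
        split_ifs at this <;> simp_all
      · simpa [h0, h0.not_gt] using this)
  refine ⟨d, ?_⟩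
  rw [hd]
  ext p
  simp

theorem nonempty_qMonodromyGroup_mulEquiv (hV : Positive V) (h : Represents V P)
    (hP : P.IsTypical) (hc : P.IsCyclic) :
    Nonempty (P.qMonodromyGroup hP ≃* DihedralGroup 3) := by
  let φ : DihedralGroup 3 →* Equiv.Perm P.Pt :=
    h.equiv.permCongrHom.toMonoidHom.comp hexagonPerm
  have hφ : Function.Injective φ := h.equiv.permCongrHom.injective.comp hexagonPerm_injective
  have hrange : φ.range = P.qMonodromyGroup hP := by
    ext σ
    constructor
    · rintro ⟨d, rfl⟩
      exact hV.permCongr_hexagonPerm_mem h hP d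
    · intro hσ
      obtain ⟨hadj, hdom⟩ := preserves_of_mem_qMonodromyGroup hP hc hσ
      exact hV.exists_permCongr_hexagonPerm_eq h hP hadj hdom
  exact ⟨((MonoidHom.ofInjective hφ).trans (MulEquiv.subgroupCongr hrange)).symm⟩

end Positive

end

theorem lemma2p2 :
    (∀ (P₀ P₁ : PointConfig 6) (p₀ p₁ : RP2),
      P₀.IsTypical → P₀.IsHexagonal → P₁.IsTypical → P₁.IsHexagonal →
      P₀.IsDominant p₀ → P₁.IsDominant p₁ →
      ∃ γ : Path P₀ P₁, PointConfig.IsQDeformation γ ∧ PointConfig.Takes γ p₀ p₁) ∧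
    (IsPathConnected PointConfig.typicalCyclicSpace ∧
      ∀ P ∈ PointConfig.typicalCyclicSpace,
        pathComponentIn (PointConfig.typicalSpace 6) P = PointConfig.typicalCyclicSpace) ∧
    (∀ (P : PointConfig 6) (hP : P.IsTypical), P.IsCyclic →
      (∀ σ : Equiv.Perm P.Pt, σ ∈ P.qMonodromyGroup hP ↔
        (∀ p q : P.Pt, P.adjacencyGraph.Adj (σ p) (σ q) ↔ P.adjacencyGraph.Adj p q) ∧
        ∀ p : P.Pt, P.IsDominant (σ p).1 ↔ P.IsDominant p.1) ∧
      Nonempty (P.qMonodromyGroup hP ≃* DihedralGroup 3)) := by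
  refine ⟨fun P₀ P₁ p₀ p₁ _ h₀ _ h₁ hp₀ hp₁ => exists_deformation_of_hexagonal h₀ h₁ hp₀ hp₁,
    ⟨isPathConnected_typicalCyclicSpace, fun P hP => PointConfig.pathComponentIn_typicalSpace hP⟩,
    fun P hP hc => ?_⟩
  obtain ⟨V, hV, h⟩ := hc.exists_positive
  refine ⟨fun σ => ⟨PointConfig.preserves_of_mem_qMonodromyGroup hP hc, ?_⟩,
    hV.nonempty_qMonodromyGroup_mulEquiv h hP hc⟩
  rintro ⟨hadj, hdom⟩
  obtain ⟨d, rfl⟩ := hV.exists_permCongr_hexagonPerm_eq h hP hadj hdom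
  exact hV.permCongr_hexagonPerm_mem h hP d
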